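/- Let $M$ be a smooth real manifold of dimension $d$ (Hausdorff, second countable). Let $\Gamma(\mathcal SM)$ be the space of smooth sections $a(x,y)=\sum_{p\ge 0}a_{i_1\dots i_p}(x)\,y^{i_1}\cdots y^{i_p}$ of the bundle of formally completed symmetric algebras of $T^*M$ (the $a_{i_1\dots i_p}$ are symmetric covariant tensors, the $y^i$ are formal fibre coordinates of $TM$), and put $\sigma(a)=a|_{y=0}$. Let $\nabla$ be a smooth torsion-free affine connection on $M$ with Christoffel symbols $\Gamma^k_{ij}$, let $A=\sum_{p\ge 2}dx^k A^j_{k i_1\dots i_p}(x)\,y^{i_1}\cdots y^{i_p}\,\partial/\partial y^j$ be a smooth one-form with values in formal fibrewise vector fields of degree at least two in $y$, and suppose that $$D=dx^i\Big(\frac{\partial}{\partial x^i}-\Gamma^k_{ij}(x)\,y^j\frac{\partial}{\partial y^k}-\frac{\partial}{\partial y^i}\Big)+A$$ satisfies $D^2=0$ (such a $D$ is called a Fedosov differential). Let $D_{poly}(M)=\bigoplus_{k\ge -1}D^k_{poly}(M)$, where $D^k_{poly}(M)$ is the space of polydifferential operators $C^\infty(M)^{\otimes (k+1)}\to C^\infty(M)$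 (smooth coefficients, finite order), and $T_{poly}(M)=\bigoplus_{k\ge -1}\Gamma(\wedge^{k+1}TM)$; a polyvector field $w$ of degree $k$ is regarded as the polydifferential operator $(a_0,\dots,a_k)\mapsto\langle da_0\wedge\dots\wedge da_k,w\rangle$. Let $\mathcal F^0\mathcal D_{poly}=\bigoplus_{k\ge -1}\mathcal F^0\mathcal D^k_{poly}$, where $\mathcal F^0\mathcal D^k_{poly}$ is the space of maps $\Gamma(\mathcal SM)^{\otimes(k+1)}\to\Gamma(\mathcal SM)$ of finite order that have in all local coordinates the form $\sum_{\alpha_0,\dots,\alpha_k}P^{\alpha_0\dots\alpha_k}(x)\,\partial_y^{\alpha_0}\otimes\dots\otimes\partial_y^{\alpha_k}$ with smooth coefficients (constant in $y$), and let $\mathcal F^0\mathcal T_{poly}\subset\mathcal F^0\mathcal D_{poly}$ be the subspace of fibrewise polyvector fields with coefficients constant in $y$, of the form $v^{j_0\dots j_k}(x)\,\partial_{y^{j_0}}\wedge\dots\wedge\partial_{y^{j_k}}$ in degree $k$. Then for every $a\in C^\infty(M)$ there is exactly one $\tau(a)\in\Gamma(\mathcal SM)$ with $D\tau(a)=0$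 and $\sigma(\tau(a))=a$, and the formula $$\mu(P)(a_0,\dots,a_k)=\sigma\big(P(\tau(a_0),\dots,\tau(a_k))\big),\qquad P\in\mathcal F^0\mathcal D^k_{poly},$$ defines a degree-preserving isomorphism of vector spaces $\mu:\mathcal F^0\mathcal D_{poly}\to D_{poly}(M)$. Its restriction to $\mathcal F^0\mathcal T_{poly}$ is a degree-preserving isomorphism of vector spaces from $\mathcal F^0\mathcal T_{poly}$ onto $T_{poly}(M)$. -/

import Mathlib

open scoped Manifold ContDiff DirectSum ExteriorAlgebra

noncomputable section

namespace Fedosov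

/-- Formal power series in the fibre coordinates `y¹, …, yᵈ`. -/
abbrev Series (d : ℕ) : Type := MvPowerSeries (Fin d) ℝ

/-- The `i`-th standard basis vector of `ℝᵈ`. -/
abbrev stdVec {d : ℕ} (i : Fin d) : EuclideanSpace ℝ (Fin d) := EuclideanSpace.single i 1

section Charts

variable {d : ℕ} {M : Type*} [TopologicalSpace M] [ChartedSpace (EuclideanSpace ℝ (Fin d)) M]

/-- The smooth charts `x = (x¹, …, xᵈ)` of `M`: all charts of its maximal smooth atlas. -/
abbrev charts (d : ℕ) (M : Type*) [TopologicalSpace M]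
    [ChartedSpace (EuclideanSpace ℝ (Fin d)) M] :
    Set (OpenPartialHomeomorph M (EuclideanSpace ℝ (Fin d))) :=
  IsManifold.maximalAtlas (𝓡 d) ∞ M

/-- The differential `df` at `x`, as a linear form on `TₓM`. -/
def dif (f : M → ℝ) (x : M) : Module.Dual ℝ (TangentSpace (𝓡 d) x) :=
  (mvfderiv (𝓡 d) f x).toLinearMap

/-- The coordinate covector `dxᵏ` at `x` of a chart. -/
def coframe (φ : OpenPartialHomeomorph M (EuclideanSpace ℝ (Fin d))) (k : Fin d) (x : M) :
    Module.Dual ℝ (TangentSpace (𝓡 d) x) :=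
  dif (fun z => φ z k) x

/-- The coordinate vector field `∂/∂xⁱ` of a chart (only used on the domain of the chart). -/
def frame (φ : OpenPartialHomeomorph M (EuclideanSpace ℝ (Fin d))) (i : Fin d) (x : M) :
    TangentSpace (𝓡 d) x :=
  (mvfderiv (𝓡 d) φ x).inverse (stdVec i)

/-- The `m`-th standard coordinate of a tangent vector; Mathlib's `TₓM` is the model space `ℝᵈ`. -/
def stdCoord {x : M} (v : TangentSpace (𝓡 d) x) (m : Fin d) : ℝ :=
  WithLp.ofLp (p := 2) (V := Fin d → ℝ) v m

/-- The `m`-th standard basis vector of `TₓM`, which is the model space `ℝᵈ` in Mathlib. -/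
def stdTangent (x : M) (m : Fin d) : TangentSpace (𝓡 d) x := (stdVec m : EuclideanSpace ℝ (Fin d))

/-- A formal function `f` on `TₓM`, given as a power series in the standard coordinates of `TₓM`,
rewritten in the fibre coordinates `yⁱ` of the chart `φ`, that is, the power series
`f (∑ᵢ yⁱ ∂/∂xⁱ)`. -/
def inChart (φ : OpenPartialHomeomorph M (EuclideanSpace ℝ (Fin d))) (x : M) (f : Series d) :
    Series d :=
  MvPowerSeries.subst
    (fun m => ∑ i, MvPowerSeries.C (stdCoord (frame φ i x) m) * MvPowerSeries.X i) f

theorem hasSubst_frame (φ : OpenPartialHomeomorph M (EuclideanSpace ℝ (Fin d))) (x : M) :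
    MvPowerSeries.HasSubst (fun m : Fin d =>
      ∑ i, MvPowerSeries.C (stdCoord (frame φ i x) m) * (MvPowerSeries.X i : Series d)) :=
  MvPowerSeries.hasSubst_of_constantCoeff_zero (fun m => by simp)

theorem inChart_add (φ : OpenPartialHomeomorph M (EuclideanSpace ℝ (Fin d))) (x : M)
    (f g : Series d) : inChart φ x (f + g) = inChart φ x f + inChart φ x g :=
  MvPowerSeries.subst_add (hasSubst_frame φ x) f g

theorem inChart_smul (φ : OpenPartialHomeomorph M (EuclideanSpace ℝ (Fin d))) (x : M)
    (r : ℝ) (f : Series d) : inChart φ x (r • f) = r • inChart φ x f :=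
  MvPowerSeries.subst_smul (hasSubst_frame φ x) r f

theorem inChart_zero (φ : OpenPartialHomeomorph M (EuclideanSpace ℝ (Fin d))) (x : M) :
    inChart φ x 0 = 0 := by
  simpa using inChart_smul φ x 0 0

end Charts

section Sections

variable (d : ℕ) (M : Type*) [TopologicalSpace M] [ChartedSpace (EuclideanSpace ℝ (Fin d)) M]

/-- `Γ(𝒮M)`: smooth sections of the bundle of formally completed symmetric algebras of `T*M`.
The value at `x` is a formal power series on `TₓM`; in every chart the coefficients
`a_{i₁…iₚ}(x)` of `a(x,y) = ∑ a_{i₁…iₚ}(x) y^{i₁}⋯y^{iₚ}` are smooth. -/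
def SymSection : Submodule ℝ (M → Series d) where
  carrier := {s | ∀ φ ∈ charts d M, ∀ m : Fin d →₀ ℕ,
    ContMDiffOn (𝓡 d) 𝓘(ℝ, ℝ) ∞
      (fun x => MvPowerSeries.coeff m (inChart φ x (s x))) φ.source}
  add_mem' := by
    intro s t hs ht φ hφ m
    have h := (hs φ hφ m).add (ht φ hφ m)
    refine h.congr fun x _ => ?_
    simp [inChart_add]
  zero_mem' := by
    intro φ hφ m
    simpa [inChart_zero] using contMDiffOn_const
  smul_mem' := by
    intro r s hs φ hφ m
    have h := (contMDiffOn_const (c := r)).mul (hs φ hφ m)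
    refine h.congr fun x _ => ?_
    simp [inChart_smul]

variable {d M}

/-- `σ(a) = a|_{y = 0}`. -/
def symbolMap (s : SymSection d M) (x : M) : ℝ := MvPowerSeries.constantCoeff (s.1 x)

/-- The expression `a(x,y)` of a section in a chart, as a function of the coordinates of `x`. -/
def localExpr (φ : OpenPartialHomeomorph M (EuclideanSpace ℝ (Fin d))) (s : SymSection d M)
    (t : EuclideanSpace ℝ (Fin d)) : Series d :=
  inChart φ (φ.symm t) (s.1 (φ.symm t))

variable (d M)

/-- One-forms `A = ∑_{p ≥ 2} dxᵏ Aʲ_{k i₁…iₚ}(x) y^{i₁}⋯y^{iₚ} ∂/∂yʲ` on `M` with values in the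
formal fibrewise vector fields whose coefficients start in degree two in `y`.
`A x k j` is the coefficient of `dxᵏ ∂/∂yʲ` with respect to the standard basis of `TₓM`. -/
structure FibreVectorOneForm where
  /-- the components in the standard basis of the tangent space -/
  toFun : M → Fin d → Fin d → Series d
  /-- there are no terms of degree less than two in `y` -/
  order_two : ∀ x k j (m : Fin d →₀ ℕ), m.degree < 2 → MvPowerSeries.coeff m (toFun x k j) = 0
  /-- in every chart the components are smooth -/
  smooth : ∀ φ ∈ charts d M, ∀ (i j : Fin d) (m : Fin d →₀ ℕ),
    ContMDiffOn (𝓡 d) 𝓘(ℝ, ℝ) ∞ (fun x => MvPowerSeries.coeff m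
      (∑ k, ∑ l, MvPowerSeries.C (stdCoord (frame φ i x) k * coframe φ j x (stdTangent x l)) *
        inChart φ x (toFun x k l))) φ.source

variable {d M}

/-- The component `Aʲᵢ(x,y)` of `A = dxⁱ Aʲᵢ(x,y) ∂/∂yʲ` in a chart. -/
def FibreVectorOneForm.comp (A : FibreVectorOneForm d M)
    (φ : OpenPartialHomeomorph M (EuclideanSpace ℝ (Fin d))) (i j : Fin d) (x : M) : Series d :=
  ∑ k, ∑ l, MvPowerSeries.C (stdCoord (frame φ i x) k * coframe φ j x (stdTangent x l)) *
    inChart φ x (A.toFun x k l)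

variable [IsManifold (𝓡 d) ∞ M]

/-- The Christoffel symbols `Γᵏᵢⱼ = dxᵏ(∇_{∂ᵢ} ∂ⱼ)` of an affine connection in a chart. -/
def christoffel (cov : CovariantDerivative (𝓡 d) (EuclideanSpace ℝ (Fin d))
      (TangentSpace (𝓡 d) : M → Type _))
    (φ : OpenPartialHomeomorph M (EuclideanSpace ℝ (Fin d))) (k i j : Fin d) (x : M) : ℝ :=
  coframe φ k x (cov (frame φ j) x (frame φ i x))

/-- `∂a/∂xⁱ` for a power series `a(x,y)` in `y` with coefficients depending on `x`. -/
def xDeriv (i : Fin d) (a : EuclideanSpace ℝ (Fin d) → Series d)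
    (t : EuclideanSpace ℝ (Fin d)) : Series d :=
  fun m => fderiv ℝ (fun u => MvPowerSeries.coeff m (a u)) t (stdVec i)

/-- The component `Dᵢ` of `D = ∇ - δ + A = dxⁱ Dᵢ` in a chart, acting on `a(x,y)`:
`Dᵢ a = ∂a/∂xⁱ - Γᵏᵢⱼ yʲ ∂a/∂yᵏ - ∂a/∂yⁱ + Aᵏᵢ ∂a/∂yᵏ`. -/
def Dcomp (cov : CovariantDerivative (𝓡 d) (EuclideanSpace ℝ (Fin d))
      (TangentSpace (𝓡 d) : M → Type _))
    (A : FibreVectorOneForm d M) (φ : OpenPartialHomeomorph M (EuclideanSpace ℝ (Fin d)))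
    (i : Fin d) (a : EuclideanSpace ℝ (Fin d) → Series d)
    (t : EuclideanSpace ℝ (Fin d)) : Series d :=
  xDeriv i a t
    - ∑ j, ∑ k, MvPowerSeries.C (christoffel cov φ k i j (φ.symm t)) * MvPowerSeries.X j *
        MvPowerSeries.pderiv ℝ k (a t)
    - MvPowerSeries.pderiv ℝ i (a t)
    + ∑ k, A.comp φ i k (φ.symm t) * MvPowerSeries.pderiv ℝ k (a t)

/-- `D a = 0` for a section `a` of `𝒮M`. -/
def IsFlat (cov : CovariantDerivative (𝓡 d) (EuclideanSpace ℝ (Fin d))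
      (TangentSpace (𝓡 d) : M → Type _))
    (A : FibreVectorOneForm d M) (s : SymSection d M) : Prop :=
  ∀ φ ∈ charts d M, ∀ t ∈ φ.target, ∀ i, Dcomp cov A φ i (localExpr φ s) t = 0

/-- `D² = 0`, i.e. `D = ∇ - δ + A` is a Fedosov differential. Since `D = dxⁱ Dᵢ` satisfies
`D² a = dxⁱ dxʲ Dᵢ Dⱼ a`, and `D²` is linear over exterior forms on `M`, this says that the
components of `D` in each chart commute on sections of `𝒮M`. -/
def IsFedosov (cov : CovariantDerivative (𝓡 d) (EuclideanSpace ℝ (Fin d))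
      (TangentSpace (𝓡 d) : M → Type _))
    (A : FibreVectorOneForm d M) : Prop :=
  ∀ s : SymSection d M, ∀ φ ∈ charts d M, ∀ t ∈ φ.target, ∀ i j,
    Dcomp cov A φ i (Dcomp cov A φ j (localExpr φ s)) t =
      Dcomp cov A φ j (Dcomp cov A φ i (localExpr φ s)) t

end Sections

section Operators

/-- `∂/∂y^α = ∂/∂y^{j₁} ⋯ ∂/∂y^{jₗ}` for a multi-index `α = j₁…jₗ`. -/
def yPartial {d : ℕ} (α : List (Fin d)) (f : Series d) : Series d :=
  α.foldr (fun j g => MvPowerSeries.pderiv ℝ j g) f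

/-- `∂/∂x^α = ∂/∂x^{j₁} ⋯ ∂/∂x^{jₗ}` for a multi-index `α = j₁…jₗ`. -/
def xPartial {d : ℕ} (α : List (Fin d)) (f : EuclideanSpace ℝ (Fin d) → ℝ) :
    EuclideanSpace ℝ (Fin d) → ℝ :=
  α.foldr (fun j g t => fderiv ℝ g t (stdVec j)) f

variable (d : ℕ) (M : Type*) [TopologicalSpace M] [ChartedSpace (EuclideanSpace ℝ (Fin d)) M]

/-- The smooth real functions on `M`. -/
abbrev Smooth : Type _ := C^∞⟮𝓡 d, M; 𝓘(ℝ, ℝ), ℝ⟯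

/-- `D_poly^{n-1}(M)`: polydifferential operators of rank `n` (degree `n - 1`), i.e. maps
`C^∞(M)^{⊗n} → C^∞(M)` of finite order that have in every chart the form
`(a₁, …, aₙ) ↦ ∑_α c_α(x) ∂_x^{α₁} a₁ ⋯ ∂_x^{αₙ} aₙ` with smooth `c_α`. -/
def PolyDiff (n : ℕ) :
    Submodule ℝ (MultilinearMap ℝ (fun _ : Fin n => Smooth d M) (Smooth d M)) where
  carrier := {Q | ∃ S : Finset (Fin n → List (Fin d)), ∀ φ ∈ charts d M,
    ∃ c : (Fin n → List (Fin d)) → M → ℝ,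
      (∀ α, ContMDiffOn (𝓡 d) 𝓘(ℝ, ℝ) ∞ (c α) φ.source) ∧
      ∀ a : Fin n → Smooth d M, ∀ x ∈ φ.source,
        Q a x = ∑ α ∈ S, c α x * ∏ i, xPartial (α i) (a i ∘ φ.symm) (φ x)}
  add_mem' := by
    classical
    rintro P Q ⟨S, hS⟩ ⟨T, hT⟩
    refine ⟨S ∪ T, fun φ hφ => ?_⟩
    obtain ⟨c, hc, hP⟩ := hS φ hφ
    obtain ⟨e, he, hQ⟩ := hT φ hφ
    refine ⟨fun α x => (if α ∈ S then c α x else 0) + (if α ∈ T then e α x else 0), ?_, ?_⟩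
    · intro α
      by_cases h1 : α ∈ S <;> by_cases h2 : α ∈ T <;> simp only [h1, h2, if_true, if_false]
      · exact (hc α).add (he α)
      · exact (hc α).add contMDiffOn_const
      · exact contMDiffOn_const.add (he α)
      · exact contMDiffOn_const
    · intro a x hx
      have h : (P + Q) a x = P a x + Q a x := rfl
      rw [h, hP a x hx, hQ a x hx]
      simp only [add_mul, ite_mul, zero_mul, Finset.sum_add_distrib, ← Finset.sum_filter,
        Finset.filter_mem_eq_inter, Finset.union_inter_cancel_left,
        Finset.union_inter_cancel_right]
  zero_mem' := ⟨∅, fun φ _ => ⟨fun _ _ => 0, fun _ => contMDiffOn_const, fun a x _ => by simp⟩⟩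
  smul_mem' := by
    rintro r P ⟨S, hS⟩
    refine ⟨S, fun φ hφ => ?_⟩
    obtain ⟨c, hc, hP⟩ := hS φ hφ
    refine ⟨fun α x => r * c α x, fun α => contMDiffOn_const.mul (hc α), fun a x hx => ?_⟩
    have h : (r • P) a x = r * P a x := rfl
    rw [h, hP a x hx, Finset.mul_sum]
    simp only [mul_assoc]

/-- `ℱ⁰𝒟_poly^{n-1}`: formal fibrewise polydifferential operators on `𝒮M` of rank `n`
(degree `n - 1`) with coefficients constant in `y`, i.e. maps `Γ(𝒮M)^{⊗n} → Γ(𝒮M)` of finite order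
that have in every chart the form `∑_α c_α(x) ∂/∂y^{α₁} ⊗ ⋯ ⊗ ∂/∂y^{αₙ}` with smooth `c_α`.
Such maps are automatically multilinear over `C^∞(M)`. -/
def FibrePolyDiff (n : ℕ) :
    Submodule ℝ (MultilinearMap ℝ (fun _ : Fin n => SymSection d M) (SymSection d M)) where
  carrier := {P | ∃ S : Finset (Fin n → List (Fin d)), ∀ φ ∈ charts d M,
    ∃ c : (Fin n → List (Fin d)) → M → ℝ,
      (∀ α, ContMDiffOn (𝓡 d) 𝓘(ℝ, ℝ) ∞ (c α) φ.source) ∧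
      ∀ s : Fin n → SymSection d M, ∀ x ∈ φ.source,
        inChart φ x ((P s).1 x) =
          ∑ α ∈ S, c α x • ∏ i, yPartial (α i) (inChart φ x ((s i).1 x))}
  add_mem' := by
    classical
    rintro P Q ⟨S, hS⟩ ⟨T, hT⟩
    refine ⟨S ∪ T, fun φ hφ => ?_⟩
    obtain ⟨c, hc, hP⟩ := hS φ hφ
    obtain ⟨e, he, hQ⟩ := hT φ hφ
    refine ⟨fun α x => (if α ∈ S then c α x else 0) + (if α ∈ T then e α x else 0), ?_, ?_⟩
    · intro α
      by_cases h1 : α ∈ S <;> by_cases h2 : α ∈ T <;> simp only [h1, h2, if_true, if_false]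
      · exact (hc α).add (he α)
      · exact (hc α).add contMDiffOn_const
      · exact contMDiffOn_const.add (he α)
      · exact contMDiffOn_const
    · intro s x hx
      have h : ((P + Q) s).1 x = (P s).1 x + (Q s).1 x := rfl
      rw [h, inChart_add, hP s x hx, hQ s x hx]
      simp only [add_smul, ite_smul, zero_smul, Finset.sum_add_distrib, ← Finset.sum_filter,
        Finset.filter_mem_eq_inter, Finset.union_inter_cancel_left,
        Finset.union_inter_cancel_right]
  zero_mem' := ⟨∅, fun φ _ => ⟨fun _ _ => 0, fun _ => contMDiffOn_const, fun s x _ => by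
    have h : ((0 : MultilinearMap ℝ (fun _ : Fin n => SymSection d M) (SymSection d M)) s).1 x
      = 0 := rfl
    simp [inChart_zero]⟩⟩
  smul_mem' := by
    rintro r P ⟨S, hS⟩
    refine ⟨S, fun φ hφ => ?_⟩
    obtain ⟨c, hc, hP⟩ := hS φ hφ
    refine ⟨fun α x => r * c α x, fun α => contMDiffOn_const.mul (hc α), fun s x hx => ?_⟩
    have h : ((r • P) s).1 x = r • (P s).1 x := rfl
    rw [h, inChart_smul, hP s x hx, Finset.smul_sum]
    simp only [mul_smul]

/-- `ℱ⁰𝒯_poly^{n-1}`: formal fibrewise polyvector fields of degree `n - 1` with coefficients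
constant in `y`, as a subspace of `ℱ⁰𝒟_poly^{n-1}`: they have in every chart the form
`v^{j₁…jₙ}(x) ∂/∂y^{j₁} ∧ ⋯ ∧ ∂/∂y^{jₙ}` with smooth `v^{j₁…jₙ}`, antisymmetric in `j₁, …, jₙ`. -/
def FibrePolyVector (n : ℕ) : Submodule ℝ (FibrePolyDiff d M n) where
  carrier := {P | ∀ φ ∈ charts d M, ∃ v : (Fin n → Fin d) → M → ℝ,
      (∀ J, ContMDiffOn (𝓡 d) 𝓘(ℝ, ℝ) ∞ (v J) φ.source) ∧
      (∀ (π : Equiv.Perm (Fin n)) (J : Fin n → Fin d) (x : M),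
        v (J ∘ π) x = ((Equiv.Perm.sign π : ℤ) : ℝ) * v J x) ∧
      ∀ s : Fin n → SymSection d M, ∀ x ∈ φ.source,
        inChart φ x ((P.1 s).1 x) =
          ∑ J : Fin n → Fin d, v J x •
            ∏ i, MvPowerSeries.pderiv ℝ (J i) (inChart φ x ((s i).1 x))}
  add_mem' := by
    rintro P Q hP hQ φ hφ
    obtain ⟨v, hv, av, fv⟩ := hP φ hφ
    obtain ⟨w, hw, aw, fw⟩ := hQ φ hφ
    refine ⟨fun J x => v J x + w J x, fun J => (hv J).add (hw J), fun π J x => ?_,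
      fun s x hx => ?_⟩
    · simp only [av, aw, mul_add]
    · have h : (((P + Q).1 s).1) x = (P.1 s).1 x + (Q.1 s).1 x := rfl
      rw [h, inChart_add, fv s x hx, fw s x hx]
      simp only [add_smul, Finset.sum_add_distrib]
  zero_mem' := by
    intro φ hφ
    refine ⟨fun _ _ => 0, fun _ => contMDiffOn_const, fun _ _ _ => by simp, fun s x hx => ?_⟩
    simp [inChart_zero]
  smul_mem' := by
    rintro r P hP φ hφ
    obtain ⟨v, hv, av, fv⟩ := hP φ hφ
    refine ⟨fun J x => r * v J x, fun J => contMDiffOn_const.mul (hv J), fun π J x => ?_,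
      fun s x hx => ?_⟩
    · simp only [av, mul_left_comm]
    · have h : (((r • P).1 s).1) x = r • (P.1 s).1 x := rfl
      rw [h, inChart_smul, fv s x hx, Finset.smul_sum]
      simp only [mul_smul]

variable {d M}

/-- The pairing `⟨θ₁ ∧ ⋯ ∧ θₙ, w⟩` of linear forms with `w ∈ ⋀ⁿ TₓM`. -/
def pairing {n : ℕ} {x : M} (θ : Fin n → Module.Dual ℝ (TangentSpace (𝓡 d) x))
    (w : ⋀[ℝ]^n (TangentSpace (𝓡 d) x)) : ℝ :=
  exteriorPower.pairingDual ℝ (TangentSpace (𝓡 d) x) n (exteriorPower.ιMulti ℝ n θ) w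

variable (d M)

/-- `T_poly^{n-1}(M) = Γ(⋀ⁿ TM)`: smooth polyvector fields, i.e. families `w x ∈ ⋀ⁿ TₓM` whose
components `⟨dx^{j₁} ∧ ⋯ ∧ dx^{jₙ}, w⟩` are smooth in every chart. -/
def PolyVector (n : ℕ) : Submodule ℝ (∀ x : M, ⋀[ℝ]^n (TangentSpace (𝓡 d) x)) where
  carrier := {w | ∀ φ ∈ charts d M, ∀ J : Fin n → Fin d,
    ContMDiffOn (𝓡 d) 𝓘(ℝ, ℝ) ∞ (fun x => pairing (fun i => coframe φ (J i) x) (w x)) φ.source}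
  add_mem' := by
    intro v w hv hw φ hφ J
    have h := (hv φ hφ J).add (hw φ hφ J)
    refine h.congr fun x _ => ?_
    simp [pairing]
  zero_mem' := by
    intro φ hφ J
    simpa [pairing] using contMDiffOn_const
  smul_mem' := by
    intro r w hw φ hφ J
    have h := (contMDiffOn_const (c := r)).mul (hw φ hφ J)
    refine h.congr fun x _ => ?_
    simp [pairing]

end Operators

end Fedosov

end

/-!
A flat section is determined by its symbol, and its jet at a point in the fibre direction carries
the same information as the jet of its symbol at that point. Everything follows from this.

**Flat sections.** Write `Dᵢ = ∂/∂xⁱ + Wᵢᵏ ∂/∂yᵏ - ∂/∂yⁱ` in a chart, where the series `Wᵢᵏ` have no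
constant term (`connForm`, `fibreConn`). Contracting with `yⁱ` turns `Dᵢ u = 0` into `∑ yⁱ ∂u/∂yⁱ =
∑ yⁱ (∂/∂xⁱ + Wᵢᵏ ∂/∂yᵏ) u`. The left side multiplies the part of degree `p` by `p`, and on the
right side the part of degree `p` depends only on the parts of `u` of degree less than `p`. So this
radial equation has exactly one solution with a given `u|_{y = 0}`, and it is smooth (`flatLift`,
`IsRadiallyFlat.eq`). The solution is flat: since the `Dᵢ` commute, `∂(Dⱼ u)/∂yⁱ - ∂(Dᵢ u)/∂yʲ` is
of the same order as the `Dᵢ u`, so the lowest part of `(Dᵢ u)ᵢ` is a closed one-form in `y`; its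
contraction with `yⁱ` vanishes, hence so does the form itself (`IsRadiallyFlat.flat`). As `D` does
not depend on the chart (`Dcomp_linSubst`), the local solutions agree on overlaps by uniqueness and
define `τ` (`lift`, `isFlat_iff_eq_lift`).

**Jets.** For a flat family, `∂u/∂yⁱ = (∂/∂xⁱ + Wᵢᵏ ∂/∂yᵏ) u`. By induction on the order, the
derivatives `∂_x^α a` and the numbers `∂_y^α τ(a)|_{y = 0}` are combinations of each other with
smooth coefficients, of the same order (`smoothComb_xPartial`, `smoothComb_yJet`). This turns
fibrewise operators into differential operators on `M` and vice versa. Moreover `a ↦ τ(a)` is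
multiplicative, and functions with prescribed differential at a point exist, so flat sections have
arbitrary jets at any point (`exists_lift_jet`). An operator with coefficients constant in `y`
commutes with the `∂/∂yⁱ`, hence is determined by the constant terms of its values, hence by its
action on flat sections (`linSubst_polyOp_eq`). This gives injectivity, and also shows that the
local fibrewise operators constructed from a differential operator in the charts fit together, which
gives surjectivity (`descendEquiv`).

**Polyvector fields.** In degree one, `∂_{yʲ} τ(a)|_{y = 0} = ∂a/∂xʲ`. So `μ` sends the fibrewise
polyvector field with components `v^{j₁…jₙ}` to the polyvector field with the same components, once
the latter is normalised by `1/n!` (`frameVector`, `exists_polyVectorEquiv`).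
-/

noncomputable section

namespace Fedosov

open MvPowerSeries

/-! ### Formal power series in the fibre coordinates -/

section Series

variable {d : ℕ}

theorem le_order_add {n : ℕ∞} {f g : Series d} (hf : n ≤ order f) (hg : n ≤ order g) :
    n ≤ order (f + g) :=
  (le_min hf hg).trans min_order_le_add

theorem le_order_sub {n : ℕ∞} {f g : Series d} (hf : n ≤ order f) (hg : n ≤ order g) :
    n ≤ order (f - g) := by
  rw [sub_eq_add_neg]
  exact le_order_add hf (by rwa [order_neg])

theorem le_order_sum {ι : Type*} {n : ℕ∞} (s : Finset ι) {f : ι → Series d}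
    (hf : ∀ i ∈ s, n ≤ order (f i)) : n ≤ order (∑ i ∈ s, f i) := by
  classical
  induction s using Finset.induction_on with
  | empty => simp
  | insert i s hi ih =>
    rw [Finset.sum_insert hi]
    exact le_order_add (hf i (by simp)) (ih fun j hj => hf j (by simp [hj]))

theorem le_order_mul_left {n : ℕ∞} (f : Series d) {g : Series d} (hg : n ≤ order g) :
    n ≤ order (f * g) :=
  (hg.trans (le_add_of_nonneg_left zero_le)).trans le_order_mul

theorem le_order_mul_of_le {m n : ℕ} {f g : Series d} (hf : m ≤ order f) (hg : n ≤ order g) :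
    ((m + n : ℕ) : ℕ∞) ≤ order (f * g) := by
  push_cast
  exact (add_le_add hf hg).trans le_order_mul

theorem one_le_order {f : Series d} (h : constantCoeff f = 0) : ((1 : ℕ) : ℕ∞) ≤ order f := by
  simpa using one_le_order_iff_constCoeff_eq_zero.2 h

theorem le_order_X_mul {n : ℕ} (i : Fin d) {g : Series d} (hg : (n : ℕ∞) ≤ order g) :
    ((n + 1 : ℕ) : ℕ∞) ≤ order (X i * g) := by
  rw [add_comm]
  exact le_order_mul_of_le (one_le_order (by simp)) hg

theorem le_order_pderiv {n : ℕ} (i : Fin d) {f : Series d}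
    (hf : ((n + 1 : ℕ) : ℕ∞) ≤ order f) : (n : ℕ∞) ≤ order (pderiv ℝ i f) := by
  refine nat_le_order fun m hm => ?_
  rw [coeff_pderiv, coeff_of_lt_order, zero_mul]
  refine lt_of_lt_of_le ?_ hf
  rw [map_add, Finsupp.degree_single]
  exact_mod_cast Nat.add_lt_add_right hm 1

theorem eq_zero_of_forall_le_order {f : Series d} (h : ∀ n : ℕ, (n : ℕ∞) ≤ order f) : f = 0 :=
  order_eq_top_iff.1 (ENat.eq_top_iff_forall_ge.2 h)

theorem coeff_eq_of_le_order_sub {n : ℕ} {f g : Series d} (h : (n : ℕ∞) ≤ order (f - g))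
    {m : Fin d →₀ ℕ} (hm : m.degree < n) : coeff m f = coeff m g := by
  have := coeff_of_lt_order (f := f - g) (d := m) (lt_of_lt_of_le (by exact_mod_cast hm) h)
  rwa [map_sub, sub_eq_zero] at this

theorem le_order_sub_of_coeff_eq {n : ℕ} {f g : Series d}
    (h : ∀ m : Fin d →₀ ℕ, m.degree < n → coeff m f = coeff m g) :
    (n : ℕ∞) ≤ order (f - g) :=
  nat_le_order fun m hm => by rw [map_sub, h m hm, sub_self]

theorem le_order_sub_truncTotal (n : ℕ) (f : Series d) :
    (n : ℕ∞) ≤ order (f - ((truncTotal n f : MvPolynomial (Fin d) ℝ) : Series d)) :=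
  le_order_sub_of_coeff_eq fun m hm => by
    rw [MvPolynomial.coeff_coe, coeff_truncTotal _ hm]

theorem pderiv_comm (i j : Fin d) (f : Series d) :
    pderiv ℝ i (pderiv ℝ j f) = pderiv ℝ j (pderiv ℝ i f) := by
  ext m
  rw [coeff_pderiv, coeff_pderiv, coeff_pderiv, coeff_pderiv, add_right_comm]
  by_cases h : i = j
  · subst h; rfl
  · simp [h, Ne.symm h]
    ring

theorem coeff_X_mul_pderiv (i : Fin d) (f : Series d) (m : Fin d →₀ ℕ) :
    coeff m (X i * pderiv ℝ i f) = m i * coeff m f := by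
  classical
  rw [X, coeff_monomial_mul]
  by_cases h : Finsupp.single i 1 ≤ m
  · have h1 : 1 ≤ m i := by simpa using h i
    rw [if_pos h, coeff_pderiv, tsub_add_cancel_of_le h, Finsupp.tsub_apply,
      Finsupp.single_eq_same, Nat.cast_sub h1]
    ring
  · have h1 : m i = 0 := by
      by_contra h0
      refine h fun j => ?_
      by_cases hj : j = i
      · subst hj; simp; omega
      · simp [hj]
    rw [if_neg h, h1]
    simp

/-- Euler's formula: `∑ᵢ yⁱ ∂/∂yⁱ` multiplies a monomial by its degree. -/
theorem coeff_euler (f : Series d) (m : Fin d →₀ ℕ) :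
    coeff m (∑ i, X i * pderiv ℝ i f) = m.degree * coeff m f := by
  rw [map_sum, Finsupp.degree_eq_sum, Nat.cast_sum, Finset.sum_mul]
  exact Finset.sum_congr rfl fun i _ => coeff_X_mul_pderiv i f m

/-- The linear form `∑ᵢ Jₘᵢ yⁱ`. -/
def linForm (J : Fin d → Fin d → ℝ) (m : Fin d) : Series d := ∑ i, C (J m i) * X i

/-- The linear substitution `f(y) ↦ f(J y)`. -/
def linSubst (J : Fin d → Fin d → ℝ) (f : Series d) : Series d := subst (linForm J) f

@[simp]
theorem constantCoeff_linForm (J : Fin d → Fin d → ℝ) (m : Fin d) :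
    constantCoeff (linForm J m) = 0 := by
  simp [linForm]

theorem hasSubst_linForm (J : Fin d → Fin d → ℝ) : HasSubst (linForm J) :=
  hasSubst_of_constantCoeff_zero fun m => by simp

theorem linSubst_add (J : Fin d → Fin d → ℝ) (f g : Series d) :
    linSubst J (f + g) = linSubst J f + linSubst J g := subst_add (hasSubst_linForm J) f g

theorem linSubst_sub (J : Fin d → Fin d → ℝ) (f g : Series d) :
    linSubst J (f - g) = linSubst J f - linSubst J g := subst_sub (hasSubst_linForm J) f g

theorem linSubst_mul (J : Fin d → Fin d → ℝ) (f g : Series d) :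
    linSubst J (f * g) = linSubst J f * linSubst J g := subst_mul (hasSubst_linForm J) f g

theorem linSubst_smul (J : Fin d → Fin d → ℝ) (r : ℝ) (f : Series d) :
    linSubst J (r • f) = r • linSubst J f := subst_smul (hasSubst_linForm J) r f

theorem linSubst_sum {ι : Type*} (J : Fin d → Fin d → ℝ) (s : Finset ι) (f : ι → Series d) :
    linSubst J (∑ i ∈ s, f i) = ∑ i ∈ s, linSubst J (f i) := by
  simp only [linSubst, ← substAlgHom_apply (hasSubst_linForm J), map_sum]

@[simp]
theorem linSubst_C (J : Fin d → Fin d → ℝ) (r : ℝ) : linSubst J (C r : Series d) = C r :=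
  subst_C r

@[simp]
theorem linSubst_one (J : Fin d → Fin d → ℝ) : linSubst J (1 : Series d) = 1 := by
  rw [← map_one C, linSubst_C]

@[simp]
theorem linSubst_zero (J : Fin d → Fin d → ℝ) : linSubst J (0 : Series d) = 0 := by
  rw [← map_zero C, linSubst_C]

@[simp]
theorem linSubst_X (J : Fin d → Fin d → ℝ) (m : Fin d) : linSubst J (X m) = linForm J m :=
  subst_X (hasSubst_linForm J) m

theorem linSubst_linSubst (J K : Fin d → Fin d → ℝ) (f : Series d) :
    linSubst K (linSubst J f) = linSubst (fun m k => ∑ i, J m i * K i k) f := by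
  rw [linSubst, linSubst, subst_comp_subst_apply (hasSubst_linForm J) (hasSubst_linForm K)]
  congr 1
  funext m
  change linSubst K (linForm J m) = _
  simp only [linForm, linSubst_sum, linSubst_mul, linSubst_C, linSubst_X, Finset.mul_sum,
    map_sum, map_mul, Finset.sum_mul]
  rw [Finset.sum_comm]
  simp only [mul_assoc]

theorem linSubst_id (f : Series d) : linSubst (fun m i => if m = i then 1 else 0) f = f := by
  have h : linForm (fun m i : Fin d => if m = i then (1 : ℝ) else 0) = X := by
    funext m
    simp [linForm, apply_ite C]
  rw [linSubst, h, subst_self, id]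

@[simp]
theorem constantCoeff_linSubst (J : Fin d → Fin d → ℝ) (f : Series d) :
    constantCoeff (linSubst J f) = constantCoeff f := by
  have h : constantCoeff (linSubst J (f - C (constantCoeff f))) = 0 :=
    constantCoeff_subst_eq_zero (hasSubst_linForm J) (by simp) (by simp)
  rw [linSubst_sub, linSubst_C, map_sub, constantCoeff_C, sub_eq_zero] at h
  exact h

theorem le_order_linSubst {n : ℕ} (J : Fin d → Fin d → ℝ) {f : Series d}
    (hf : (n : ℕ∞) ≤ order f) : (n : ℕ∞) ≤ order (linSubst J f) := by
  refine le_trans ?_ (le_order_subst (hasSubst_linForm J) f)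
  have h1 : (1 : ℕ∞) ≤ ⨅ i, order (linForm J i) :=
    le_iInf fun i => by simpa using one_le_order (constantCoeff_linForm J i)
  calc (n : ℕ∞) = 1 * n := (one_mul _).symm
    _ ≤ _ := mul_le_mul' h1 hf

/-- An additive map on power series that vanishes on polynomials and lowers orders by at most one
vanishes. -/
theorem eq_zero_of_polynomial {T : Series d → Series d}
    (hsub : ∀ f g, T (f - g) = T f - T g) (hpoly : ∀ p : MvPolynomial (Fin d) ℝ, T p = 0)
    (hord : ∀ (n : ℕ) f, ((n + 1 : ℕ) : ℕ∞) ≤ order f → (n : ℕ∞) ≤ order (T f)) (f : Series d) :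
    T f = 0 := by
  refine eq_zero_of_forall_le_order fun n => ?_
  have h := hord n _ (le_order_sub_truncTotal (n + 1) f)
  rwa [hsub, hpoly, sub_zero] at h

/-- The chain rule for a linear substitution. -/
theorem pderiv_linSubst (J : Fin d → Fin d → ℝ) (k : Fin d) (f : Series d) :
    pderiv ℝ k (linSubst J f) = ∑ m, C (J m k) * linSubst J (pderiv ℝ m f) := by
  rw [← sub_eq_zero]
  refine eq_zero_of_polynomial
    (T := fun f => pderiv ℝ k (linSubst J f) - ∑ m, C (J m k) * linSubst J (pderiv ℝ m f))
    (fun f g => ?_) (fun p => ?_) (fun n f hf => ?_) f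
  · simp only [linSubst_sub, map_sub, mul_sub, Finset.sum_sub_distrib]
    abel
  · rw [sub_eq_zero]
    induction p using MvPolynomial.induction_on with
    | C r => simp
    | add p q hp hq =>
      simp only [MvPolynomial.coe_add, linSubst_add, map_add, hp, hq, mul_add,
        Finset.sum_add_distrib]
    | mul_X p i hp =>
      simp only [MvPolynomial.coe_mul, MvPolynomial.coe_X, linSubst_mul, Derivation.leibniz, hp,
        linSubst_X, smul_eq_mul, linSubst_add, mul_add, Finset.sum_add_distrib]
      rw [add_comm]
      have h1 : ∑ m, C (J m k) * (linSubst J (p : Series d) * linSubst J (pderiv ℝ m (X i))) =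
          linSubst J (p : Series d) * C (J i k) := by
        rw [Finset.sum_eq_single i]
        · simp [mul_comm]
        · intro m _ hm
          simp [pderiv_X_of_ne hm.symm]
        · simp
      have h2 : pderiv ℝ k (linForm J i) = C (J i k) := by
        rw [linForm, map_sum, Finset.sum_eq_single k]
        · simp
        · intro m _ hm
          simp [pderiv_X_of_ne hm]
        · simp
      rw [h1, h2, add_comm, Finset.mul_sum]
      congr 1
      exact Finset.sum_congr rfl fun m _ => by ring
  · exact le_order_sub (le_order_pderiv k (le_order_linSubst J hf))
      (le_order_sum _ fun m _ =>
        le_order_mul_left _ (le_order_linSubst J (le_order_pderiv m hf)))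

theorem yPartial_cons (j : Fin d) (α : List (Fin d)) (f : Series d) :
    yPartial (j :: α) f = pderiv ℝ j (yPartial α f) := rfl

theorem yPartial_pderiv (j : Fin d) (α : List (Fin d)) (f : Series d) :
    yPartial α (pderiv ℝ j f) = pderiv ℝ j (yPartial α f) := by
  induction α with
  | nil => rfl
  | cons i α ih => rw [yPartial_cons, ih, pderiv_comm, yPartial_cons]

theorem yPartial_sub (α : List (Fin d)) (f g : Series d) :
    yPartial α (f - g) = yPartial α f - yPartial α g := by
  induction α with
  | nil => rfl
  | cons i α ih => simp only [yPartial_cons, ih, map_sub]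

theorem le_order_yPartial {n : ℕ} (α : List (Fin d)) {f : Series d}
    (hf : ((n + α.length : ℕ) : ℕ∞) ≤ order f) : (n : ℕ∞) ≤ order (yPartial α f) := by
  induction α generalizing n with
  | nil => simpa [yPartial] using hf
  | cons i α ih =>
    refine le_order_pderiv i (ih ?_)
    rwa [List.length_cons, ← add_assoc, add_right_comm] at hf

/-- A power series is determined by its partial derivatives at the origin. -/
theorem eq_zero_of_forall_yPartial {f : Series d}
    (h : ∀ α : List (Fin d), constantCoeff (yPartial α f) = 0) : f = 0 := by
  refine eq_zero_of_forall_le_order fun n => ?_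
  suffices H : ∀ n : ℕ, ∀ f : Series d, (∀ α, constantCoeff (yPartial α f) = 0) →
      ∀ m : Fin d →₀ ℕ, m.degree = n → coeff m f = 0 from
    nat_le_order fun m _ => H _ f h m rfl
  intro n
  induction n with
  | zero =>
    intro f hf m hm
    rw [Finsupp.degree_eq_zero_iff] at hm
    subst hm
    exact hf []
  | succ n ih =>
    intro f hf m hm
    obtain ⟨i, hi⟩ : ∃ i, m i ≠ 0 := by
      by_contra! h0
      have : m = 0 := Finsupp.ext h0
      simp [this] at hm
    have hle : Finsupp.single i 1 ≤ m := fun j => by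
      by_cases hj : j = i
      · subst hj; simp; omega
      · simp [hj]
    have hdeg : (m - Finsupp.single i 1).degree = n := by
      have := congrArg Finsupp.degree (tsub_add_cancel_of_le hle)
      rw [map_add, Finsupp.degree_single] at this
      omega
    have h1 := ih (pderiv ℝ i f) (fun α => by
      rw [yPartial_pderiv]; exact hf (i :: α)) _ hdeg
    rw [coeff_pderiv, tsub_add_cancel_of_le hle] at h1
    exact (mul_eq_zero.1 h1).resolve_right (by positivity)

end Series

/-! ### Families of power series depending on a point of `ℝᵈ` -/

section Families

variable {d : ℕ}

/-- All coefficients of the family of power series `u` are differentiable at `t`. -/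
def DiffSeriesAt (u : EuclideanSpace ℝ (Fin d) → Series d) (t : EuclideanSpace ℝ (Fin d)) : Prop :=
  ∀ m, DifferentiableAt ℝ (fun s => coeff m (u s)) t

/-- All coefficients of the family of power series `u` are smooth on `U`. -/
def SmoothSeriesOn (U : Set (EuclideanSpace ℝ (Fin d)))
    (u : EuclideanSpace ℝ (Fin d) → Series d) : Prop :=
  ∀ m, ContDiffOn ℝ ∞ (fun s => coeff m (u s)) U

variable {U : Set (EuclideanSpace ℝ (Fin d))} {t : EuclideanSpace ℝ (Fin d)}
  {u v : EuclideanSpace ℝ (Fin d) → Series d}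

theorem SmoothSeriesOn.diffSeriesAt (hu : SmoothSeriesOn U u) (hU : IsOpen U) (ht : t ∈ U) :
    DiffSeriesAt u t :=
  fun m => ((hu m).contDiffAt (hU.mem_nhds ht)).differentiableAt (by simp)

theorem SmoothSeriesOn.add (hu : SmoothSeriesOn U u) (hv : SmoothSeriesOn U v) :
    SmoothSeriesOn U (fun t => u t + v t) :=
  fun m => by simpa using (hu m).add (hv m)

theorem SmoothSeriesOn.sub (hu : SmoothSeriesOn U u) (hv : SmoothSeriesOn U v) :
    SmoothSeriesOn U (fun t => u t - v t) :=
  fun m => by simpa using (hu m).sub (hv m)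

theorem SmoothSeriesOn.mul (hu : SmoothSeriesOn U u) (hv : SmoothSeriesOn U v) :
    SmoothSeriesOn U (fun t => u t * v t) := by
  classical
  intro m
  simp only [coeff_mul]
  exact ContDiffOn.sum fun p _ => (hu p.1).mul (hv p.2)

theorem smoothSeriesOn_const (f : Series d) : SmoothSeriesOn U (fun _ => f) :=
  fun _ => contDiffOn_const

theorem smoothSeriesOn_C {c : EuclideanSpace ℝ (Fin d) → ℝ} (hc : ContDiffOn ℝ ∞ c U) :
    SmoothSeriesOn U (fun t => C (c t)) := by
  classical
  intro m
  simp only [coeff_C]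
  by_cases h : m = 0
  · simpa [h] using hc
  · simpa [h] using contDiffOn_const

theorem SmoothSeriesOn.sum {ι : Type*} {s : Finset ι} {f : ι → EuclideanSpace ℝ (Fin d) → Series d}
    (hf : ∀ i ∈ s, SmoothSeriesOn U (f i)) : SmoothSeriesOn U (fun t => ∑ i ∈ s, f i t) := by
  intro m
  simp only [map_sum]
  exact ContDiffOn.sum fun i hi => hf i hi m

theorem SmoothSeriesOn.prod {ι : Type*} {s : Finset ι}
    {f : ι → EuclideanSpace ℝ (Fin d) → Series d}
    (hf : ∀ i ∈ s, SmoothSeriesOn U (f i)) : SmoothSeriesOn U (fun t => ∏ i ∈ s, f i t) := by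
  classical
  induction s using Finset.induction_on with
  | empty => simpa using smoothSeriesOn_const 1
  | insert i s hi ih =>
    simp only [Finset.prod_insert hi]
    exact (hf i (by simp)).mul (ih fun j hj => hf j (by simp [hj]))

theorem SmoothSeriesOn.pderiv (hu : SmoothSeriesOn U u) (k : Fin d) :
    SmoothSeriesOn U (fun t => pderiv ℝ k (u t)) := by
  intro m
  simp only [coeff_pderiv]
  exact (hu _).mul contDiffOn_const

theorem SmoothSeriesOn.yPartial (hu : SmoothSeriesOn U u) (α : List (Fin d)) :
    SmoothSeriesOn U (fun t => yPartial α (u t)) := by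
  induction α with
  | nil => exact hu
  | cons i α ih => exact ih.pderiv i

theorem SmoothSeriesOn.constantCoeff (hu : SmoothSeriesOn U u) :
    ContDiffOn ℝ ∞ (fun t => constantCoeff (u t)) U := hu 0

theorem contDiffOn_fderiv_apply {c : EuclideanSpace ℝ (Fin d) → ℝ} (hU : IsOpen U)
    (hc : ContDiffOn ℝ ∞ c U) (w : EuclideanSpace ℝ (Fin d)) :
    ContDiffOn ℝ ∞ (fun t => fderiv ℝ c t w) U :=
  (hc.fderiv_of_isOpen hU (by simp)).clm_apply contDiffOn_const

theorem coeff_xDeriv (i : Fin d) (m : Fin d →₀ ℕ) :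
    coeff m (xDeriv i u t) = fderiv ℝ (fun s => coeff m (u s)) t (stdVec i) := rfl

theorem SmoothSeriesOn.xDeriv (hu : SmoothSeriesOn U u) (hU : IsOpen U) (i : Fin d) :
    SmoothSeriesOn U (xDeriv i u) :=
  fun m => contDiffOn_fderiv_apply hU (hu m) _

theorem xDeriv_congr (i : Fin d) (h : u =ᶠ[nhds t] v) : xDeriv i u t = xDeriv i v t := by
  ext m
  rw [coeff_xDeriv, coeff_xDeriv, Filter.EventuallyEq.fderiv_eq]
  filter_upwards [h] with s hs
  rw [hs]

theorem xDeriv_add (i : Fin d) (hu : DiffSeriesAt u t) (hv : DiffSeriesAt v t) :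
    xDeriv i (fun s => u s + v s) t = xDeriv i u t + xDeriv i v t := by
  ext m
  simp only [coeff_xDeriv, map_add]
  rw [fderiv_fun_add (hu m) (hv m)]
  rfl

theorem xDeriv_sum {ι : Type*} {s : Finset ι} {f : ι → EuclideanSpace ℝ (Fin d) → Series d}
    (i : Fin d) (hf : ∀ r ∈ s, DiffSeriesAt (f r) t) :
    xDeriv i (fun x => ∑ r ∈ s, f r x) t = ∑ r ∈ s, xDeriv i (f r) t := by
  ext m
  simp only [coeff_xDeriv, map_sum]
  rw [fderiv_fun_sum fun r hr => hf r hr m, _root_.sum_apply]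

theorem xDeriv_mul (i : Fin d) (hu : DiffSeriesAt u t) (hv : DiffSeriesAt v t) :
    xDeriv i (fun s => u s * v s) t = xDeriv i u t * v t + u t * xDeriv i v t := by
  classical
  ext m
  simp only [coeff_xDeriv, coeff_mul, map_add]
  rw [fderiv_fun_sum fun p _ => (hu p.1).fun_mul (hv p.2), _root_.sum_apply,
    ← Finset.sum_add_distrib]
  refine Finset.sum_congr rfl fun p _ => ?_
  rw [fderiv_fun_mul (hu p.1) (hv p.2)]
  simp only [_root_.add_apply, _root_.smul_apply, smul_eq_mul]
  ring

theorem xDeriv_const (i : Fin d) (f : Series d) : xDeriv i (fun _ => f) t = 0 := by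
  ext m
  simp [coeff_xDeriv]

theorem xDeriv_C (i : Fin d) (c : EuclideanSpace ℝ (Fin d) → ℝ) :
    xDeriv i (fun s => C (c s)) t = C (fderiv ℝ c t (stdVec i)) := by
  classical
  ext m
  simp only [coeff_xDeriv, coeff_C]
  by_cases h : m = 0 <;> simp [h]

theorem xDeriv_pderiv (i k : Fin d) (hu : DiffSeriesAt u t) :
    xDeriv i (fun s => pderiv ℝ k (u s)) t = pderiv ℝ k (xDeriv i u t) := by
  ext m
  simp only [coeff_xDeriv, coeff_pderiv]
  rw [fderiv_mul_const (hu _)]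
  simp [mul_comm]

theorem DiffSeriesAt.add (hu : DiffSeriesAt u t) (hv : DiffSeriesAt v t) :
    DiffSeriesAt (fun s => u s + v s) t :=
  fun m => by simpa only [map_add] using (hu m).fun_add (hv m)

theorem DiffSeriesAt.mul (hu : DiffSeriesAt u t) (hv : DiffSeriesAt v t) :
    DiffSeriesAt (fun s => u s * v s) t := by
  classical
  intro m
  simp only [coeff_mul]
  exact DifferentiableAt.fun_sum fun p _ => (hu p.1).fun_mul (hv p.2)

theorem diffSeriesAt_const (f : Series d) : DiffSeriesAt (fun _ => f) t :=
  fun _ => differentiableAt_const _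

theorem diffSeriesAt_C {c : EuclideanSpace ℝ (Fin d) → ℝ} (hc : DifferentiableAt ℝ c t) :
    DiffSeriesAt (fun s => C (c s)) t := by
  classical
  intro m
  simp only [coeff_C]
  by_cases h : m = 0
  · simpa [h] using hc
  · simp [h]

theorem DiffSeriesAt.sum {ι : Type*} {s : Finset ι} {f : ι → EuclideanSpace ℝ (Fin d) → Series d}
    (hf : ∀ i ∈ s, DiffSeriesAt (f i) t) : DiffSeriesAt (fun x => ∑ i ∈ s, f i x) t := by
  intro m
  simp only [map_sum]
  exact DifferentiableAt.fun_sum fun i hi => hf i hi m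

theorem DiffSeriesAt.pderiv (hu : DiffSeriesAt u t) (k : Fin d) :
    DiffSeriesAt (fun s => pderiv ℝ k (u s)) t := by
  intro m
  simp only [coeff_pderiv]
  exact (hu _).mul_const _

/-! ### Change of coordinates -/

/-- Differentiating `u(θ(x), J(x) y)` in `x`, with the differentiability it rests on. -/
structure HasChainRule (J : EuclideanSpace ℝ (Fin d) → Fin d → Fin d → ℝ)
    (θ : EuclideanSpace ℝ (Fin d) → EuclideanSpace ℝ (Fin d)) (t : EuclideanSpace ℝ (Fin d))
    (u : EuclideanSpace ℝ (Fin d) → Series d) : Prop where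
  diff : DiffSeriesAt u (θ t)
  diff_comp : DiffSeriesAt (fun s => linSubst (J s) (u (θ s))) t
  formula : ∀ j, xDeriv j (fun s => linSubst (J s) (u (θ s))) t =
    ∑ i, C (fderiv ℝ (fun s => θ s i) t (stdVec j)) * linSubst (J t) (xDeriv i u (θ t)) +
    ∑ m, xDeriv j (fun s => linForm (J s) m) t * linSubst (J t) (pderiv ℝ m (u (θ t)))

variable {J : EuclideanSpace ℝ (Fin d) → Fin d → Fin d → ℝ}
  {θ : EuclideanSpace ℝ (Fin d) → EuclideanSpace ℝ (Fin d)}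

theorem HasChainRule.add (hu : HasChainRule J θ t u) (hv : HasChainRule J θ t v) :
    HasChainRule J θ t (fun s => u s + v s) where
  diff := hu.diff.add hv.diff
  diff_comp := by simpa only [linSubst_add] using hu.diff_comp.add hv.diff_comp
  formula j := by
    simp only [linSubst_add]
    rw [xDeriv_add j hu.diff_comp hv.diff_comp, hu.formula, hv.formula]
    simp only [xDeriv_add _ hu.diff hv.diff, linSubst_add, map_add, mul_add,
      Finset.sum_add_distrib]
    abel

theorem HasChainRule.mul (hu : HasChainRule J θ t u) (hv : HasChainRule J θ t v) :
    HasChainRule J θ t (fun s => u s * v s) where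
  diff := hu.diff.mul hv.diff
  diff_comp := by simpa only [linSubst_mul] using hu.diff_comp.mul hv.diff_comp
  formula j := by
    simp only [linSubst_mul]
    rw [xDeriv_mul j hu.diff_comp hv.diff_comp, hu.formula, hv.formula]
    simp only [xDeriv_mul _ hu.diff hv.diff, linSubst_add, linSubst_mul, Derivation.leibniz,
      smul_eq_mul, mul_add, add_mul, Finset.sum_add_distrib, Finset.sum_mul, Finset.mul_sum]
    simp only [mul_comm, mul_assoc]
    abel

theorem hasChainRule_C {c : EuclideanSpace ℝ (Fin d) → ℝ} (hc : DifferentiableAt ℝ c (θ t))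
    (hθ : DifferentiableAt ℝ θ t) : HasChainRule J θ t (fun s => C (c s)) where
  diff := diffSeriesAt_C hc
  diff_comp := by
    simpa only [linSubst_C] using diffSeriesAt_C (c := fun s => c (θ s)) (hc.comp t hθ)
  formula j := by
    simp only [linSubst_C, xDeriv_C, pderiv_C, linSubst_zero, mul_zero, Finset.sum_const_zero,
      add_zero, ← map_mul, ← map_sum]
    congr 1
    have h1 : fderiv ℝ (fun s => c (θ s)) t (stdVec j) =
        fderiv ℝ c (θ t) (fderiv ℝ θ t (stdVec j)) := by
      rw [show (fun s => c (θ s)) = c ∘ θ from rfl, fderiv_comp t hc hθ]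
      rfl
    have h2 : ∀ w : EuclideanSpace ℝ (Fin d), w = ∑ i, w i • stdVec i := fun w => by
      ext k
      simp [stdVec, Pi.single_apply]
    have h3 : ∀ i, fderiv ℝ (fun s => θ s i) t (stdVec j) = (fderiv ℝ θ t (stdVec j)) i :=
      fun i => by
        have := (EuclideanSpace.proj i : EuclideanSpace ℝ (Fin d) →L[ℝ] ℝ).hasFDerivAt.comp t
          hθ.hasFDerivAt
        rw [show (fun s => θ s i) =
          (EuclideanSpace.proj i : EuclideanSpace ℝ (Fin d) →L[ℝ] ℝ) ∘ θ from rfl, this.fderiv]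
        rfl
    simp only [h3]
    rw [h1]
    generalize fderiv ℝ θ t (stdVec j) = w
    conv_lhs => rw [h2 w, map_sum]
    simp

theorem diffSeriesAt_linForm (hJ : ∀ m i, DifferentiableAt ℝ (fun s => J s m i) t) (m : Fin d) :
    DiffSeriesAt (fun s => linForm (J s) m) t :=
  DiffSeriesAt.sum fun i _ => (diffSeriesAt_C (hJ m i)).mul (diffSeriesAt_const _)

theorem hasChainRule_X (hJ : ∀ m i, DifferentiableAt ℝ (fun s => J s m i) t) (k : Fin d) :
    HasChainRule J θ t (fun _ => X k) where
  diff := diffSeriesAt_const _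
  diff_comp := by simpa only [linSubst_X] using diffSeriesAt_linForm hJ k
  formula j := by
    simp only [linSubst_X, xDeriv_const, linSubst_zero, mul_zero, Finset.sum_const_zero, zero_add]
    rw [Finset.sum_eq_single k]
    · simp
    · intro m _ hm
      simp [pderiv_X_of_ne hm.symm]
    · simp

theorem HasChainRule.sum {ι : Type*} {s : Finset ι} {f : ι → EuclideanSpace ℝ (Fin d) → Series d}
    (hθ : DifferentiableAt ℝ θ t) (hf : ∀ i ∈ s, HasChainRule J θ t (f i)) :
    HasChainRule J θ t (fun x => ∑ i ∈ s, f i x) := by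
  classical
  induction s using Finset.induction_on with
  | empty => simpa using hasChainRule_C (c := fun _ => 0) (differentiableAt_const _) hθ
  | insert i s hi ih =>
    simp only [Finset.sum_insert hi]
    exact (hf i (by simp)).add (ih fun j hj => hf j (by simp [hj]))

theorem hasChainRule_polynomial (hJ : ∀ m i, DifferentiableAt ℝ (fun s => J s m i) t)
    (hθ : DifferentiableAt ℝ θ t) (p : MvPolynomial (Fin d) ℝ) :
    HasChainRule J θ t (fun _ => (p : Series d)) := by
  induction p using MvPolynomial.induction_on with
  | C r => simpa using hasChainRule_C (c := fun _ => r) (differentiableAt_const _) hθ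
  | add p q hp hq => simpa using hp.add hq
  | mul_X p i hp => simpa using hp.mul (hasChainRule_X hJ i)

/-- The chain rule holds for every differentiable family: up to any given order in `y`
the family is a finite sum of polynomials in `y` with coefficients depending on `x`. -/
theorem DiffSeriesAt.hasChainRule (hJ : ∀ m i, DifferentiableAt ℝ (fun s => J s m i) t)
    (hθ : DifferentiableAt ℝ θ t) (hu : DiffSeriesAt u (θ t)) : HasChainRule J θ t u := by
  classical
  let p : ℕ → EuclideanSpace ℝ (Fin d) → Series d := fun n s =>
    ∑ m ∈ (Finsupp.finite_of_degree_lt (σ := Fin d) n).toFinset,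
      C (coeff m (u s)) * ((MvPolynomial.monomial m 1 : MvPolynomial (Fin d) ℝ) : Series d)
  have hp : ∀ n, HasChainRule J θ t (p n) := fun n =>
    HasChainRule.sum hθ fun m _ => (hasChainRule_C (hu m) hθ).mul (hasChainRule_polynomial hJ hθ _)
  have hord : ∀ (n : ℕ) s, (n : ℕ∞) ≤ order (u s - p n s) := fun n s =>
    le_order_sub_of_coeff_eq fun m hm => by
      simp only [p, map_sum, coeff_C_mul, MvPolynomial.coeff_coe, MvPolynomial.coeff_monomial]
      rw [Finset.sum_eq_single m]
      · simp
      · intro k _ hk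
        simp [hk]
      · intro h
        simp [hm] at h
  have hcoeff : ∀ (n : ℕ) (m : Fin d →₀ ℕ), m.degree < n →
      (fun s => coeff m (linSubst (J s) (u (θ s)))) =
        fun s => coeff m (linSubst (J s) (p n (θ s))) := fun n m hm => by
    funext s
    refine coeff_eq_of_le_order_sub (n := n) ?_ hm
    rw [← linSubst_sub]
    exact le_order_linSubst _ (hord n _)
  refine ⟨hu, fun m => ?_, fun j => ?_⟩
  · rw [hcoeff (m.degree + 1) m (Nat.lt_succ_self _)]
    exact (hp _).diff_comp m
  · ext m
    have h1 : coeff m (xDeriv j (fun s => linSubst (J s) (u (θ s))) t) =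
        coeff m (xDeriv j (fun s => linSubst (J s) (p (m.degree + 2) (θ s))) t) := by
      rw [coeff_xDeriv, coeff_xDeriv, hcoeff (m.degree + 2) m (by omega)]
    rw [h1, (hp _).formula j]
    refine (coeff_eq_of_le_order_sub (n := m.degree + 1) ?_ (Nat.lt_succ_self _)).symm
    rw [add_sub_add_comm]
    simp only [← Finset.sum_sub_distrib, ← mul_sub, ← linSubst_sub, ← map_sub]
    refine le_order_add (le_order_sum _ fun i _ => le_order_mul_left _ (le_order_linSubst _ ?_))
      (le_order_sum _ fun k _ =>
        le_order_mul_left _ (le_order_linSubst _ (le_order_pderiv k (hord _ _))))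
    refine le_order_sub_of_coeff_eq fun k hk => ?_
    have h2 : ∀ s, coeff k (u s) = coeff k (p (m.degree + 2) s) := fun s =>
      coeff_eq_of_le_order_sub (hord _ s) (by omega)
    simp only [coeff_xDeriv, h2]

/-- The operator `∂/∂xⁱ + ∑ₖ Vᵢᵏ(x,y) ∂/∂yᵏ`, for a one-form `V` with values in the formal
fibrewise vector fields. -/
def fibreConn (V : Fin d → Fin d → EuclideanSpace ℝ (Fin d) → Series d) (i : Fin d)
    (u : EuclideanSpace ℝ (Fin d) → Series d) (t : EuclideanSpace ℝ (Fin d)) : Series d :=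
  xDeriv i u t + ∑ k, V i k t * pderiv ℝ k (u t)

/-- If `V` and `W` are related by the transformation law of connections under
`(x, y) ↦ (θ(x), J(x) y)`, where `J = ∂θ/∂x`, then so are the operators they define. -/
theorem fibreConn_linSubst {V W : Fin d → Fin d → EuclideanSpace ℝ (Fin d) → Series d}
    (hJ : ∀ m i, DifferentiableAt ℝ (fun s => J s m i) t)
    (hθ : DifferentiableAt ℝ θ t)
    (hJθ : ∀ i j, fderiv ℝ (fun s => θ s i) t (stdVec j) = J t i j)
    (hVW : ∀ j m, xDeriv j (fun s => linForm (J s) m) t + ∑ k, C (J t m k) * W j k t =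
      ∑ i, C (J t i j) * linSubst (J t) (V i m (θ t)))
    (hu : DiffSeriesAt u (θ t)) (j : Fin d) :
    fibreConn W j (fun s => linSubst (J s) (u (θ s))) t =
      ∑ i, C (J t i j) * linSubst (J t) (fibreConn V i u (θ t)) := by
  simp only [fibreConn]
  rw [(hu.hasChainRule hJ hθ).formula]
  simp only [hJθ, pderiv_linSubst, linSubst_add, linSubst_sum, linSubst_mul, mul_add,
    Finset.sum_add_distrib]
  rw [add_assoc]
  congr 1
  calc _ = ∑ m, (xDeriv j (fun s => linForm (J s) m) t + ∑ k, C (J t m k) * W j k t) *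
        linSubst (J t) (pderiv ℝ m (u (θ t))) := by
        simp only [add_mul, Finset.sum_add_distrib, Finset.sum_mul, Finset.mul_sum]
        congr 1
        rw [Finset.sum_comm]
        exact Finset.sum_congr rfl fun m _ => Finset.sum_congr rfl fun k _ => by ring
    _ = _ := by
        simp only [hVW, Finset.sum_mul, Finset.mul_sum]
        rw [Finset.sum_comm]
        exact Finset.sum_congr rfl fun m _ => Finset.sum_congr rfl fun k _ => by ring

end Families

/-! ### Flat families of power series over an open subset of `ℝᵈ` -/

section Flat

variable {d : ℕ} {U : Set (EuclideanSpace ℝ (Fin d))} {t : EuclideanSpace ℝ (Fin d)}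
  {u v : EuclideanSpace ℝ (Fin d) → Series d}
  {W : Fin d → Fin d → EuclideanSpace ℝ (Fin d) → Series d}

theorem fibreConn_zero (i : Fin d) : fibreConn W i (fun _ => 0) t = 0 := by
  simp [fibreConn, xDeriv_const]

theorem fibreConn_add (i : Fin d) (hu : DiffSeriesAt u t) (hv : DiffSeriesAt v t) :
    fibreConn W i (fun s => u s + v s) t = fibreConn W i u t + fibreConn W i v t := by
  simp only [fibreConn, xDeriv_add i hu hv, map_add, mul_add, Finset.sum_add_distrib]
  abel

theorem fibreConn_mul (i : Fin d) (hu : DiffSeriesAt u t) (hv : DiffSeriesAt v t) :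
    fibreConn W i (fun s => u s * v s) t = fibreConn W i u t * v t + u t * fibreConn W i v t := by
  simp only [fibreConn, xDeriv_mul i hu hv, Derivation.leibniz, smul_eq_mul, mul_add, add_mul,
    Finset.sum_add_distrib, Finset.sum_mul, Finset.mul_sum]
  simp only [mul_comm, mul_left_comm]
  abel

theorem fibreConn_congr (i : Fin d) (h : u =ᶠ[nhds t] v) :
    fibreConn W i u t = fibreConn W i v t := by
  rw [fibreConn, fibreConn, xDeriv_congr i h, h.eq_of_nhds]

theorem SmoothSeriesOn.fibreConn (hU : IsOpen U) (hW : ∀ i k, SmoothSeriesOn U (W i k))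
    (hu : SmoothSeriesOn U u) (i : Fin d) : SmoothSeriesOn U (fibreConn W i u) :=
  (hu.xDeriv hU i).add (SmoothSeriesOn.sum fun k _ => (hW i k).mul (hu.pderiv k))

/-- If the coefficients of `W` have no constant term, then `fibreConn W i` does not lower the
order of a family. -/
theorem le_order_fibreConn_sub (hW : ∀ i k t, constantCoeff (W i k t) = 0) {n : ℕ} (i : Fin d)
    (h : ∀ᶠ s in nhds t, (n : ℕ∞) ≤ order (u s - v s)) :
    (n : ℕ∞) ≤ order (fibreConn W i u t - fibreConn W i v t) := by
  rw [fibreConn, fibreConn, add_sub_add_comm]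
  refine le_order_add (le_order_sub_of_coeff_eq fun m hm => ?_) ?_
  · rw [coeff_xDeriv, coeff_xDeriv, Filter.EventuallyEq.fderiv_eq]
    filter_upwards [h] with s hs
    exact coeff_eq_of_le_order_sub hs hm
  · rw [← Finset.sum_sub_distrib]
    refine le_order_sum _ fun k _ => ?_
    rw [← mul_sub, ← map_sub]
    cases n with
    | zero => simp
    | succ n =>
      rw [add_comm]
      exact le_order_mul_of_le (one_le_order (hW i k t)) (le_order_pderiv k h.self_of_nhds)

/-- The operator inverse to `∑ᵢ yⁱ ∂/∂yⁱ` on power series without constant term. -/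
def eulerInv (f : Series d) : Series d := fun m => coeff m f / m.degree

theorem coeff_eulerInv (f : Series d) (m : Fin d →₀ ℕ) :
    coeff m (eulerInv f) = coeff m f / m.degree := rfl

/-- One step of the iteration solving `∑ᵢ yⁱ ∂u/∂yⁱ = ∑ᵢ yⁱ (∂/∂xⁱ + Wᵢᵏ ∂/∂yᵏ) u` with `u = c`
at `y = 0`. -/
def flatStep (W : Fin d → Fin d → EuclideanSpace ℝ (Fin d) → Series d)
    (c : EuclideanSpace ℝ (Fin d) → ℝ) (u : EuclideanSpace ℝ (Fin d) → Series d)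
    (t : EuclideanSpace ℝ (Fin d)) : Series d :=
  C (c t) + eulerInv (∑ i, X i * fibreConn W i u t)

/-- The iterates of `flatStep`; each step fixes one more degree in `y`. -/
def flatIter (W : Fin d → Fin d → EuclideanSpace ℝ (Fin d) → Series d)
    (c : EuclideanSpace ℝ (Fin d) → ℝ) : ℕ → EuclideanSpace ℝ (Fin d) → Series d
  | 0 => fun t => C (c t)
  | n + 1 => flatStep W c (flatIter W c n)

/-- The limit of the iterates `flatIter`. -/
def flatLift (W : Fin d → Fin d → EuclideanSpace ℝ (Fin d) → Series d)
    (c : EuclideanSpace ℝ (Fin d) → ℝ) (t : EuclideanSpace ℝ (Fin d)) : Series d :=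
  fun m => coeff m (flatIter W c m.degree t)

theorem coeff_flatLift (c : EuclideanSpace ℝ (Fin d) → ℝ) (m : Fin d →₀ ℕ) :
    coeff m (flatLift W c t) = coeff m (flatIter W c m.degree t) := rfl

theorem le_order_eulerInv_sub {n : ℕ} {f g : Series d} (h : (n : ℕ∞) ≤ order (f - g)) :
    (n : ℕ∞) ≤ order (eulerInv f - eulerInv g) :=
  le_order_sub_of_coeff_eq fun m hm => by
    rw [coeff_eulerInv, coeff_eulerInv, coeff_eq_of_le_order_sub h hm]

theorem le_order_flatStep_sub (hW : ∀ i k t, constantCoeff (W i k t) = 0)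
    (c : EuclideanSpace ℝ (Fin d) → ℝ) {n : ℕ} (h : ∀ s, (n : ℕ∞) ≤ order (u s - v s)) :
    ((n + 1 : ℕ) : ℕ∞) ≤ order (flatStep W c u t - flatStep W c v t) := by
  rw [flatStep, flatStep, add_sub_add_left_eq_sub]
  refine le_order_eulerInv_sub ?_
  rw [← Finset.sum_sub_distrib]
  refine le_order_sum _ fun i _ => ?_
  rw [← mul_sub]
  exact le_order_X_mul i (le_order_fibreConn_sub hW i (Filter.Eventually.of_forall h))

theorem le_order_flatIter_sub (hW : ∀ i k t, constantCoeff (W i k t) = 0)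
    (c : EuclideanSpace ℝ (Fin d) → ℝ) (n : ℕ) (t : EuclideanSpace ℝ (Fin d)) :
    ((n + 1 : ℕ) : ℕ∞) ≤ order (flatIter W c (n + 1) t - flatIter W c n t) := by
  induction n generalizing t with
  | zero =>
    refine one_le_order ?_
    simp only [flatIter, flatStep, add_sub_cancel_left]
    rw [← coeff_zero_eq_constantCoeff_apply, coeff_eulerInv]
    simp
  | succ n ih => exact le_order_flatStep_sub hW c ih

theorem le_order_flatLift_sub (hW : ∀ i k t, constantCoeff (W i k t) = 0)
    (c : EuclideanSpace ℝ (Fin d) → ℝ) (n : ℕ) (t : EuclideanSpace ℝ (Fin d)) :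
    ((n + 1 : ℕ) : ℕ∞) ≤ order (flatLift W c t - flatIter W c n t) := by
  refine le_order_sub_of_coeff_eq fun m hm => ?_
  rw [coeff_flatLift]
  induction n, Nat.lt_succ_iff.1 hm using Nat.le_induction with
  | base => rfl
  | succ k hk ih =>
    rw [ih (by omega)]
    exact (coeff_eq_of_le_order_sub (le_order_flatIter_sub hW c k t) (by omega)).symm

theorem flatLift_eq_flatStep (hW : ∀ i k t, constantCoeff (W i k t) = 0)
    (c : EuclideanSpace ℝ (Fin d) → ℝ) (t : EuclideanSpace ℝ (Fin d)) :
    flatLift W c t = flatStep W c (flatLift W c) t := by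
  rw [← sub_eq_zero]
  refine eq_zero_of_forall_le_order fun n => ?_
  have h1 := le_order_flatLift_sub hW c (n + 1) t
  have h2 := le_order_flatStep_sub (t := t) hW c (le_order_flatLift_sub hW c n)
  have h3 := le_order_sub h1 h2
  rw [flatIter, sub_sub_sub_cancel_right] at h3
  exact le_trans (Nat.cast_le.2 (by omega)) h3

@[simp]
theorem constantCoeff_flatLift (c : EuclideanSpace ℝ (Fin d) → ℝ)
    (t : EuclideanSpace ℝ (Fin d)) : constantCoeff (flatLift W c t) = c t := by
  rw [← coeff_zero_eq_constantCoeff_apply, coeff_flatLift]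
  simp [flatIter]

/-- The family `u` is annihilated by `∑ᵢ yⁱ Dᵢ`, where `Dᵢ = ∂/∂xⁱ + Wᵢᵏ ∂/∂yᵏ - ∂/∂yⁱ`. -/
def IsRadiallyFlat (W : Fin d → Fin d → EuclideanSpace ℝ (Fin d) → Series d)
    (U : Set (EuclideanSpace ℝ (Fin d))) (u : EuclideanSpace ℝ (Fin d) → Series d) : Prop :=
  ∀ t ∈ U, ∑ i, X i * (fibreConn W i u t - pderiv ℝ i (u t)) = 0

theorem isRadiallyFlat_iff : IsRadiallyFlat W U u ↔ ∀ t ∈ U, ∀ m : Fin d →₀ ℕ,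
    m.degree * coeff m (u t) = coeff m (∑ i, X i * fibreConn W i u t) := by
  refine forall₂_congr fun t _ => ?_
  simp only [mul_sub, Finset.sum_sub_distrib]
  rw [sub_eq_zero, MvPowerSeries.ext_iff]
  refine forall_congr' fun m => ?_
  rw [coeff_euler, eq_comm]

theorem isRadiallyFlat_flatLift (hW : ∀ i k t, constantCoeff (W i k t) = 0)
    (c : EuclideanSpace ℝ (Fin d) → ℝ) : IsRadiallyFlat W U (flatLift W c) := by
  classical
  rw [isRadiallyFlat_iff]
  intro t _ m
  conv_lhs => rw [flatLift_eq_flatStep hW]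
  rw [flatStep, map_add, coeff_eulerInv, coeff_C]
  by_cases h : m = 0
  · subst h
    simp
  · have h1 : (m.degree : ℝ) ≠ 0 := by
      exact_mod_cast fun h0 => h ((Finsupp.degree_eq_zero_iff m).1 h0)
    rw [if_neg h, zero_add, mul_div_cancel₀ _ h1]

/-- A radially flat family is determined by its value at `y = 0`. -/
theorem IsRadiallyFlat.eq (hU : IsOpen U) (hW : ∀ i k t, constantCoeff (W i k t) = 0)
    (hu : IsRadiallyFlat W U u) (hv : IsRadiallyFlat W U v)
    (h : ∀ t ∈ U, constantCoeff (u t) = constantCoeff (v t)) : ∀ t ∈ U, u t = v t := by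
  rw [isRadiallyFlat_iff] at hu hv
  have key : ∀ n : ℕ, ∀ t ∈ U, (n : ℕ∞) ≤ order (u t - v t) := by
    intro n
    induction n with
    | zero => simp
    | succ n ih =>
      intro t ht
      refine le_order_sub_of_coeff_eq fun m hm => ?_
      by_cases h0 : m = 0
      · subst h0
        exact h t ht
      · have h1 : (m.degree : ℝ) ≠ 0 := by
          exact_mod_cast fun h2 => h0 ((Finsupp.degree_eq_zero_iff m).1 h2)
        apply mul_left_cancel₀ h1
        rw [hu t ht, hv t ht]
        refine coeff_eq_of_le_order_sub (n := n + 1) ?_ hm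
        rw [← Finset.sum_sub_distrib]
        refine le_order_sum _ fun i _ => ?_
        rw [← mul_sub]
        refine le_order_X_mul i (le_order_fibreConn_sub hW i ?_)
        filter_upwards [hU.mem_nhds ht] with s hs using ih s hs
  intro t ht
  exact sub_eq_zero.1 (eq_zero_of_forall_le_order fun n => key n t ht)

theorem SmoothSeriesOn.eulerInv (hu : SmoothSeriesOn U u) :
    SmoothSeriesOn U (fun t => eulerInv (u t)) :=
  fun m => (hu m).div_const _

theorem smoothSeriesOn_flatLift (hU : IsOpen U) (hW : ∀ i k, SmoothSeriesOn U (W i k))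
    {c : EuclideanSpace ℝ (Fin d) → ℝ} (hc : ContDiffOn ℝ ∞ c U) :
    SmoothSeriesOn U (flatLift W c) := by
  have h : ∀ n, SmoothSeriesOn U (flatIter W c n) := by
    intro n
    induction n with
    | zero => exact smoothSeriesOn_C hc
    | succ n ih =>
      exact (smoothSeriesOn_C hc).add (SmoothSeriesOn.eulerInv (SmoothSeriesOn.sum fun i _ =>
        (smoothSeriesOn_const _).mul (ih.fibreConn hU hW i)))
  exact fun m => h _ m

/-- If the operators `Dᵢ` commute on `u`, then `∑ᵢ yⁱ Dᵢ u = 0` forces `Dᵢ u = 0`: the lowest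
homogeneous part of `(Dᵢ u)ᵢ` is a closed one-form in `y` whose contraction with the Euler field
vanishes. -/
theorem IsRadiallyFlat.flat (hU : IsOpen U) (hW : ∀ i k t, constantCoeff (W i k t) = 0)
    {D : Fin d → (EuclideanSpace ℝ (Fin d) → Series d) → EuclideanSpace ℝ (Fin d) → Series d}
    (hD : ∀ i u t, D i u t = fibreConn W i u t - pderiv ℝ i (u t))
    (hu : IsRadiallyFlat W U u) (hcomm : ∀ t ∈ U, ∀ i j, D i (D j u) t = D j (D i u) t) :
    ∀ t ∈ U, ∀ j, D j u t = 0 := by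
  have key : ∀ n : ℕ, ∀ t ∈ U, ∀ j, (n : ℕ∞) ≤ order (D j u t) := by
    intro n
    induction n with
    | zero => simp
    | succ n ih =>
      intro t ht j
      have hconn : ∀ i j, (n : ℕ∞) ≤ order (fibreConn W i (D j u) t) := fun i j => by
        have := le_order_fibreConn_sub (t := t) (u := D j u) (v := fun _ => 0) (n := n) hW i
          (by filter_upwards [hU.mem_nhds ht] with s hs using by simpa using ih s hs j)
        rwa [fibreConn_zero, sub_zero] at this
      -- `D j u` is closed as a one-form in `y` up to terms of order `n`, as `D i` and `D j` commute
      have hcl : ∀ i, (n : ℕ∞) ≤ order (pderiv ℝ i (D j u t) - pderiv ℝ j (D i u t)) := fun i => by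
        have h := hcomm t ht i j
        rw [hD i, hD j (D i u)] at h
        have h' : pderiv ℝ i (D j u t) - pderiv ℝ j (D i u t) =
            fibreConn W i (D j u) t - fibreConn W j (D i u) t := by
          linear_combination -h
        rw [h']
        exact le_order_sub (hconn i j) (hconn j i)
      -- differentiate `∑ yⁱ Dᵢ u = 0` in `yʲ`
      have heuler : ∑ i, X i * pderiv ℝ j (D i u t) = -D j u t := by
        have h := congrArg (pderiv ℝ j) (hu t ht)
        simp only [← hD, map_sum, Derivation.leibniz, smul_eq_mul, map_zero,
          Finset.sum_add_distrib] at h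
        have h2 : ∑ i, D i u t * pderiv ℝ j (X i) = D j u t := by
          rw [Finset.sum_eq_single j]
          · simp
          · intro i _ hi
            simp [pderiv_X_of_ne hi]
          · simp
        rw [h2] at h
        exact eq_neg_of_add_eq_zero_left h
      -- so the Euler field acts on the part of degree `n` of `D j u` as `-1`, and that part vanishes
      refine nat_le_order fun m hm => ?_
      have h1 : coeff m (∑ i, X i * (pderiv ℝ i (D j u t) - pderiv ℝ j (D i u t))) = 0 := by
        refine coeff_of_lt_order (lt_of_lt_of_le (b := ((n + 1 : ℕ) : ℕ∞))
          (by exact_mod_cast hm) (le_order_sum _ fun i _ => le_order_X_mul i (hcl i)))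
      simp only [mul_sub, Finset.sum_sub_distrib] at h1
      rw [heuler, sub_neg_eq_add, map_add, coeff_euler, ← add_one_mul] at h1
      exact (mul_eq_zero.1 h1).resolve_left (by positivity)
  exact fun t ht j => eq_zero_of_forall_le_order fun n => key n t ht j

end Flat

/-! ### Comparing the jets of a function with the coefficients of its flat lift -/

section SmoothComb

variable {d : ℕ} {U : Set (EuclideanSpace ℝ (Fin d))} {ι κ X : Type*}
  {S : Finset ι} {T : Finset κ}
  {G : ι → X → EuclideanSpace ℝ (Fin d) → ℝ} {H : κ → X → EuclideanSpace ℝ (Fin d) → ℝ}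
  {F F' : X → EuclideanSpace ℝ (Fin d) → ℝ}

/-- On `U`, the functions `F x` are linear combinations of the functions `G i x`, `i ∈ S`, with
smooth coefficients that do not depend on `x`. -/
def SmoothComb (U : Set (EuclideanSpace ℝ (Fin d))) (S : Finset ι)
    (G : ι → X → EuclideanSpace ℝ (Fin d) → ℝ) (F : X → EuclideanSpace ℝ (Fin d) → ℝ) : Prop :=
  ∃ c : ι → EuclideanSpace ℝ (Fin d) → ℝ, (∀ i, ContDiffOn ℝ ∞ (c i) U) ∧
    ∀ x, ∀ t ∈ U, F x t = ∑ i ∈ S, c i t * G i x t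

theorem SmoothComb.congr (h : SmoothComb U S G F) (hF : ∀ x, ∀ t ∈ U, F' x t = F x t) :
    SmoothComb U S G F' := by
  obtain ⟨c, hc, hc'⟩ := h
  exact ⟨c, hc, fun x t ht => by rw [hF x t ht, hc' x t ht]⟩

theorem SmoothComb.of_mem {i : ι} (hi : i ∈ S) : SmoothComb U S G (G i) := by
  classical
  refine ⟨fun j _ => if j = i then 1 else 0, fun _ => contDiffOn_const, fun x t _ => ?_⟩
  simp [hi]

theorem SmoothComb.zero : SmoothComb U S G (fun _ _ => 0) :=
  ⟨fun _ _ => 0, fun _ => contDiffOn_const, fun x t _ => by simp⟩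

theorem SmoothComb.add (h : SmoothComb U S G F) (h' : SmoothComb U S G F') :
    SmoothComb U S G (fun x t => F x t + F' x t) := by
  obtain ⟨c, hc, hF⟩ := h
  obtain ⟨c', hc', hF'⟩ := h'
  exact ⟨fun i t => c i t + c' i t, fun i => (hc i).add (hc' i), fun x t ht => by
    simp only [hF x t ht, hF' x t ht, add_mul, Finset.sum_add_distrib]⟩

theorem SmoothComb.smul {e : EuclideanSpace ℝ (Fin d) → ℝ} (he : ContDiffOn ℝ ∞ e U)
    (h : SmoothComb U S G F) : SmoothComb U S G (fun x t => e t * F x t) := by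
  obtain ⟨c, hc, hF⟩ := h
  exact ⟨fun i t => e t * c i t, fun i => he.mul (hc i), fun x t ht => by
    simp only [hF x t ht, mul_assoc, Finset.mul_sum]⟩

theorem SmoothComb.sub (h : SmoothComb U S G F) (h' : SmoothComb U S G F') :
    SmoothComb U S G (fun x t => F x t - F' x t) :=
  (h.add (h'.smul (e := fun _ => -1) contDiffOn_const)).congr fun x t _ => by ring

theorem SmoothComb.sum {R : Type*} {s : Finset R} {f : R → X → EuclideanSpace ℝ (Fin d) → ℝ}
    (h : ∀ r ∈ s, SmoothComb U S G (f r)) : SmoothComb U S G (fun x t => ∑ r ∈ s, f r x t) := by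
  classical
  induction s using Finset.induction_on with
  | empty => simpa using SmoothComb.zero
  | insert i s hi ih =>
    simp only [Finset.sum_insert hi]
    exact (h i (by simp)).add (ih fun j hj => h j (by simp [hj]))

theorem SmoothComb.trans (h : SmoothComb U S G F) (hG : ∀ i ∈ S, SmoothComb U T H (G i)) :
    SmoothComb U T H F := by
  obtain ⟨c, hc, hF⟩ := h
  exact (SmoothComb.sum fun i hi => (hG i hi).smul (hc i)).congr hF

theorem SmoothComb.mono {S' : Finset ι} (h : SmoothComb U S G F) (hS : S ⊆ S') :
    SmoothComb U S' G F :=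
  h.trans fun _ hi => SmoothComb.of_mem (hS hi)

theorem SmoothComb.fderiv (hU : IsOpen U) (h : SmoothComb U S G F)
    (hG : ∀ i ∈ S, ∀ x, ContDiffOn ℝ ∞ (G i x) U) (w : EuclideanSpace ℝ (Fin d))
    (hS : ∀ i ∈ S, SmoothComb U T H (G i))
    (hT : ∀ i ∈ S, SmoothComb U T H (fun x t => fderiv ℝ (G i x) t w)) :
    SmoothComb U T H (fun x t => fderiv ℝ (F x) t w) := by
  obtain ⟨c, hc, hF⟩ := h
  refine (SmoothComb.sum (s := S) (f := fun i x t =>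
    c i t * _root_.fderiv ℝ (G i x) t w + _root_.fderiv ℝ (c i) t w * G i x t) fun i hi =>
      ((hT i hi).smul (hc i)).add ((hS i hi).smul (contDiffOn_fderiv_apply hU (hc i) w))).congr
    fun x t ht => ?_
  have h1 : F x =ᶠ[nhds t] fun s => ∑ i ∈ S, c i s * G i x s := by
    filter_upwards [hU.mem_nhds ht] with s hs using hF x s hs
  have hd : ∀ {e : EuclideanSpace ℝ (Fin d) → ℝ}, ContDiffOn ℝ ∞ e U → DifferentiableAt ℝ e t :=
    fun he => (he.contDiffAt (hU.mem_nhds ht)).differentiableAt (by simp)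
  rw [h1.fderiv_eq, fderiv_fun_sum fun i hi => (hd (hc i)).fun_mul (hd (hG i hi x)),
    _root_.sum_apply]
  refine Finset.sum_congr rfl fun i hi => ?_
  rw [fderiv_fun_mul (hd (hc i)) (hd (hG i hi x))]
  simp [mul_comm]

/-- The multi-indices (lists) of length less than `n`. -/
def multiIndexLT (d n : ℕ) : Finset (List (Fin d)) := (List.finite_length_lt (Fin d) n).toFinset

@[simp]
theorem mem_multiIndexLT {n : ℕ} {α : List (Fin d)} : α ∈ multiIndexLT d n ↔ α.length < n := by
  simp [multiIndexLT]

theorem multiIndexLT_subset {m n : ℕ} (h : m ≤ n) : multiIndexLT d m ⊆ multiIndexLT d n :=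
  fun α hα => by
    rw [mem_multiIndexLT] at hα ⊢
    omega

/-- The partial derivatives in `y` at `y = 0`, for families of power series. -/
def yJet (u : X → EuclideanSpace ℝ (Fin d) → Series d) (α : List (Fin d)) (x : X)
    (t : EuclideanSpace ℝ (Fin d)) : ℝ := constantCoeff (yPartial α (u x t))

theorem yPartial_add (α : List (Fin d)) (f g : Series d) :
    yPartial α (f + g) = yPartial α f + yPartial α g := by
  induction α with
  | nil => rfl
  | cons i α ih => simp only [yPartial_cons, ih, map_add]

theorem yPartial_sum {R : Type*} (α : List (Fin d)) (s : Finset R) (f : R → Series d) :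
    yPartial α (∑ r ∈ s, f r) = ∑ r ∈ s, yPartial α (f r) := by
  induction α with
  | nil => rfl
  | cons i α ih => simp only [yPartial_cons, ih, map_sum]

variable {u : X → EuclideanSpace ℝ (Fin d) → Series d}

theorem yPartial_cons_mul (i : Fin d) (β : List (Fin d)) (f g : Series d) :
    yPartial (i :: β) (f * g) =
      yPartial β (pderiv ℝ i f * g) + yPartial β (f * pderiv ℝ i g) := by
  rw [yPartial_cons, ← yPartial_pderiv, Derivation.leibniz, smul_eq_mul, smul_eq_mul, yPartial_add,
    add_comm, mul_comm g]

theorem smoothComb_yJet_mul {w : EuclideanSpace ℝ (Fin d) → Series d} (hw : SmoothSeriesOn U w)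
    (β : List (Fin d)) :
    SmoothComb U (multiIndexLT d (β.length + 1)) (yJet u) (yJet (fun x t => w t * u x t) β) := by
  induction β generalizing w u with
  | nil =>
    refine ((SmoothComb.of_mem (G := yJet u) (i := []) (by simp)).smul hw.constantCoeff).congr ?_
    intro x t _
    simp [yJet, yPartial]
  | cons i β ih =>
    refine (((ih (u := u) (hw.pderiv i)).mono (multiIndexLT_subset (by simp))).add
      ((ih (u := fun x t => pderiv ℝ i (u x t)) hw).trans fun γ hγ => ?_)).congr
        fun x t _ => ?_
    · refine (SmoothComb.of_mem (i := i :: γ) ?_).congr fun x t _ => ?_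
      · simpa using hγ
      · simp only [yJet, yPartial_pderiv, yPartial_cons]
    · simp only [yJet, yPartial_cons_mul, map_add]

/-- Multiplication by a power series without constant term lowers the order in `∂/∂y`. -/
theorem smoothComb_yJet_mul_of_constantCoeff {w : EuclideanSpace ℝ (Fin d) → Series d}
    (hw : SmoothSeriesOn U w) (hw0 : ∀ t, constantCoeff (w t) = 0) (β : List (Fin d)) :
    SmoothComb U (multiIndexLT d β.length) (yJet u) (yJet (fun x t => w t * u x t) β) := by
  induction β generalizing u with
  | nil =>
    refine SmoothComb.zero.congr fun x t _ => ?_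
    simp [yJet, yPartial, hw0]
  | cons i β ih =>
    refine ((smoothComb_yJet_mul (u := u) (hw.pderiv i) β).add
      ((ih (u := fun x t => pderiv ℝ i (u x t))).trans fun γ hγ => ?_)).congr fun x t _ => ?_
    · refine (SmoothComb.of_mem (i := i :: γ) ?_).congr fun x t _ => ?_
      · simpa using hγ
      · simp only [yJet, yPartial_pderiv, yPartial_cons]
    · simp only [yJet, yPartial_cons_mul, map_add]

variable {W : Fin d → Fin d → EuclideanSpace ℝ (Fin d) → Series d}

theorem DiffSeriesAt.yPartial {t : EuclideanSpace ℝ (Fin d)}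
    {v : EuclideanSpace ℝ (Fin d) → Series d} (hv : DiffSeriesAt v t) (α : List (Fin d)) :
    DiffSeriesAt (fun s => yPartial α (v s)) t := by
  induction α with
  | nil => exact hv
  | cons i α ih => exact ih.pderiv i

theorem fderiv_yPartial {t : EuclideanSpace ℝ (Fin d)} {v : EuclideanSpace ℝ (Fin d) → Series d}
    (hv : DiffSeriesAt v t) (α : List (Fin d)) (j : Fin d) :
    _root_.fderiv ℝ (fun s => constantCoeff (yPartial α (v s))) t (stdVec j) =
      constantCoeff (yPartial α (xDeriv j v t)) := by
  have h : xDeriv j (fun s => Fedosov.yPartial α (v s)) t =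
      Fedosov.yPartial α (xDeriv j v t) := by
    induction α with
    | nil => rfl
    | cons i α ih =>
      simp only [yPartial_cons]
      rw [xDeriv_pderiv j i (hv.yPartial α), ih]
  rw [← h]
  rfl

/-- For a flat family `u`, an `x`-derivative raises the order of a `y`-jet by at most one. -/
theorem smoothComb_fderiv_yJet (hU : IsOpen U) (hW : ∀ i k, SmoothSeriesOn U (W i k))
    (hu : ∀ x, SmoothSeriesOn U (u x))
    (hflat : ∀ x, ∀ t ∈ U, ∀ i, fibreConn W i (u x) t = pderiv ℝ i (u x t))
    (β : List (Fin d)) (j : Fin d) :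
    SmoothComb U (multiIndexLT d (β.length + 2)) (yJet u)
      (fun x t => _root_.fderiv ℝ (yJet u β x) t (stdVec j)) := by
  refine ((SmoothComb.of_mem (i := j :: β) (by simp)).sub (SmoothComb.sum (s := Finset.univ)
    (f := fun k => yJet (fun x t => W j k t * pderiv ℝ k (u x t)) β) fun k _ =>
      (smoothComb_yJet_mul (hW j k) β).trans fun γ hγ =>
        (SmoothComb.of_mem (i := k :: γ) (by simpa using hγ)).congr fun x t _ => ?_)).congr
        fun x t ht => ?_
  · simp only [yJet, yPartial_pderiv, yPartial_cons]
  · have h := hflat x t ht j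
    rw [fibreConn, ← eq_sub_iff_add_eq] at h
    refine (fderiv_yPartial ((hu x).diffSeriesAt hU ht) β j).trans ?_
    rw [h, yPartial_sub, yPartial_sum, yPartial_pderiv, map_sub, map_sum]
    rfl

theorem contDiffOn_yJet (hu : ∀ x, SmoothSeriesOn U (u x)) (α : List (Fin d)) (x : X) :
    ContDiffOn ℝ ∞ (yJet u α x) U := ((hu x).yPartial α).constantCoeff

theorem contDiffOn_xPartial (hU : IsOpen U) {f : EuclideanSpace ℝ (Fin d) → ℝ}
    (hf : ContDiffOn ℝ ∞ f U) (α : List (Fin d)) : ContDiffOn ℝ ∞ (xPartial α f) U := by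
  induction α with
  | nil => exact hf
  | cons j α ih => exact contDiffOn_fderiv_apply hU ih _

variable {c : X → EuclideanSpace ℝ (Fin d) → ℝ}

/-- The partial derivatives of `c = u|_{y=0}` of order at most `n`, expressed by the `y`-jets of
order at most `n` of the flat family `u`. -/
theorem smoothComb_xPartial (hU : IsOpen U) (hW : ∀ i k, SmoothSeriesOn U (W i k))
    (hu : ∀ x, SmoothSeriesOn U (u x))
    (hflat : ∀ x, ∀ t ∈ U, ∀ i, fibreConn W i (u x) t = pderiv ℝ i (u x t))
    (hc : ∀ x, ∀ t ∈ U, constantCoeff (u x t) = c x t) (α : List (Fin d)) :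
    SmoothComb U (multiIndexLT d (α.length + 1)) (yJet u) (fun x => xPartial α (c x)) := by
  induction α with
  | nil =>
    refine (SmoothComb.of_mem (i := []) (by simp)).congr fun x t ht => ?_
    exact (hc x t ht).symm
  | cons j α ih =>
    refine ih.fderiv hU (fun β _ x => contDiffOn_yJet hu β x) (stdVec j)
      (fun β hβ => SmoothComb.of_mem (multiIndexLT_subset (by simp) hβ)) fun β hβ => ?_
    rw [mem_multiIndexLT] at hβ
    refine (smoothComb_fderiv_yJet hU hW hu hflat β j).mono (multiIndexLT_subset ?_)
    rw [List.length_cons]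
    omega

/-- The `y`-jets of order at most `n` of a flat family `u`, expressed by the partial derivatives
of order at most `n` of `c = u|_{y=0}`. -/
theorem smoothComb_yJet (hU : IsOpen U) (hW : ∀ i k, SmoothSeriesOn U (W i k))
    (hW0 : ∀ i k t, constantCoeff (W i k t) = 0)
    (hu : ∀ x, SmoothSeriesOn U (u x))
    (hflat : ∀ x, ∀ t ∈ U, ∀ i, fibreConn W i (u x) t = pderiv ℝ i (u x t))
    (hc : ∀ x, ∀ t ∈ U, constantCoeff (u x t) = c x t) (α : List (Fin d)) :
    SmoothComb U (multiIndexLT d (α.length + 1)) (fun β x => xPartial β (c x)) (yJet u α) := by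
  have hcs : ∀ x, ContDiffOn ℝ ∞ (c x) U := fun x =>
    (hu x).constantCoeff.congr fun t ht => (hc x t ht).symm
  induction hn : α.length using Nat.strong_induction_on generalizing α with
  | _ n ih =>
    subst hn
    cases α with
    | nil =>
      refine (SmoothComb.of_mem (i := []) (by simp)).congr fun x t ht => ?_
      exact hc x t ht
    | cons i β =>
      -- `∂u/∂yⁱ = ∂u/∂xⁱ + ∑ₖ Wᵢᵏ ∂u/∂yᵏ`, and the second term has smaller order than the left side,
      -- as `W` has no constant term
      have h1 : SmoothComb U (multiIndexLT d (β.length + 2)) (fun β x => xPartial β (c x))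
          (fun x t => _root_.fderiv ℝ (yJet u β x) t (stdVec i)) := by
        refine (ih β.length (by simp) β rfl).fderiv hU
          (fun γ _ x => contDiffOn_xPartial hU (hcs x) γ) (stdVec i)
          (fun γ hγ => SmoothComb.of_mem (multiIndexLT_subset (by omega) hγ)) fun γ hγ => ?_
        refine SmoothComb.of_mem (G := fun β x => xPartial β (c x)) (i := i :: γ) ?_
        rw [mem_multiIndexLT] at hγ ⊢
        rw [List.length_cons]
        omega
      refine (h1.add (SmoothComb.sum (s := Finset.univ)
        (f := fun k => yJet (fun x t => W i k t * pderiv ℝ k (u x t)) β) fun k _ =>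
          (smoothComb_yJet_mul_of_constantCoeff (hW i k) (hW0 i k) β).trans fun γ hγ => ?_)).congr
        fun x t ht => ?_
      · rw [mem_multiIndexLT] at hγ
        refine ((ih (k :: γ).length (by simpa using hγ) (k :: γ) rfl).mono
          (multiIndexLT_subset ?_)).congr fun x t _ => ?_
        · rw [List.length_cons]
          omega
        · simp only [yJet, yPartial_pderiv, yPartial_cons]
      · have h := hflat x t ht i
        have h2 : _root_.fderiv ℝ (yJet u β x) t (stdVec i) = _ :=
          fderiv_yPartial ((hu x).diffSeriesAt hU ht) β i
        rw [h2, yJet, yPartial_cons, ← yPartial_pderiv, ← h, fibreConn, yPartial_add, yPartial_sum,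
          map_add, map_sum]
        rfl

end SmoothComb

/-! ### Coordinate frames -/

section Frames

variable {d : ℕ} {M : Type*} [TopologicalSpace M] [ChartedSpace (EuclideanSpace ℝ (Fin d)) M]
  {φ ψ : OpenPartialHomeomorph M (EuclideanSpace ℝ (Fin d))} {x : M}

theorem chartAt_mem_charts [IsManifold (𝓡 d) ∞ M] (x : M) :
    chartAt (EuclideanSpace ℝ (Fin d)) x ∈ charts d M :=
  IsManifold.chart_mem_maximalAtlas x

theorem contMDiffAt_of_mem_charts (hφ : φ ∈ charts d M) (hx : x ∈ φ.source) :
    ContMDiffAt (𝓡 d) (𝓡 d) ∞ φ x :=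
  contMDiffAt_of_mem_maximalAtlas hφ hx

theorem mdifferentiable_of_mem_charts (hφ : φ ∈ charts d M) :
    φ.MDifferentiable (𝓡 d) (𝓡 d) :=
  ⟨(contMDiffOn_of_mem_maximalAtlas hφ).mdifferentiableOn (by simp),
    (contMDiffOn_symm_of_mem_maximalAtlas hφ).mdifferentiableOn (by simp)⟩

theorem mvfderiv_isInvertible (hφ : φ ∈ charts d M) (hx : x ∈ φ.source) :
    (mvfderiv (𝓡 d) φ x).IsInvertible :=
  ⟨((mdifferentiable_of_mem_charts hφ).mfderiv hx).trans (NormedSpace.fromTangentSpace (φ x)), rfl⟩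

theorem mvfderiv_injective (hφ : φ ∈ charts d M) (hx : x ∈ φ.source) :
    Function.Injective (mvfderiv (𝓡 d) φ x) := by
  obtain ⟨e, he⟩ := mvfderiv_isInvertible hφ hx
  rw [← he]
  exact e.injective

theorem mvfderiv_frame (hφ : φ ∈ charts d M) (hx : x ∈ φ.source) (i : Fin d) :
    mvfderiv (𝓡 d) φ x (frame φ i x) = stdVec i := by
  obtain ⟨e, he⟩ := mvfderiv_isInvertible hφ hx
  rw [frame, ← he, ContinuousLinearMap.inverse_equiv]
  exact e.apply_symm_apply _

theorem frame_eq_mfderiv_symm (hφ : φ ∈ charts d M) (hx : x ∈ φ.source) (i : Fin d) :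
    frame φ i x = mfderiv (𝓡 d) (𝓡 d) φ.symm (φ x) (stdVec i : EuclideanSpace ℝ (Fin d)) := by
  apply mvfderiv_injective hφ hx
  refine (mvfderiv_frame hφ hx i).trans ?_
  have h2 := (mdifferentiable_of_mem_charts hφ).comp_symm_deriv (φ.map_source hx)
  rw [φ.left_inv hx] at h2
  exact (congrArg (fun L => L (stdVec i : EuclideanSpace ℝ (Fin d))) h2).symm

/-- In the coordinates of a chart, `df(∂/∂xᵏ)` is the partial derivative of `f`. -/
theorem dif_frame (hφ : φ ∈ charts d M) (hx : x ∈ φ.source) {f : M → ℝ}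
    (hf : MDifferentiableAt (𝓡 d) 𝓘(ℝ, ℝ) f x) (k : Fin d) :
    dif f x (frame φ k x) = fderiv ℝ (f ∘ φ.symm) (φ x) (stdVec k) := by
  have hf' : MDifferentiableAt (𝓡 d) 𝓘(ℝ, ℝ) f (φ.symm (φ x)) := by rwa [φ.left_inv hx]
  have h := mfderiv_comp (φ x) hf' ((mdifferentiable_of_mem_charts hφ).mdifferentiableAt_symm
    (φ.map_source hx))
  rw [mfderiv_eq_fderiv] at h
  have hpt : ∀ (y : M), y = x → ∀ v : EuclideanSpace ℝ (Fin d),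
      (mfderiv (𝓡 d) 𝓘(ℝ, ℝ) f y v : ℝ) = mfderiv (𝓡 d) 𝓘(ℝ, ℝ) f x v := by
    rintro y rfl v
    rfl
  rw [h, frame_eq_mfderiv_symm hφ hx]
  exact (hpt _ (φ.left_inv hx) _).symm

theorem mdifferentiableAt_coord (hφ : φ ∈ charts d M) (hx : x ∈ φ.source) (k : Fin d) :
    MDifferentiableAt (𝓡 d) 𝓘(ℝ, ℝ) (fun z => φ z k) x :=
  MDifferentiableAt.comp x (g := fun v : EuclideanSpace ℝ (Fin d) => v k)
    (EuclideanSpace.proj k : EuclideanSpace ℝ (Fin d) →L[ℝ] ℝ).differentiableAt.mdifferentiableAt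
    ((mdifferentiable_of_mem_charts hφ).mdifferentiableAt hx)

theorem coframe_apply (hφ : φ ∈ charts d M) (hx : x ∈ φ.source) (k : Fin d)
    (v : TangentSpace (𝓡 d) x) :
    coframe φ k x v = (mvfderiv (𝓡 d) φ x v : EuclideanSpace ℝ (Fin d)) k := by
  have h := mfderiv_comp x (g := fun v : EuclideanSpace ℝ (Fin d) => v k)
    (I' := 𝓡 d) (I'' := 𝓘(ℝ, ℝ))
    (EuclideanSpace.proj k : EuclideanSpace ℝ (Fin d) →L[ℝ] ℝ).differentiableAt.mdifferentiableAt
    ((mdifferentiable_of_mem_charts hφ).mdifferentiableAt hx)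
  rw [mfderiv_eq_fderiv] at h
  have h2 : fderiv ℝ (fun v : EuclideanSpace ℝ (Fin d) => v k) (φ x) =
      (EuclideanSpace.proj k : EuclideanSpace ℝ (Fin d) →L[ℝ] ℝ) :=
    (EuclideanSpace.proj k : EuclideanSpace ℝ (Fin d) →L[ℝ] ℝ).fderiv
  rw [h2] at h
  exact congrArg (fun L => L v) h

theorem coframe_frame (hφ : φ ∈ charts d M) (hx : x ∈ φ.source) (k i : Fin d) :
    coframe φ k x (frame φ i x) = if k = i then 1 else 0 := by
  rw [coframe_apply hφ hx, mvfderiv_frame hφ hx]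
  simp [stdVec]

theorem sum_coframe_smul_frame (hφ : φ ∈ charts d M) (hx : x ∈ φ.source)
    (v : TangentSpace (𝓡 d) x) : ∑ i, coframe φ i x v • frame φ i x = v := by
  apply mvfderiv_injective hφ hx
  rw [map_sum]
  simp only [map_smul, mvfderiv_frame hφ hx, coframe_apply hφ hx]
  ext k
  simp [stdVec, Pi.single_apply]

theorem sum_stdCoord_smul_stdTangent (v : TangentSpace (𝓡 d) x) :
    ∑ l, stdCoord v l • stdTangent x l = v := by
  have h : ∀ w : EuclideanSpace ℝ (Fin d), ∑ l, w l • stdVec l = w := fun w => by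
    ext k
    simp [stdVec, Pi.single_apply]
  exact h v

theorem stdCoord_stdTangent (l m : Fin d) :
    stdCoord (stdTangent x l) m = if m = l then 1 else 0 := by
  simp [stdCoord, stdTangent, stdVec]

theorem stdCoord_add (v w : TangentSpace (𝓡 d) x) (m : Fin d) :
    stdCoord (v + w) m = stdCoord v m + stdCoord w m := rfl

theorem stdCoord_smul (r : ℝ) (v : TangentSpace (𝓡 d) x) (m : Fin d) :
    stdCoord (r • v) m = r * stdCoord v m := rfl

theorem stdCoord_sum {ι : Type*} (s : Finset ι) (v : ι → TangentSpace (𝓡 d) x) (m : Fin d) :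
    stdCoord (∑ i ∈ s, v i) m = ∑ i ∈ s, stdCoord (v i) m := by
  classical
  induction s using Finset.induction_on with
  | empty => simp; rfl
  | insert i s hi ih => rw [Finset.sum_insert hi, stdCoord_add, ih, Finset.sum_insert hi]

theorem inChart_eq_linSubst (f : Series d) :
    inChart φ x f = linSubst (fun m i => stdCoord (frame φ i x) m) f := rfl

/-- The inverse of `inChart`: a power series in the fibre coordinates of the chart `φ`, rewritten in
the standard coordinates of `TₓM`. -/
def outChart (φ : OpenPartialHomeomorph M (EuclideanSpace ℝ (Fin d))) (x : M) (f : Series d) :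
    Series d :=
  linSubst (fun i l => coframe φ i x (stdTangent x l)) f

/-- The Jacobian matrix `∂xᵢ/∂x'ⱼ` of the coordinates of `φ` with respect to those of `ψ`. -/
def jac (φ ψ : OpenPartialHomeomorph M (EuclideanSpace ℝ (Fin d))) (x : M) (i j : Fin d) : ℝ :=
  coframe φ i x (frame ψ j x)

theorem outChart_inChart (hφ : φ ∈ charts d M) (hx : x ∈ φ.source) (f : Series d) :
    outChart φ x (inChart φ x f) = f := by
  rw [outChart, inChart_eq_linSubst, linSubst_linSubst]
  conv_rhs => rw [← linSubst_id f]
  congr 1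
  funext m l
  rw [← stdCoord_stdTangent (x := x) l m]
  conv_rhs => rw [← sum_coframe_smul_frame hφ hx (stdTangent x l)]
  rw [stdCoord_sum]
  simp only [stdCoord_smul, mul_comm]

theorem inChart_outChart (hφ : φ ∈ charts d M) (hx : x ∈ φ.source) (f : Series d) :
    inChart φ x (outChart φ x f) = f := by
  rw [outChart, inChart_eq_linSubst, linSubst_linSubst]
  conv_rhs => rw [← linSubst_id f]
  congr 1
  funext k i
  rw [← coframe_frame hφ hx k i]
  conv_rhs => rw [← sum_stdCoord_smul_stdTangent (frame φ i x), map_sum]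
  simp only [map_smul, smul_eq_mul, mul_comm]

theorem inChart_injective (hφ : φ ∈ charts d M) (hx : x ∈ φ.source) {f g : Series d}
    (h : inChart φ x f = inChart φ x g) : f = g := by
  rw [← outChart_inChart hφ hx f, h, outChart_inChart hφ hx]

/-- Change of chart. -/
theorem inChart_eq_linSubst_jac (hφ : φ ∈ charts d M) (hx : x ∈ φ.source) (f : Series d) :
    inChart ψ x f = linSubst (jac φ ψ x) (inChart φ x f) := by
  rw [inChart_eq_linSubst, inChart_eq_linSubst, linSubst_linSubst]
  congr 1
  funext m j
  conv_lhs => rw [← sum_coframe_smul_frame hφ hx (frame ψ j x)]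
  rw [stdCoord_sum]
  simp only [stdCoord_smul, mul_comm, jac]

@[simp]
theorem constantCoeff_inChart (f : Series d) :
    constantCoeff (inChart φ x f) = constantCoeff f :=
  constantCoeff_linSubst _ f

theorem contDiffOn_comp_symm (hφ : φ ∈ charts d M) {f : M → ℝ}
    (hf : ContMDiffOn (𝓡 d) 𝓘(ℝ, ℝ) ∞ f φ.source) :
    ContDiffOn ℝ ∞ (f ∘ φ.symm) φ.target := by
  rw [← contMDiffOn_iff_contDiffOn]
  exact hf.comp (contMDiffOn_symm_of_mem_maximalAtlas hφ) fun t ht => φ.map_target ht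

theorem contMDiffOn_comp_chart (hφ : φ ∈ charts d M) {f : EuclideanSpace ℝ (Fin d) → ℝ}
    (hf : ContDiffOn ℝ ∞ f φ.target) :
    ContMDiffOn (𝓡 d) 𝓘(ℝ, ℝ) ∞ (f ∘ φ) φ.source :=
  hf.contMDiffOn.comp (contMDiffOn_of_mem_maximalAtlas hφ) fun _ hx => φ.map_source hx

end Frames

/-! ### The connection in coordinates -/

section Connection

variable {d : ℕ} {M : Type*} [TopologicalSpace M] [ChartedSpace (EuclideanSpace ℝ (Fin d)) M]
  [IsManifold (𝓡 d) ∞ M]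
  {φ ψ : OpenPartialHomeomorph M (EuclideanSpace ℝ (Fin d))} {x : M}

/-- The vector field `V` is smooth at `x`. -/
abbrev SmoothFieldAt (V : ∀ x : M, TangentSpace (𝓡 d) x) (x : M) : Prop :=
  ContMDiffAt (𝓡 d) ((𝓡 d).prod 𝓘(ℝ, EuclideanSpace ℝ (Fin d))) ∞
    (fun z => Bundle.TotalSpace.mk' (EuclideanSpace ℝ (Fin d))
      (E := (TangentSpace (𝓡 d) : M → Type _)) z (V z)) x

theorem smoothFieldAt_frame (hφ : φ ∈ charts d M) (hx : x ∈ φ.source) (i : Fin d) :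
    SmoothFieldAt (frame φ i) x := by
  have hV : SmoothFieldAt (fun _ : EuclideanSpace ℝ (Fin d) =>
      (stdVec i : EuclideanSpace ℝ (Fin d))) (φ x) := by
    refine contMDiffAt_vectorSpace_iff_contDiffAt.2 ?_
    exact contDiffAt_const
  have hinv : (mfderiv (𝓡 d) (𝓡 d) φ x).IsInvertible :=
    ⟨(mdifferentiable_of_mem_charts hφ).mfderiv hx, rfl⟩
  exact hV.mpullback_vectorField_preimage (contMDiffAt_of_mem_charts hφ hx) hinv (by simp)

theorem contMDiffAt_coframe_apply (hφ : φ ∈ charts d M) (hx : x ∈ φ.source) (k : Fin d)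
    {V : ∀ x : M, TangentSpace (𝓡 d) x} (hV : SmoothFieldAt V x) :
    ContMDiffAt (𝓡 d) 𝓘(ℝ, ℝ) ∞ (fun z => coframe φ k z (V z)) x := by
  have h1 : ContMDiffOn (𝓡 d) (𝓡 d) ∞ φ φ.source := contMDiffOn_of_mem_maximalAtlas hφ
  have h2 := h1.contMDiffOn_tangentMapWithin (m := ∞) (by simp) φ.open_source.uniqueMDiffOn
  have h3 : ContMDiffAt (𝓡 d).tangent (𝓡 d).tangent ∞ (tangentMapWithin (𝓡 d) (𝓡 d) φ φ.source)
      (⟨x, V x⟩ : TangentBundle (𝓡 d) M) :=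
    h2.contMDiffAt ((FiberBundle.continuous_proj (EuclideanSpace ℝ (Fin d))
      (TangentSpace (𝓡 d) : M → Type _)).continuousAt.preimage_mem_nhds
        (φ.open_source.mem_nhds hx))
  have h4 := (contMDiff_snd_tangentBundle_modelSpace (EuclideanSpace ℝ (Fin d)) (𝓡 d) (n := ∞)
    ).contMDiffAt.comp x (h3.comp x hV)
  have h5 : ContMDiffAt (𝓡 d) 𝓘(ℝ, ℝ) ∞ _ x :=
    ((EuclideanSpace.proj k : EuclideanSpace ℝ (Fin d) →L[ℝ] ℝ).contDiff.contMDiff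
      (n := ∞)).contMDiffAt.comp x h4
  refine h5.congr_of_eventuallyEq ?_
  filter_upwards [φ.open_source.mem_nhds hx] with z hz
  rw [coframe_apply hφ hz]
  change _ = WithLp.ofLp (p := 2) (V := Fin d → ℝ)
    (mfderivWithin (𝓡 d) (𝓡 d) φ φ.source z (V z)) k
  rw [mfderivWithin_of_isOpen φ.open_source hz]
  rfl

theorem SmoothFieldAt.mdifferentiableAt {V : ∀ x : M, TangentSpace (𝓡 d) x}
    (hV : SmoothFieldAt V x) :
    MDifferentiableAt (𝓡 d) ((𝓡 d).prod 𝓘(ℝ, EuclideanSpace ℝ (Fin d)))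
      (fun z => Bundle.TotalSpace.mk' (EuclideanSpace ℝ (Fin d))
        (E := (TangentSpace (𝓡 d) : M → Type _)) z (V z)) x :=
  ContMDiffAt.mdifferentiableAt hV (by simp)

theorem contMDiffAt_jac (hφ : φ ∈ charts d M) (hψ : ψ ∈ charts d M) (hx : x ∈ φ.source)
    (hx' : x ∈ ψ.source) (i j : Fin d) :
    ContMDiffAt (𝓡 d) 𝓘(ℝ, ℝ) ∞ (fun z => jac φ ψ z i j) x :=
  contMDiffAt_coframe_apply hφ hx i (smoothFieldAt_frame hψ hx' j)

theorem contMDiffOn_christoffel [T2Space M]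
    {cov : CovariantDerivative (𝓡 d) (EuclideanSpace ℝ (Fin d))
      (TangentSpace (𝓡 d) : M → Type _)}
    (hcov : cov.ContMDiffCovariantDerivative ∞) (hφ : φ ∈ charts d M) (k i j : Fin d) :
    ContMDiffOn (𝓡 d) 𝓘(ℝ, ℝ) ∞ (christoffel cov φ k i j) φ.source := by
  intro x hx
  refine ContMDiffAt.contMDiffWithinAt ?_
  -- `frame φ j` is cut off by a bump function, as `hcov` concerns globally smooth fields.
  obtain ⟨f, -, hf⟩ := (SmoothBumpFunction.nhds_basis_tsupport (I := 𝓡 d) x).mem_iff.1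
    (φ.open_source.mem_nhds hx)
  let Y : ∀ z : M, TangentSpace (𝓡 d) z := (f : M → ℝ) • frame φ j
  have hframe : ∀ z ∈ φ.source, ∀ l, SmoothFieldAt (frame φ l) z :=
    fun z hz l => smoothFieldAt_frame hφ hz l
  have hY : ContMDiff (𝓡 d) ((𝓡 d).prod 𝓘(ℝ, EuclideanSpace ℝ (Fin d))) ∞
      (fun z => Bundle.TotalSpace.mk' (EuclideanSpace ℝ (Fin d))
        (E := (TangentSpace (𝓡 d) : M → Type _)) z (Y z)) :=
    ContMDiffOn.smul_section_of_tsupport f.contMDiff.contMDiffOn φ.open_source hf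
      fun z hz => (hframe z hz j).contMDiffWithinAt
  have hcY := hcov.contMDiff.contMDiff (σ := Y) hY.contMDiffOn
  have hV : SmoothFieldAt (fun z => cov Y z (frame φ i z)) x :=
    (hcY.contMDiffAt Filter.univ_mem).clm_bundle_apply (hframe x hx i)
  refine (contMDiffAt_coframe_apply hφ hx k hV).congr_of_eventuallyEq ?_
  filter_upwards [φ.open_source.mem_nhds hx, f.eventuallyEq_one.eventuallyEq_nhds] with z hz hfz
  rw [christoffel, cov.isCovariantDerivativeOnUniv.congr_of_eventuallyEq (σ' := Y)
    (hframe z hz j).mdifferentiableAt (SmoothFieldAt.mdifferentiableAt (hY z)) Filter.univ_mem]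
  filter_upwards [hfz] with w hw
  simp [Y, hw]

/-- The transformation law of the Christoffel symbols. -/
theorem sum_jac_mul_christoffel
    (cov : CovariantDerivative (𝓡 d) (EuclideanSpace ℝ (Fin d))
      (TangentSpace (𝓡 d) : M → Type _))
    (hφ : φ ∈ charts d M) (hψ : ψ ∈ charts d M) (hx : x ∈ φ.source) (hx' : x ∈ ψ.source)
    (m j l : Fin d) :
    ∑ k, jac φ ψ x m k * christoffel cov ψ k j l x =
      dif (fun z => jac φ ψ z m l) x (frame ψ j x) +
        ∑ i, ∑ p, jac φ ψ x i j * jac φ ψ x p l * christoffel cov φ m i p x := by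
  have hjac : ∀ p, MDifferentiableAt (𝓡 d) 𝓘(ℝ, ℝ) (fun z => jac φ ψ z p l) x := fun p =>
    (contMDiffAt_jac hφ hψ hx hx' p l).mdifferentiableAt (by simp)
  have hfr : ∀ p, _ := fun p => (smoothFieldAt_frame hφ hx p).mdifferentiableAt
  have hterm : ∀ p, MDifferentiableAt (𝓡 d) ((𝓡 d).prod 𝓘(ℝ, EuclideanSpace ℝ (Fin d)))
      (fun z => Bundle.TotalSpace.mk' (EuclideanSpace ℝ (Fin d))
        (E := (TangentSpace (𝓡 d) : M → Type _)) z
          (((fun z => jac φ ψ z p l) • frame φ p : ∀ z : M, TangentSpace (𝓡 d) z) z)) x :=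
    fun p => (hjac p).smul_section (hfr p)
  have hsum : ∀ s : Finset (Fin d),
      MDifferentiableAt (𝓡 d) ((𝓡 d).prod 𝓘(ℝ, EuclideanSpace ℝ (Fin d)))
        (fun z => Bundle.TotalSpace.mk' (EuclideanSpace ℝ (Fin d))
          (E := (TangentSpace (𝓡 d) : M → Type _)) z
            ((∑ p ∈ s, (fun z => jac φ ψ z p l) • frame φ p :
              ∀ z : M, TangentSpace (𝓡 d) z) z)) x ∧
      cov (∑ p ∈ s, (fun z => jac φ ψ z p l) • frame φ p) x =
        ∑ p ∈ s, (jac φ ψ x p l • cov (frame φ p) x +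
          (mvfderiv (𝓡 d) (fun z => jac φ ψ z p l) x).smulRight (frame φ p x)) := by
    classical
    intro s
    induction s using Finset.induction_on with
    | empty =>
      simp only [Finset.sum_empty]
      exact ⟨Bundle.mdifferentiableAt_zeroSection .., by simp⟩
    | insert p s hp ih =>
      simp only [Finset.sum_insert hp]
      refine ⟨mdifferentiableAt_add_section (hterm p) ih.1, ?_⟩
      rw [cov.isCovariantDerivativeOnUniv.add (hterm p) ih.1, ih.2,
        cov.isCovariantDerivativeOnUniv.leibniz (hfr p) (hjac p)]
  have hcov : cov (frame ψ l) x = _ :=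
    (cov.isCovariantDerivativeOnUniv.congr_of_eventuallyEq
      (smoothFieldAt_frame hψ hx' l).mdifferentiableAt (hsum Finset.univ).1 Filter.univ_mem (by
        filter_upwards [φ.open_source.mem_nhds hx] with z hz
        rw [Finset.sum_apply]
        exact (sum_coframe_smul_frame hφ hz (frame ψ l z)).symm)).trans (hsum Finset.univ).2
  have hL : ∑ k, jac φ ψ x m k * christoffel cov ψ k j l x =
      coframe φ m x (cov (frame ψ l) x (frame ψ j x)) := by
    conv_rhs => rw [← sum_coframe_smul_frame hψ hx' (cov (frame ψ l) x (frame ψ j x)), map_sum]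
    simp only [map_smul, smul_eq_mul, christoffel, jac, mul_comm]
  rw [hL, hcov, _root_.sum_apply, map_sum]
  simp only [_root_.add_apply, _root_.smul_apply, ContinuousLinearMap.smulRight_apply, map_add,
    map_smul, coframe_frame hφ hx, smul_eq_mul, Finset.sum_add_distrib]
  rw [add_comm]
  congr 1
  · simp [dif]
  · rw [Finset.sum_comm]
    refine Finset.sum_congr rfl fun p _ => ?_
    conv_lhs => rw [← sum_coframe_smul_frame hφ hx (frame ψ j x), map_sum, map_sum, Finset.mul_sum]
    refine Finset.sum_congr rfl fun i _ => ?_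
    simp only [map_smul, smul_eq_mul, christoffel, jac]
    ring

end Connection

/-! ### The operator `D` in coordinates -/

section Differential

variable {d : ℕ} {M : Type*} [TopologicalSpace M] [ChartedSpace (EuclideanSpace ℝ (Fin d)) M]
  {φ ψ : OpenPartialHomeomorph M (EuclideanSpace ℝ (Fin d))} {x : M}

theorem constantCoeff_comp (A : FibreVectorOneForm d M) (i k : Fin d) :
    constantCoeff (A.comp φ i k x) = 0 := by
  have h : ∀ a b, constantCoeff (A.toFun x a b) = 0 := fun a b => A.order_two x a b 0 (by simp)
  simp [FibreVectorOneForm.comp, h]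

theorem sum_jac_mul_comp (A : FibreVectorOneForm d M) (hφ : φ ∈ charts d M)
    (hψ : ψ ∈ charts d M) (hx : x ∈ φ.source) (hx' : x ∈ ψ.source) (j m : Fin d) :
    ∑ k, C (jac φ ψ x m k) * A.comp ψ j k x =
      ∑ i, C (jac φ ψ x i j) * linSubst (jac φ ψ x) (A.comp φ i m x) := by
  have h1 : ∀ b, ∑ k, jac φ ψ x m k * coframe ψ k x (stdTangent x b) =
      coframe φ m x (stdTangent x b) := fun b => by
    conv_rhs => rw [← sum_coframe_smul_frame hψ hx' (stdTangent x b), map_sum]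
    simp only [map_smul, smul_eq_mul, jac, mul_comm]
  have h2 : ∀ a, ∑ i, jac φ ψ x i j * stdCoord (frame φ i x) a = stdCoord (frame ψ j x) a :=
    fun a => by
      conv_rhs => rw [← sum_coframe_smul_frame hφ hx (frame ψ j x), stdCoord_sum]
      simp only [stdCoord_smul, jac]
  have hL : ∑ k, C (jac φ ψ x m k) * A.comp ψ j k x = ∑ a, ∑ b,
      C (stdCoord (frame ψ j x) a * coframe φ m x (stdTangent x b)) *
        inChart ψ x (A.toFun x a b) := by
    simp only [FibreVectorOneForm.comp, Finset.mul_sum]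
    rw [Finset.sum_comm]
    refine Finset.sum_congr rfl fun a _ => ?_
    rw [Finset.sum_comm]
    refine Finset.sum_congr rfl fun b _ => ?_
    rw [← h1 b, Finset.mul_sum, map_sum, Finset.sum_mul]
    refine Finset.sum_congr rfl fun k _ => ?_
    simp only [map_mul]
    ring
  have hR : ∑ i, C (jac φ ψ x i j) * linSubst (jac φ ψ x) (A.comp φ i m x) = ∑ a, ∑ b,
      C (stdCoord (frame ψ j x) a * coframe φ m x (stdTangent x b)) *
        inChart ψ x (A.toFun x a b) := by
    simp only [FibreVectorOneForm.comp, linSubst_sum, linSubst_mul, linSubst_C,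
      ← inChart_eq_linSubst_jac hφ hx, Finset.mul_sum]
    rw [Finset.sum_comm]
    refine Finset.sum_congr rfl fun a _ => ?_
    rw [Finset.sum_comm]
    refine Finset.sum_congr rfl fun b _ => ?_
    rw [← h2 a, Finset.sum_mul, map_sum, Finset.sum_mul]
    refine Finset.sum_congr rfl fun i _ => ?_
    simp only [map_mul]
    ring
  rw [hL, hR]

variable [IsManifold (𝓡 d) ∞ M]
  {cov : CovariantDerivative (𝓡 d) (EuclideanSpace ℝ (Fin d))
    (TangentSpace (𝓡 d) : M → Type _)} {A : FibreVectorOneForm d M}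

/-- The components `Aᵏᵢ - Γᵏᵢⱼ yʲ` of the one-form by which `D + δ` differs from `∂/∂xⁱ`
in a chart. -/
def connForm (cov : CovariantDerivative (𝓡 d) (EuclideanSpace ℝ (Fin d))
      (TangentSpace (𝓡 d) : M → Type _)) (A : FibreVectorOneForm d M)
    (φ : OpenPartialHomeomorph M (EuclideanSpace ℝ (Fin d))) (i k : Fin d)
    (t : EuclideanSpace ℝ (Fin d)) : Series d :=
  A.comp φ i k (φ.symm t) - ∑ j, C (christoffel cov φ k i j (φ.symm t)) * X j

theorem Dcomp_eq (i : Fin d) (a : EuclideanSpace ℝ (Fin d) → Series d)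
    (t : EuclideanSpace ℝ (Fin d)) :
    Dcomp cov A φ i a t = fibreConn (connForm cov A φ) i a t - pderiv ℝ i (a t) := by
  simp only [Dcomp, fibreConn, connForm, sub_mul, Finset.sum_sub_distrib, Finset.sum_mul]
  rw [Finset.sum_comm]
  ring

theorem Dcomp_eq_fibreConn (i : Fin d) (a : EuclideanSpace ℝ (Fin d) → Series d)
    (t : EuclideanSpace ℝ (Fin d)) :
    Dcomp cov A φ i a t = fibreConn
      (fun i k t => connForm cov A φ i k t - C (if i = k then 1 else 0)) i a t := by
  rw [Dcomp_eq]
  simp only [fibreConn, sub_mul, Finset.sum_sub_distrib, apply_ite C, map_one, map_zero, ite_mul,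
    one_mul, zero_mul, Finset.sum_ite_eq, Finset.mem_univ, if_true]
  ring

theorem constantCoeff_connForm (i k : Fin d) (t : EuclideanSpace ℝ (Fin d)) :
    constantCoeff (connForm cov A φ i k t) = 0 := by
  simp [connForm, constantCoeff_comp]

theorem smoothSeriesOn_connForm [T2Space M] (hcov : cov.ContMDiffCovariantDerivative ∞)
    (hφ : φ ∈ charts d M) (i k : Fin d) : SmoothSeriesOn φ.target (connForm cov A φ i k) :=
  SmoothSeriesOn.sub (fun m => contDiffOn_comp_symm hφ (A.smooth φ hφ i k m))
    (SmoothSeriesOn.sum fun j _ =>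
      (smoothSeriesOn_C (contDiffOn_comp_symm hφ (contMDiffOn_christoffel hcov hφ k i j))).mul
        (smoothSeriesOn_const _))

/-- `D` does not depend on the chart. -/
theorem Dcomp_linSubst (hφ : φ ∈ charts d M) (hψ : ψ ∈ charts d M)
    {t : EuclideanSpace ℝ (Fin d)} (ht : t ∈ ψ.target) (ht' : ψ.symm t ∈ φ.source)
    {u : EuclideanSpace ℝ (Fin d) → Series d} (hu : DiffSeriesAt u (φ (ψ.symm t))) (j : Fin d) :
    Dcomp cov A ψ j (fun s => linSubst (jac φ ψ (ψ.symm s)) (u (φ (ψ.symm s)))) t =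
      ∑ i, C (jac φ ψ (ψ.symm t) i j) *
        linSubst (jac φ ψ (ψ.symm t)) (Dcomp cov A φ i u (φ (ψ.symm t))) := by
  simp only [Dcomp_eq_fibreConn]
  have hsymm : MDifferentiableAt (𝓡 d) (𝓡 d) ψ.symm t :=
    (mdifferentiable_of_mem_charts hψ).mdifferentiableAt_symm ht
  have hψt : ψ.symm t ∈ ψ.source := ψ.map_target ht
  have hjac : ∀ m i, MDifferentiableAt (𝓡 d) 𝓘(ℝ, ℝ) (fun z => jac φ ψ z m i) (ψ.symm t) :=
    fun m i => (contMDiffAt_jac hφ hψ ht' hψt m i).mdifferentiableAt (by simp)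
  have hJ : ∀ m i, DifferentiableAt ℝ (fun s => jac φ ψ (ψ.symm s) m i) t := fun m i =>
    mdifferentiableAt_iff_differentiableAt.1 ((hjac m i).comp t hsymm)
  have hθ : DifferentiableAt ℝ (fun s => φ (ψ.symm s)) t :=
    mdifferentiableAt_iff_differentiableAt.1
      (((mdifferentiable_of_mem_charts hφ).mdifferentiableAt ht').comp t hsymm)
  refine fibreConn_linSubst (J := fun s => jac φ ψ (ψ.symm s)) (θ := fun s => φ (ψ.symm s))
    hJ hθ (fun i k => ?_) (fun j m => ?_) hu j
  · have h := dif_frame hψ hψt (mdifferentiableAt_coord hφ ht' i) k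
    rw [ψ.right_inv ht] at h
    exact h.symm
  · have h1 : xDeriv j (fun s => linForm (jac φ ψ (ψ.symm s)) m) t =
        ∑ l, C (dif (fun z => jac φ ψ z m l) (ψ.symm t) (frame ψ j (ψ.symm t))) * X l := by
      simp only [linForm]
      rw [xDeriv_sum j fun l _ => (diffSeriesAt_C (hJ m l)).mul (diffSeriesAt_const _)]
      refine Finset.sum_congr rfl fun l _ => ?_
      rw [xDeriv_mul j (diffSeriesAt_C (hJ m l)) (diffSeriesAt_const _), xDeriv_const, mul_zero,
        add_zero, xDeriv_C, dif_frame hψ hψt (hjac m l), ψ.right_inv ht]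
      rfl
    have h2 : ∀ l, dif (fun z => jac φ ψ z m l) (ψ.symm t) (frame ψ j (ψ.symm t)) =
        ∑ k, jac φ ψ (ψ.symm t) m k * christoffel cov ψ k j l (ψ.symm t) -
        ∑ i, ∑ p, jac φ ψ (ψ.symm t) i j * jac φ ψ (ψ.symm t) p l *
          christoffel cov φ m i p (ψ.symm t) := fun l => by
      rw [sum_jac_mul_christoffel cov hφ hψ ht' hψt]
      ring
    simp only [connForm, φ.left_inv ht', linSubst_sub, linSubst_sum, linSubst_mul, linSubst_C,
      linSubst_X, mul_sub, Finset.sum_sub_distrib]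
    rw [sum_jac_mul_comp A hφ hψ ht' hψt, h1]
    simp only [h2, map_sub, sub_mul, Finset.sum_sub_distrib]
    have e1 : ∑ l, C (∑ k, jac φ ψ (ψ.symm t) m k * christoffel cov ψ k j l (ψ.symm t)) * X l =
        ∑ k, C (jac φ ψ (ψ.symm t) m k) *
          ∑ l, C (christoffel cov ψ k j l (ψ.symm t)) * (X l : Series d) := by
      simp only [map_sum, map_mul, Finset.sum_mul, Finset.mul_sum]
      rw [Finset.sum_comm]
      simp only [mul_assoc]
    have e2 : ∑ l, C (∑ i, ∑ p, jac φ ψ (ψ.symm t) i j * jac φ ψ (ψ.symm t) p l *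
          christoffel cov φ m i p (ψ.symm t)) * (X l : Series d) =
        ∑ i, C (jac φ ψ (ψ.symm t) i j) * ∑ p, C (christoffel cov φ m i p (ψ.symm t)) *
          linForm (jac φ ψ (ψ.symm t)) p := by
      simp only [map_sum, map_mul, Finset.sum_mul, Finset.mul_sum, linForm]
      rw [Finset.sum_comm]
      refine Finset.sum_congr rfl fun i _ => ?_
      rw [Finset.sum_comm]
      refine Finset.sum_congr rfl fun p _ => Finset.sum_congr rfl fun l _ => ?_
      ring
    have e3 : ∑ k, C (jac φ ψ (ψ.symm t) m k) * C (if j = k then 1 else 0) =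
        ∑ i, C (jac φ ψ (ψ.symm t) i j) * (C (if i = m then 1 else 0) : Series d) := by
      simp [apply_ite C]
    rw [e1, e2, e3]
    ring

end Differential

/-! ### Flat lifts of functions -/

section RadiallyFlat

variable {d : ℕ} {U : Set (EuclideanSpace ℝ (Fin d))}
  {W : Fin d → Fin d → EuclideanSpace ℝ (Fin d) → Series d}
  {u v : EuclideanSpace ℝ (Fin d) → Series d}

theorem IsRadiallyFlat.congr (hU : IsOpen U) (hu : IsRadiallyFlat W U u)
    (h : ∀ t ∈ U, v t = u t) : IsRadiallyFlat W U v := by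
  intro t ht
  have hev : v =ᶠ[nhds t] u := by
    filter_upwards [hU.mem_nhds ht] with s hs using h s hs
  simp only [fibreConn_congr _ hev, h t ht]
  exact hu t ht

theorem IsRadiallyFlat.add (hu : IsRadiallyFlat W U u) (hv : IsRadiallyFlat W U v)
    (hu' : ∀ t ∈ U, DiffSeriesAt u t) (hv' : ∀ t ∈ U, DiffSeriesAt v t) :
    IsRadiallyFlat W U (fun t => u t + v t) := by
  intro t ht
  have h1 := hu t ht
  have h2 := hv t ht
  simp only [mul_sub, Finset.sum_sub_distrib] at h1 h2
  simp only [fibreConn_add _ (hu' t ht) (hv' t ht), map_add, mul_sub, mul_add,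
    Finset.sum_sub_distrib, Finset.sum_add_distrib]
  linear_combination h1 + h2

theorem IsRadiallyFlat.mul (hu : IsRadiallyFlat W U u) (hv : IsRadiallyFlat W U v)
    (hu' : ∀ t ∈ U, DiffSeriesAt u t) (hv' : ∀ t ∈ U, DiffSeriesAt v t) :
    IsRadiallyFlat W U (fun t => u t * v t) := by
  intro t ht
  have h : ∀ i, X i * (fibreConn W i (fun t => u t * v t) t - pderiv ℝ i (u t * v t)) =
      v t * (X i * (fibreConn W i u t - pderiv ℝ i (u t))) +
      u t * (X i * (fibreConn W i v t - pderiv ℝ i (v t))) := fun i => by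
    simp only [fibreConn_mul _ (hu' t ht) (hv' t ht), Derivation.leibniz, smul_eq_mul]
    ring
  simp only [h, Finset.sum_add_distrib, ← Finset.mul_sum, hu t ht, hv t ht, mul_zero, add_zero]

theorem isRadiallyFlat_C (r : ℝ) : IsRadiallyFlat W U (fun _ => C r) := by
  intro t _
  have h : ∀ k, pderiv ℝ k (C r : Series d) = 0 := fun k => (pderiv ℝ k).map_algebraMap r
  simp [fibreConn, xDeriv_const, h]

end RadiallyFlat

section Lift

variable {d : ℕ} {M : Type*} [TopologicalSpace M] [ChartedSpace (EuclideanSpace ℝ (Fin d)) M]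
  {φ ψ : OpenPartialHomeomorph M (EuclideanSpace ℝ (Fin d))} {x : M}

theorem smoothSeriesOn_localExpr (hφ : φ ∈ charts d M) (s : SymSection d M) :
    SmoothSeriesOn φ.target (localExpr φ s) :=
  fun m => contDiffOn_comp_symm hφ (s.2 φ hφ m)

theorem localExpr_apply (hx : x ∈ φ.source) (s : SymSection d M) :
    localExpr φ s (φ x) = inChart φ x (s.1 x) := by
  rw [localExpr, φ.left_inv hx]

theorem contDiffOn_smooth_comp_symm (hφ : φ ∈ charts d M) (a : Smooth d M) :
    ContDiffOn ℝ ∞ (a ∘ φ.symm) φ.target :=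
  contDiffOn_comp_symm hφ a.contMDiff.contMDiffOn

variable [IsManifold (𝓡 d) ∞ M]
  {cov : CovariantDerivative (𝓡 d) (EuclideanSpace ℝ (Fin d))
    (TangentSpace (𝓡 d) : M → Type _)} {A : FibreVectorOneForm d M}

theorem IsFlat.isRadiallyFlat {s : SymSection d M} (hs : IsFlat cov A s) (hφ : φ ∈ charts d M) :
    IsRadiallyFlat (connForm cov A φ) φ.target (localExpr φ s) :=
  fun t ht => Finset.sum_eq_zero fun i _ => by rw [← Dcomp_eq, hs φ hφ t ht i, mul_zero]

/-- Flat sections are determined by their symbols. -/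
theorem IsFlat.eq_of_symbolMap {s s' : SymSection d M} (hs : IsFlat cov A s)
    (hs' : IsFlat cov A s') (h : ∀ x, symbolMap s x = symbolMap s' x) : s = s' := by
  refine Subtype.ext (funext fun x => ?_)
  have hφ := chartAt_mem_charts (d := d) x
  have hx := mem_chart_source (EuclideanSpace ℝ (Fin d)) x
  have h2 := (hs.isRadiallyFlat hφ).eq (OpenPartialHomeomorph.open_target _)
    constantCoeff_connForm (hs'.isRadiallyFlat hφ)
    (fun t _ => by simp only [localExpr, constantCoeff_inChart]; exact h _) _ (OpenPartialHomeomorph.map_source _ hx)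
  rw [localExpr_apply hx, localExpr_apply hx] at h2
  exact inChart_injective hφ hx h2

variable (cov A) in
/-- The solution of the radial part of `D u = 0` in a chart with `u|_{y = 0} = a`. -/
def chartLift (φ : OpenPartialHomeomorph M (EuclideanSpace ℝ (Fin d))) (a : Smooth d M) :
    EuclideanSpace ℝ (Fin d) → Series d :=
  flatLift (connForm cov A φ) (a ∘ φ.symm)

theorem isRadiallyFlat_chartLift (U : Set (EuclideanSpace ℝ (Fin d))) (a : Smooth d M) :
    IsRadiallyFlat (connForm cov A φ) U (chartLift cov A φ a) :=
  isRadiallyFlat_flatLift constantCoeff_connForm _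

theorem constantCoeff_chartLift (a : Smooth d M) (t : EuclideanSpace ℝ (Fin d)) :
    constantCoeff (chartLift cov A φ a t) = a (φ.symm t) :=
  constantCoeff_flatLift _ _

theorem chartLift_eq {a : Smooth d M} {v : EuclideanSpace ℝ (Fin d) → Series d}
    (hv : IsRadiallyFlat (connForm cov A φ) φ.target v)
    (h : ∀ t ∈ φ.target, constantCoeff (v t) = a (φ.symm t)) :
    ∀ t ∈ φ.target, chartLift cov A φ a t = v t :=
  (isRadiallyFlat_chartLift _ a).eq φ.open_target constantCoeff_connForm hv fun t ht => by
    rw [constantCoeff_chartLift, h t ht]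

variable [T2Space M]

theorem smoothSeriesOn_chartLift (hcov : cov.ContMDiffCovariantDerivative ∞)
    (hφ : φ ∈ charts d M) (a : Smooth d M) :
    SmoothSeriesOn φ.target (chartLift cov A φ a) :=
  smoothSeriesOn_flatLift φ.open_target (smoothSeriesOn_connForm hcov hφ)
    (contDiffOn_smooth_comp_symm hφ a)

/-- The local solutions of the radial equation agree on overlaps, because both are solutions of the
same equation with the same value at `y = 0`. -/
theorem chartLift_change (hcov : cov.ContMDiffCovariantDerivative ∞)
    (hφ : φ ∈ charts d M) (hψ : ψ ∈ charts d M) (hx : x ∈ φ.source) (hx' : x ∈ ψ.source)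
    (a : Smooth d M) : chartLift cov A ψ a (ψ x) =
      linSubst (jac φ ψ x) (chartLift cov A φ a (φ x)) := by
  have hU : IsOpen (ψ.target ∩ ψ.symm ⁻¹' φ.source) := ψ.isOpen_inter_preimage_symm φ.open_source
  have hflat : IsRadiallyFlat (connForm cov A ψ) (ψ.target ∩ ψ.symm ⁻¹' φ.source)
      (fun s => linSubst (jac φ ψ (ψ.symm s)) (chartLift cov A φ a (φ (ψ.symm s)))) := by
    rintro t ⟨ht, ht'⟩
    have hu : DiffSeriesAt (chartLift cov A φ a) (φ (ψ.symm t)) :=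
      (smoothSeriesOn_chartLift hcov hφ a).diffSeriesAt φ.open_target (φ.map_source ht')
    simp only [← Dcomp_eq, Dcomp_linSubst hφ hψ ht ht' hu]
    -- the radial one-form `∑ᵢ yⁱ Dᵢ` is invariant under linear changes of the fibre coordinates
    have h := isRadiallyFlat_chartLift (cov := cov) (A := A) (φ := φ) φ.target a _ (φ.map_source ht')
    have h2 := congrArg (linSubst (jac φ ψ (ψ.symm t))) h
    simp only [← Dcomp_eq, linSubst_sum, linSubst_mul, linSubst_X, linSubst_zero, linForm,
      Finset.sum_mul] at h2
    simp only [Finset.mul_sum]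
    rw [Finset.sum_comm, ← h2]
    refine Finset.sum_congr rfl fun i _ => Finset.sum_congr rfl fun j _ => ?_
    ring
  have h := (isRadiallyFlat_chartLift _ a).eq hU constantCoeff_connForm hflat
    (fun t ht => by
      rw [constantCoeff_linSubst, constantCoeff_chartLift, constantCoeff_chartLift,
        φ.left_inv ht.2]) (ψ x) ⟨ψ.map_source hx', by simpa [ψ.left_inv hx'] using hx⟩
  simpa only [ψ.left_inv hx'] using h

variable (cov A) in
/-- The local lifts, glued. -/
def liftFun (a : Smooth d M) (x : M) : Series d :=
  outChart (chartAt (EuclideanSpace ℝ (Fin d)) x) x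
    (chartLift cov A (chartAt (EuclideanSpace ℝ (Fin d)) x) a
      (chartAt (EuclideanSpace ℝ (Fin d)) x x))

theorem inChart_liftFun (hcov : cov.ContMDiffCovariantDerivative ∞) (hφ : φ ∈ charts d M)
    (hx : x ∈ φ.source) (a : Smooth d M) :
    inChart φ x (liftFun cov A a x) = chartLift cov A φ a (φ x) := by
  have h := mem_chart_source (EuclideanSpace ℝ (Fin d)) x
  rw [inChart_eq_linSubst_jac (chartAt_mem_charts x) h, liftFun,
    inChart_outChart (chartAt_mem_charts x) h,
    chartLift_change hcov (chartAt_mem_charts x) hφ h hx]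

/-- The section `τ(a)`. -/
def lift (hcov : cov.ContMDiffCovariantDerivative ∞) (A : FibreVectorOneForm d M)
    (a : Smooth d M) : SymSection d M :=
  ⟨liftFun cov A a, fun φ hφ m =>
    (contMDiffOn_comp_chart hφ (smoothSeriesOn_chartLift (A := A) hcov hφ a m)).congr
      fun x hx => by rw [inChart_liftFun hcov hφ hx]; rfl⟩

theorem inChart_lift (hcov : cov.ContMDiffCovariantDerivative ∞) (hφ : φ ∈ charts d M)
    (hx : x ∈ φ.source) (a : Smooth d M) :
    inChart φ x ((lift hcov A a).1 x) = chartLift cov A φ a (φ x) :=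
  inChart_liftFun hcov hφ hx a

theorem localExpr_lift (hcov : cov.ContMDiffCovariantDerivative ∞) (hφ : φ ∈ charts d M)
    {t : EuclideanSpace ℝ (Fin d)} (ht : t ∈ φ.target) (a : Smooth d M) :
    localExpr φ (lift hcov A a) t = chartLift cov A φ a t := by
  rw [localExpr, inChart_lift hcov hφ (φ.map_target ht), φ.right_inv ht]

theorem symbolMap_lift (hcov : cov.ContMDiffCovariantDerivative ∞) (a : Smooth d M) (x : M) :
    symbolMap (lift hcov A a) x = a x := by
  have h := mem_chart_source (EuclideanSpace ℝ (Fin d)) x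
  rw [symbolMap, ← constantCoeff_inChart (φ := chartAt (EuclideanSpace ℝ (Fin d)) x) (x := x),
    inChart_lift hcov (chartAt_mem_charts x) h, constantCoeff_chartLift,
    OpenPartialHomeomorph.left_inv _ h]

theorem isFlat_lift (hcov : cov.ContMDiffCovariantDerivative ∞) (hD : IsFedosov cov A)
    (a : Smooth d M) : IsFlat cov A (lift hcov A a) := fun φ hφ =>
  IsRadiallyFlat.flat (D := fun i u t => Dcomp cov A φ i u t) φ.open_target
    constantCoeff_connForm Dcomp_eq
    ((isRadiallyFlat_chartLift _ a).congr φ.open_target fun _ ht => localExpr_lift hcov hφ ht a)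
    (hD _ φ hφ)

theorem isFlat_iff_eq_lift (hcov : cov.ContMDiffCovariantDerivative ∞) (hD : IsFedosov cov A)
    (a : Smooth d M) (s : SymSection d M) :
    (IsFlat cov A s ∧ ∀ x, symbolMap s x = a x) ↔ s = lift hcov A a := by
  refine ⟨fun h => h.1.eq_of_symbolMap (isFlat_lift hcov hD a) fun x => ?_, ?_⟩
  · rw [h.2, symbolMap_lift]
  · rintro rfl
    exact ⟨isFlat_lift hcov hD a, symbolMap_lift hcov a⟩

end Lift

/-! ### Jets of flat sections -/

section Jets

variable {d : ℕ}

theorem le_order_succ_of_pderiv {n : ℕ} {f : Series d} (h0 : constantCoeff f = 0)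
    (h : ∀ j, (n : ℕ∞) ≤ order (pderiv ℝ j f)) : ((n + 1 : ℕ) : ℕ∞) ≤ order f := by
  refine nat_le_order fun m hm => ?_
  have h1 : ((n + 1 : ℕ) : ℕ∞) ≤ order (∑ i, X i * pderiv ℝ i f) :=
    le_order_sum _ fun i _ => le_order_X_mul i (h i)
  have h2 := coeff_of_lt_order (d := m) (lt_of_lt_of_le (by exact_mod_cast hm) h1)
  rw [coeff_euler, mul_eq_zero, Nat.cast_eq_zero] at h2
  rcases h2 with h2 | h2
  · rw [Finsupp.degree_eq_zero_iff] at h2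
    rw [h2]
    exact h0
  · exact h2

theorem coe_eq_sum (p : MvPolynomial (Fin d) ℝ) :
    (p : Series d) = ∑ m ∈ p.support, C (p.coeff m) * ∏ i, X i ^ m i := by
  conv_lhs => rw [← MvPolynomial.eval₂_eta p, ← MvPolynomial.coeToMvPowerSeries.ringHom_apply,
    MvPolynomial.eval₂_comp_left, MvPolynomial.eval₂_eq']
  simp

/-- If `g = X + O(y²)` then `g^m = X^m + O(y^{|m|+1})`. -/
theorem le_order_prod_pow_sub {g : Fin d → Series d}
    (hg : ∀ k, ((2 : ℕ) : ℕ∞) ≤ order (g k - X k)) (m : Fin d →₀ ℕ) :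
    ((m.degree + 1 : ℕ) : ℕ∞) ≤ order (∏ i, g i ^ m i - ∏ i, (X i : Series d) ^ m i) := by
  classical
  -- pairs of series with the same leading term in a given degree are closed under products
  have hmul : ∀ (a b : ℕ) (f f' h h' : Series d),
      ((a : ℕ∞) ≤ order f ∧ (a : ℕ∞) ≤ order h ∧ ((a + 1 : ℕ) : ℕ∞) ≤ order (f - h)) →
      ((b : ℕ∞) ≤ order f' ∧ (b : ℕ∞) ≤ order h' ∧ ((b + 1 : ℕ) : ℕ∞) ≤ order (f' - h')) →
      (((a + b : ℕ) : ℕ∞) ≤ order (f * f') ∧ ((a + b : ℕ) : ℕ∞) ≤ order (h * h') ∧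
        ((a + b + 1 : ℕ) : ℕ∞) ≤ order (f * f' - h * h')) := by
    rintro a b f f' h h' ⟨h1, h2, h3⟩ ⟨h4, h5, h6⟩
    refine ⟨le_order_mul_of_le h1 h4, le_order_mul_of_le h2 h5, ?_⟩
    rw [show f * f' - h * h' = (f - h) * f' + h * (f' - h') by ring]
    refine le_order_add ?_ ?_
    · rw [add_right_comm]
      exact le_order_mul_of_le h3 h4
    · rw [add_assoc]
      exact le_order_mul_of_le h2 h6
  have hpow : ∀ i (n : ℕ), (n : ℕ∞) ≤ order (g i ^ n) ∧ (n : ℕ∞) ≤ order ((X i : Series d) ^ n) ∧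
      ((n + 1 : ℕ) : ℕ∞) ≤ order (g i ^ n - X i ^ n) := by
    intro i n
    induction n with
    | zero => simp
    | succ n ih =>
      rw [pow_succ, pow_succ]
      have hX : ((1 : ℕ) : ℕ∞) ≤ order (X i : Series d) := one_le_order (by simp)
      refine hmul n 1 _ _ _ _ ih ⟨?_, hX, hg i⟩
      rw [← sub_add_cancel (g i) (X i)]
      exact le_order_add ((by norm_num : ((1 : ℕ) : ℕ∞) ≤ (2 : ℕ)).trans (hg i)) hX
  have hprod : ∀ s : Finset (Fin d), ((∑ i ∈ s, m i : ℕ) : ℕ∞) ≤ order (∏ i ∈ s, g i ^ m i) ∧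
      ((∑ i ∈ s, m i : ℕ) : ℕ∞) ≤ order (∏ i ∈ s, (X i : Series d) ^ m i) ∧
      ((∑ i ∈ s, m i + 1 : ℕ) : ℕ∞) ≤
        order (∏ i ∈ s, g i ^ m i - ∏ i ∈ s, (X i : Series d) ^ m i) := by
    intro s
    induction s using Finset.induction_on with
    | empty => simp
    | insert i s hi ih =>
      simp only [Finset.sum_insert hi, Finset.prod_insert hi]
      exact hmul _ _ _ _ _ _ (hpow i (m i)) ih
  rw [Finsupp.degree_eq_sum]
  exact (hprod Finset.univ).2.2

/-- An algebra homomorphism to power series that hits the variables up to terms of degree two hits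
every power series up to terms of arbitrarily high degree. -/
theorem exists_le_order_sub {B : Type*} [CommRing B] [Algebra ℝ B] (T : B →ₐ[ℝ] Series d)
    (hT : ∀ k, ∃ z, ((2 : ℕ) : ℕ∞) ≤ order (T z - X k)) (N : ℕ) (f : Series d) :
    ∃ b, (N : ℕ∞) ≤ order (T b - f) := by
  choose z hz using hT
  have haeval : ∀ (n : ℕ) (p : MvPolynomial (Fin d) ℝ), (n : ℕ∞) ≤ order (p : Series d) →
      ((n + 1 : ℕ) : ℕ∞) ≤ order (T (MvPolynomial.aeval z p) - (p : Series d)) := by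
    intro n p hp
    rw [MvPolynomial.aeval_def, MvPolynomial.eval₂_eq', map_sum, coe_eq_sum,
      ← Finset.sum_sub_distrib]
    refine le_order_sum _ fun m hm => ?_
    simp only [map_mul, map_prod, map_pow, AlgHom.commutes]
    have hC : algebraMap ℝ (Series d) (p.coeff m) = C (p.coeff m) := rfl
    rw [hC, ← mul_sub]
    have hnm : n ≤ m.degree := by
      by_contra hlt
      rw [MvPolynomial.mem_support_iff, ← MvPolynomial.coeff_coe] at hm
      exact hm (coeff_of_lt_order (lt_of_lt_of_le (by exact_mod_cast not_le.1 hlt) hp))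
    exact le_order_mul_left _ (le_trans (by exact_mod_cast Nat.succ_le_succ hnm)
      (le_order_prod_pow_sub hz m))
  induction N with
  | zero => exact ⟨0, by simp⟩
  | succ N ih =>
    obtain ⟨b, hb⟩ := ih
    have hp := le_order_sub_truncTotal (N + 1) (f - T b)
    -- the error `f - T b` has order `N`, so substituting `z` for `X` in its part of degree `N`
    -- changes it only in degrees greater than `N`
    set p := truncTotal (N + 1) (f - T b)
    refine ⟨b + MvPolynomial.aeval z p, ?_⟩
    have hpN : (N : ℕ∞) ≤ order (p : Series d) := by
      rw [← neg_sub, order_neg] at hb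
      rw [← sub_sub_cancel (f - T b) (p : Series d)]
      exact le_order_sub hb (le_trans (by exact_mod_cast N.le_succ) hp)
    rw [map_add, show T b + T (MvPolynomial.aeval z p) - f =
      (T (MvPolynomial.aeval z p) - (p : Series d)) - (f - T b - (p : Series d)) by ring]
    exact le_order_sub (haeval N p hpN) hp

end Jets

section LiftJets

variable {d : ℕ} {M : Type*} [TopologicalSpace M] [ChartedSpace (EuclideanSpace ℝ (Fin d)) M]
  {φ ψ : OpenPartialHomeomorph M (EuclideanSpace ℝ (Fin d))} {x : M}
  [IsManifold (𝓡 d) ∞ M]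
  {cov : CovariantDerivative (𝓡 d) (EuclideanSpace ℝ (Fin d))
    (TangentSpace (𝓡 d) : M → Type _)} {A : FibreVectorOneForm d M}

/-- Flatness of a section in a chart, without the part `∂/∂yⁱ` of the connection. -/
theorem IsFlat.fibreConn_eq {s : SymSection d M} (hs : IsFlat cov A s) (hφ : φ ∈ charts d M)
    {t : EuclideanSpace ℝ (Fin d)} (ht : t ∈ φ.target) (i : Fin d) :
    fibreConn (connForm cov A φ) i (localExpr φ s) t = pderiv ℝ i (localExpr φ s t) := by
  rw [← sub_eq_zero, ← Dcomp_eq]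
  exact hs φ hφ t ht i

/-- The degree one part of a flat section is the differential of its symbol. -/
theorem IsFlat.constantCoeff_pderiv {s : SymSection d M} (hs : IsFlat cov A s)
    (hφ : φ ∈ charts d M) (hx : x ∈ φ.source) (j : Fin d) :
    constantCoeff (pderiv ℝ j (inChart φ x (s.1 x))) =
      fderiv ℝ (symbolMap s ∘ φ.symm) (φ x) (stdVec j) := by
  rw [← localExpr_apply hx, ← hs.fibreConn_eq hφ (φ.map_source hx), fibreConn, map_add, map_sum]
  simp only [map_mul, constantCoeff_connForm, zero_mul, Finset.sum_const_zero, add_zero]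
  rw [← coeff_zero_eq_constantCoeff_apply, coeff_xDeriv]
  congr 2
  funext t
  rw [coeff_zero_eq_constantCoeff_apply, localExpr, constantCoeff_inChart]
  rfl

variable [T2Space M]

/-- The Taylor expansion at `x` of a function along flat sections, an algebra homomorphism. -/
def liftJet (hcov : cov.ContMDiffCovariantDerivative ∞) (A : FibreVectorOneForm d M)
    (hφ : φ ∈ charts d M) (hx : x ∈ φ.source) : Smooth d M →ₐ[ℝ] Series d where
  toFun a := chartLift cov A φ a (φ x)
  map_one' := chartLift_eq (isRadiallyFlat_C 1) (fun t _ => by simp) _ (φ.map_source hx)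
  map_zero' := chartLift_eq (v := fun _ => 0) (by simpa using isRadiallyFlat_C 0)
    (fun t _ => by simp) _
    (φ.map_source hx)
  map_mul' a b := chartLift_eq (v := fun t => chartLift cov A φ a t * chartLift cov A φ b t)
    ((isRadiallyFlat_chartLift _ a).mul (isRadiallyFlat_chartLift _ b)
      (fun _ ht => (smoothSeriesOn_chartLift hcov hφ a).diffSeriesAt φ.open_target ht)
      (fun _ ht => (smoothSeriesOn_chartLift hcov hφ b).diffSeriesAt φ.open_target ht))
    (fun t _ => by simp [constantCoeff_chartLift]) _ (φ.map_source hx)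
  map_add' a b := chartLift_eq (v := fun t => chartLift cov A φ a t + chartLift cov A φ b t)
    ((isRadiallyFlat_chartLift _ a).add (isRadiallyFlat_chartLift _ b)
      (fun _ ht => (smoothSeriesOn_chartLift hcov hφ a).diffSeriesAt φ.open_target ht)
      (fun _ ht => (smoothSeriesOn_chartLift hcov hφ b).diffSeriesAt φ.open_target ht))
    (fun t _ => by simp [constantCoeff_chartLift]) _ (φ.map_source hx)
  commutes' r := chartLift_eq (v := fun _ => C r) (isRadiallyFlat_C r)
    (fun t _ => (constantCoeff_C r).trans rfl) _ (φ.map_source hx)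

theorem liftJet_apply (hcov : cov.ContMDiffCovariantDerivative ∞) (hφ : φ ∈ charts d M)
    (hx : x ∈ φ.source) (a : Smooth d M) :
    liftJet hcov A hφ hx a = inChart φ x ((lift hcov A a).1 x) :=
  (inChart_lift hcov hφ hx a).symm

/-- A globally smooth function with value `0` and differential `dxᵏ` at a given point. -/
theorem exists_smooth_coord (hφ : φ ∈ charts d M) (hx : x ∈ φ.source) (k : Fin d) :
    ∃ z : Smooth d M, z x = 0 ∧
      ∀ j, fderiv ℝ (z ∘ φ.symm) (φ x) (stdVec j) = if k = j then 1 else 0 := by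
  obtain ⟨f, -, hf⟩ := (SmoothBumpFunction.nhds_basis_tsupport (I := 𝓡 d) x).mem_iff.1
    (φ.open_source.mem_nhds hx)
  have hsm : ContMDiff (𝓡 d) 𝓘(ℝ, ℝ) ∞ (fun y => f y * (φ y k - φ x k)) := by
    refine contMDiff_of_tsupport fun y hy => ?_
    have hy' : y ∈ φ.source := hf (tsupport_mul_subset_left hy)
    have h1 : ContMDiffAt (𝓡 d) 𝓘(ℝ, ℝ) ∞ (fun y => φ y k) y :=
      ContMDiffAt.comp y (g := fun v : EuclideanSpace ℝ (Fin d) => v k)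
        (EuclideanSpace.proj k : EuclideanSpace ℝ (Fin d) →L[ℝ] ℝ).contDiff.contMDiff.contMDiffAt
        (contMDiffAt_of_mem_charts hφ hy')
    exact f.contMDiffAt.mul (h1.sub contMDiffAt_const)
  refine ⟨⟨_, hsm⟩, ?_, fun j => ?_⟩
  · change f x * (φ x k - φ x k) = 0
    rw [sub_self, mul_zero]
  have hev : (fun y => f y * (φ y k - φ x k)) ∘ φ.symm =ᶠ[nhds (φ x)] fun t => t k - φ x k := by
    have h1 : Filter.Tendsto φ.symm (nhds (φ x)) (nhds x) := by
      simpa [φ.left_inv hx] using (φ.continuousAt_symm (φ.map_source hx)).tendsto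
    filter_upwards [h1.eventually f.eventuallyEq_one,
      φ.open_target.mem_nhds (φ.map_source hx)] with t ht ht'
    rw [Function.comp_apply, ht, φ.right_inv ht', Pi.one_apply, one_mul]
  have hfd : fderiv ℝ (fun t : EuclideanSpace ℝ (Fin d) => t k - φ x k) (φ x) =
      (EuclideanSpace.proj k : EuclideanSpace ℝ (Fin d) →L[ℝ] ℝ) := by
    rw [fderiv_sub_const]
    exact (EuclideanSpace.proj k : EuclideanSpace ℝ (Fin d) →L[ℝ] ℝ).fderiv
  refine (congrArg (fun L => L (stdVec j)) (hev.fderiv_eq.trans hfd)).trans ?_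
  simp [stdVec]

/-- Flat sections have arbitrary jets at any point. -/
theorem exists_lift_jet (hcov : cov.ContMDiffCovariantDerivative ∞) (hD : IsFedosov cov A)
    (hφ : φ ∈ charts d M) (hx : x ∈ φ.source) (N : ℕ) (f : Series d) :
    ∃ a, (N : ℕ∞) ≤ order (inChart φ x ((lift hcov A a).1 x) - f) := by
  classical
  simp only [← liftJet_apply hcov hφ hx]
  refine exists_le_order_sub _ (fun k => ?_) N f
  obtain ⟨z, hz, hz'⟩ := exists_smooth_coord hφ hx k
  have hsym : symbolMap (lift hcov A z) = z := funext (symbolMap_lift hcov z)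
  refine ⟨z, le_order_succ_of_pderiv ?_ fun j => one_le_order ?_⟩
  · rw [liftJet_apply, map_sub, constantCoeff_X, sub_zero, constantCoeff_inChart]
    exact (symbolMap_lift hcov z x).trans hz
  · rw [liftJet_apply, map_sub, map_sub, (isFlat_lift hcov hD z).constantCoeff_pderiv hφ hx, hsym,
      hz', pderiv_X]
    by_cases h : k = j
    · subst h
      simp
    · simp [h]

/-- `τ` as a linear map. -/
def liftLinear (hcov : cov.ContMDiffCovariantDerivative ∞) (A : FibreVectorOneForm d M) :
    Smooth d M →ₗ[ℝ] SymSection d M where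
  toFun := lift hcov A
  map_add' a b := Subtype.ext <| funext fun x => by
    have hφ := chartAt_mem_charts (d := d) x
    have hx := mem_chart_source (EuclideanSpace ℝ (Fin d)) x
    refine inChart_injective hφ hx ?_
    rw [← liftJet_apply hcov hφ hx, map_add, liftJet_apply, liftJet_apply, ← inChart_add]
    rfl
  map_smul' r a := Subtype.ext <| funext fun x => by
    have hφ := chartAt_mem_charts (d := d) x
    have hx := mem_chart_source (EuclideanSpace ℝ (Fin d)) x
    refine inChart_injective hφ hx ?_
    rw [← liftJet_apply hcov hφ hx, map_smul, liftJet_apply, ← inChart_smul]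
    rfl

end LiftJets

/-! ### Polydifferential operators with constant coefficients on power series -/

section PolyOp

variable {d n : ℕ}

/-- `∂/∂y^α` as a linear map. -/
def yPartialLinear (α : List (Fin d)) : Series d →ₗ[ℝ] Series d where
  toFun := yPartial α
  map_add' := yPartial_add α
  map_smul' r f := by
    induction α with
    | nil => rfl
    | cons j α ih => simp only [yPartial_cons, ih, Derivation.map_smul, RingHom.id_apply]

/-- The operator `∑_{α ∈ S} c_α ∂/∂y^{α₁} ⊗ ⋯ ⊗ ∂/∂y^{αₙ}` with constant coefficients. -/
def polyOp (S : Finset (Fin n → List (Fin d))) (c : (Fin n → List (Fin d)) → ℝ) :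
    MultilinearMap ℝ (fun _ : Fin n => Series d) (Series d) :=
  ∑ α ∈ S, c α • (MultilinearMap.mkPiAlgebra ℝ (Fin n) (Series d)).compLinearMap
    fun i => yPartialLinear (α i)

variable {S S' : Finset (Fin n → List (Fin d))} {c c' : (Fin n → List (Fin d)) → ℝ}

theorem polyOp_apply (f : Fin n → Series d) :
    polyOp S c f = ∑ α ∈ S, c α • ∏ i, yPartial (α i) (f i) := by
  simp only [polyOp, _root_.sum_apply, _root_.smul_apply]
  rfl

theorem constantCoeff_polyOp (f : Fin n → Series d) :
    constantCoeff (polyOp S c f) = ∑ α ∈ S, c α * ∏ i, constantCoeff (yPartial (α i) (f i)) := by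
  simp only [polyOp_apply, map_sum, smul_eq_C_mul, map_mul, constantCoeff_C, map_prod]

/-- A strict bound for the lengths of the multi-indices in `S`. -/
def lengthBound (S : Finset (Fin n → List (Fin d))) : ℕ :=
  S.sup (fun α => Finset.univ.sup fun i => (α i).length) + 1

theorem length_lt_lengthBound {α : Fin n → List (Fin d)} (hα : α ∈ S) (i : Fin n) :
    (α i).length < lengthBound S :=
  Nat.lt_succ_of_le ((Finset.le_sup (f := fun i => (α i).length) (Finset.mem_univ i)).trans
    (Finset.le_sup (f := fun α : Fin n → List (Fin d) => Finset.univ.sup fun i => (α i).length) hα))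

/-- The constant term of `polyOp S c f` depends only on finitely many coefficients of `f`. -/
theorem exists_constantCoeff_polyOp_eq (S : Finset (Fin n → List (Fin d)))
    (c : (Fin n → List (Fin d)) → ℝ) : ∃ N : ℕ, ∀ f g : Fin n → Series d,
      (∀ i, (N : ℕ∞) ≤ order (f i - g i)) →
        constantCoeff (polyOp S c f) = constantCoeff (polyOp S c g) := by
  refine ⟨lengthBound S, fun f g h => ?_⟩
  rw [constantCoeff_polyOp, constantCoeff_polyOp]
  refine Finset.sum_congr rfl fun α hα => congrArg _ (Finset.prod_congr rfl fun i _ => ?_)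
  have hlt := length_lt_lengthBound hα i
  have h1 : ((1 : ℕ) : ℕ∞) ≤ order (yPartial (α i) (f i - g i)) :=
    le_order_yPartial _ (le_trans (by exact_mod_cast (by omega)) (h i))
  rw [yPartial_sub] at h1
  simpa using coeff_eq_of_le_order_sub h1 (m := 0) (by simp)

theorem pderiv_prod {ι : Type*} [DecidableEq ι] (j : Fin d) (s : Finset ι) (g : ι → Series d) :
    pderiv ℝ j (∏ i ∈ s, g i) =
      ∑ i ∈ s, ∏ k ∈ s, if k = i then pderiv ℝ j (g k) else g k := by
  induction s using Finset.induction_on with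
  | empty => simp
  | insert a s ha ih =>
    have h1 : ∀ k ∈ s, k ≠ a := fun k hk h => ha (h ▸ hk)
    rw [Finset.prod_insert ha, Derivation.leibniz, Finset.sum_insert ha, Finset.prod_insert ha,
      if_pos rfl, ih, Finset.prod_congr rfl fun k hk => if_neg (h1 k hk), smul_eq_mul, smul_eq_mul,
      add_comm, mul_comm, Finset.mul_sum]
    congr 1
    refine Finset.sum_congr rfl fun i hi => ?_
    rw [Finset.prod_insert ha, if_neg (h1 i hi).symm]

/-- Operators with constant coefficients commute with derivatives. -/
theorem pderiv_polyOp (j : Fin d) (f : Fin n → Series d) :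
    pderiv ℝ j (polyOp S c f) =
      ∑ i, polyOp S c (Function.update f i (pderiv ℝ j (f i))) := by
  simp only [polyOp_apply, map_sum]
  rw [Finset.sum_comm]
  refine Finset.sum_congr rfl fun α _ => ?_
  rw [Derivation.map_smul, pderiv_prod, Finset.smul_sum]
  refine Finset.sum_congr rfl fun i _ => congrArg _ (Finset.prod_congr rfl fun k _ => ?_)
  by_cases h : k = i
  · subst h
    simp [yPartial_pderiv]
  · simp [h]

/-- An operator on power series that commutes with derivatives, up to a linear change of the
derivatives, is determined by the constant terms of its values. -/
theorem eq_zero_of_constantCoeff_eq_zero {E : (Fin n → Series d) → Series d}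
    {r : Fin d → Fin d → ℝ} (hE : ∀ j g, pderiv ℝ j (E g) =
      ∑ m, ∑ i, C (r m j) * E (Function.update g i (pderiv ℝ m (g i))))
    (h0 : ∀ g, constantCoeff (E g) = 0) (g : Fin n → Series d) : E g = 0 := by
  refine eq_zero_of_forall_yPartial fun β => ?_
  induction β generalizing g with
  | nil => exact h0 g
  | cons j β ih =>
    rw [yPartial_cons, ← yPartial_pderiv, hE, yPartial_sum, map_sum]
    refine Finset.sum_eq_zero fun m _ => ?_
    rw [yPartial_sum, map_sum]
    refine Finset.sum_eq_zero fun i _ => ?_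
    have h := (yPartialLinear β).map_smul (r m j) (E (Function.update g i (pderiv ℝ m (g i))))
    rw [← smul_eq_C_mul]
    refine (congrArg constantCoeff h).trans ?_
    rw [smul_eq_C_mul, map_mul]
    exact mul_eq_zero_of_right _ (ih _)

/-- Two operators with constant coefficients, in two linear coordinate systems, are equal as soon as
the constant terms of their values agree on sufficiently many power series. -/
theorem linSubst_polyOp_eq {X : Type*} {J : Fin d → Fin d → ℝ} {e : X → Series d}
    (he : ∀ (N : ℕ) f, ∃ a, (N : ℕ∞) ≤ order (e a - f))
    (h : ∀ a : Fin n → X, constantCoeff (polyOp S c fun i => e (a i)) =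
      constantCoeff (polyOp S' c' fun i => linSubst J (e (a i)))) (f : Fin n → Series d) :
    linSubst J (polyOp S c f) = polyOp S' c' fun i => linSubst J (f i) := by
  rw [← sub_eq_zero]
  refine eq_zero_of_constantCoeff_eq_zero (r := J)
    (E := fun f => linSubst J (polyOp S c f) - polyOp S' c' fun i => linSubst J (f i))
    (fun j g => ?_) (fun g => ?_) f
  · have hupd : ∀ i (v : Series d), (fun k => linSubst J (Function.update g i v k)) =
        Function.update (fun k => linSubst J (g k)) i (linSubst J v) := fun i v => by
      funext k
      exact Function.apply_update (fun _ => linSubst J) g i v k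
    rw [map_sub, pderiv_linSubst, pderiv_polyOp]
    simp only [pderiv_linSubst, pderiv_polyOp, hupd, mul_sub, Finset.sum_sub_distrib]
    congr 1
    · simp only [linSubst_sum, Finset.mul_sum]
    · rw [Finset.sum_comm]
      refine Finset.sum_congr rfl fun i _ => ?_
      rw [MultilinearMap.map_update_sum]
      simp only [← smul_eq_C_mul, MultilinearMap.map_update_smul]
  · obtain ⟨N, hN⟩ := exists_constantCoeff_polyOp_eq S c
    obtain ⟨N', hN'⟩ := exists_constantCoeff_polyOp_eq S' c'
    choose a ha using fun i => he (max N N') (g i)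
    have h1 := hN (fun i => e (a i)) g fun i =>
      le_trans (by exact_mod_cast le_max_left _ _) (ha i)
    have h2 := hN' (fun i => linSubst J (e (a i))) (fun i => linSubst J (g i)) fun i => by
      rw [← linSubst_sub]
      exact le_order_linSubst J (le_trans (by exact_mod_cast le_max_right _ _) (ha i))
    rw [map_sub, constantCoeff_linSubst, ← h1, ← h2, h a, sub_self]

end PolyOp

section SmoothComb

variable {d n : ℕ} {U : Set (EuclideanSpace ℝ (Fin d))} {ι X : Type*}
  {S : Fin n → Finset ι} {G : ι → X → EuclideanSpace ℝ (Fin d) → ℝ}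
  {F : Fin n → X → EuclideanSpace ℝ (Fin d) → ℝ}

theorem SmoothComb.prod (h : ∀ k, SmoothComb U (S k) G (F k)) :
    SmoothComb U (Fintype.piFinset S) (fun α (x : Fin n → X) t => ∏ k, G (α k) (x k) t)
      (fun x t => ∏ k, F k (x k) t) := by
  choose c hc hF using h
  refine ⟨fun α t => ∏ k, c k (α k) t, fun α => contDiffOn_prod fun k _ => hc k (α k),
    fun x t ht => ?_⟩
  simp only [fun k => hF k (x k) t ht, Finset.prod_univ_sum, Finset.prod_mul_distrib]

end SmoothComb

/-! ### The comparison of polydifferential operators -/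

section Operators

variable {d n : ℕ} {M : Type*} [TopologicalSpace M] [ChartedSpace (EuclideanSpace ℝ (Fin d)) M]
  {φ ψ : OpenPartialHomeomorph M (EuclideanSpace ℝ (Fin d))} {x : M}

/-- The local form of a polydifferential operator in terms of `SmoothComb`. -/
theorem mem_polyDiff_iff {Q : MultilinearMap ℝ (fun _ : Fin n => Smooth d M) (Smooth d M)} :
    Q ∈ PolyDiff d M n ↔ ∃ S : Finset (Fin n → List (Fin d)), ∀ φ ∈ charts d M,
      SmoothComb φ.target S (fun α a t => ∏ i, xPartial (α i) (a i ∘ φ.symm) t)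
        (fun a t => Q a (φ.symm t)) := by
  refine exists_congr fun S => forall₂_congr fun φ hφ => ⟨?_, ?_⟩
  · rintro ⟨c, hc, h⟩
    refine ⟨fun α => c α ∘ φ.symm, fun α => contDiffOn_comp_symm hφ (hc α), fun a t ht => ?_⟩
    refine (h a _ (φ.map_target ht)).trans ?_
    simp only [φ.right_inv ht, Function.comp_apply]
  · rintro ⟨c, hc, h⟩
    refine ⟨fun α => c α ∘ φ, fun α => contMDiffOn_comp_chart hφ (hc α), fun a x hx => ?_⟩
    have h1 := h a _ (φ.map_source hx)
    simpa only [φ.left_inv hx, Function.comp_apply] using h1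

theorem multiIndexLT_subset_lengthBound {S : Finset (Fin n → List (Fin d))}
    {α : Fin n → List (Fin d)} (hα : α ∈ S) (i : Fin n) :
    multiIndexLT d ((α i).length + 1) ⊆ multiIndexLT d (lengthBound S) :=
  multiIndexLT_subset (length_lt_lengthBound hα i)

/-- All tuples of multi-indices whose lengths are bounded by those occurring in `S`. -/
def fullIndex (S : Finset (Fin n → List (Fin d))) : Finset (Fin n → List (Fin d)) :=
  Fintype.piFinset fun _ => multiIndexLT d (lengthBound S)

variable (φ x) in
/-- `inChart` as a linear map. -/
def inChartLinear : Series d →ₗ[ℝ] Series d where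
  toFun := inChart φ x
  map_add' := inChart_add φ x
  map_smul' := inChart_smul φ x

variable (φ x) in
/-- `outChart` as a linear map. -/
def outChartLinear : Series d →ₗ[ℝ] Series d where
  toFun := outChart φ x
  map_add' := linSubst_add _
  map_smul' := linSubst_smul _

variable [IsManifold (𝓡 d) ∞ M]

variable (d M) in
/-- The symbol `σ` as a linear map to smooth functions. -/
def symbolLinear : SymSection d M →ₗ[ℝ] Smooth d M where
  toFun s := ⟨symbolMap s, fun x => by
    have h := (s.2 _ (chartAt_mem_charts (d := d) x) 0).contMDiffAt
      ((OpenPartialHomeomorph.open_source _).mem_nhds (mem_chart_source _ x))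
    simp only [coeff_zero_eq_constantCoeff_apply, constantCoeff_inChart] at h
    exact h⟩
  map_add' _ _ := rfl
  map_smul' r s := ContMDiffMap.ext fun x => constantCoeff_smul (s.1 x) r

variable [T2Space M]
  {cov : CovariantDerivative (𝓡 d) (EuclideanSpace ℝ (Fin d))
    (TangentSpace (𝓡 d) : M → Type _)} {A : FibreVectorOneForm d M}

theorem smoothComb_yJet_lift (hcov : cov.ContMDiffCovariantDerivative ∞) (hD : IsFedosov cov A)
    (hφ : φ ∈ charts d M) (α : List (Fin d)) :
    SmoothComb φ.target (multiIndexLT d (α.length + 1))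
      (fun β (a : Smooth d M) => xPartial β (a ∘ φ.symm))
      (yJet (fun a => localExpr φ (lift hcov A a)) α) :=
  smoothComb_yJet φ.open_target (smoothSeriesOn_connForm hcov hφ) constantCoeff_connForm
    (fun a => smoothSeriesOn_localExpr hφ (lift hcov A a))
    (fun a _ ht i => (isFlat_lift hcov hD a).fibreConn_eq hφ ht i)
    (fun a t _ => by
      rw [localExpr, constantCoeff_inChart]; exact symbolMap_lift hcov a (φ.symm t)) α

theorem smoothComb_xPartial_lift (hcov : cov.ContMDiffCovariantDerivative ∞)
    (hD : IsFedosov cov A) (hφ : φ ∈ charts d M) (α : List (Fin d)) :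
    SmoothComb φ.target (multiIndexLT d (α.length + 1))
      (yJet (fun a => localExpr φ (lift hcov A a)))
      (fun a : Smooth d M => xPartial α (a ∘ φ.symm)) :=
  smoothComb_xPartial φ.open_target (smoothSeriesOn_connForm hcov hφ)
    (fun a => smoothSeriesOn_localExpr hφ (lift hcov A a))
    (fun a _ ht i => (isFlat_lift hcov hD a).fibreConn_eq hφ ht i)
    (fun a t _ => by
      rw [localExpr, constantCoeff_inChart]; exact symbolMap_lift hcov a (φ.symm t)) α

/-- The operator `μ(P)(a₁, …, aₙ) = σ(P(τ a₁, …, τ aₙ))`. -/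
def descend (hcov : cov.ContMDiffCovariantDerivative ∞) (A : FibreVectorOneForm d M)
    (P : MultilinearMap ℝ (fun _ : Fin n => SymSection d M) (SymSection d M)) :
    MultilinearMap ℝ (fun _ : Fin n => Smooth d M) (Smooth d M) :=
  (symbolLinear d M).compMultilinearMap (P.compLinearMap fun _ => liftLinear hcov A)

theorem descend_apply (hcov : cov.ContMDiffCovariantDerivative ∞)
    (P : MultilinearMap ℝ (fun _ : Fin n => SymSection d M) (SymSection d M))
    (a : Fin n → Smooth d M) (x : M) :
    descend hcov A P a x = symbolMap (P fun i => lift hcov A (a i)) x := rfl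

theorem descend_mem_polyDiff (hcov : cov.ContMDiffCovariantDerivative ∞) (hD : IsFedosov cov A)
    {P : MultilinearMap ℝ (fun _ : Fin n => SymSection d M) (SymSection d M)}
    (hP : P ∈ FibrePolyDiff d M n) : descend hcov A P ∈ PolyDiff d M n := by
  obtain ⟨S, hS⟩ := hP
  refine mem_polyDiff_iff.2 ⟨fullIndex S, fun φ hφ => ?_⟩
  obtain ⟨c, hc, hP⟩ := hS φ hφ
  have h : ∀ α ∈ S, SmoothComb φ.target (fullIndex S)
      (fun α (a : Fin n → Smooth d M) t => ∏ i, xPartial (α i) (a i ∘ φ.symm) t)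
      (fun a t => ∏ i, yJet (fun a => localExpr φ (lift hcov A a)) (α i) (a i) t) := fun α hα =>
    SmoothComb.prod fun i =>
      (smoothComb_yJet_lift hcov hD hφ (α i)).mono (multiIndexLT_subset_lengthBound hα i)
  refine (SmoothComb.sum fun α hα => (h α hα).smul (contDiffOn_comp_symm hφ (hc α))).congr
    fun a t ht => ?_
  rw [descend_apply, symbolMap, ← constantCoeff_inChart (φ := φ) (x := φ.symm t),
    hP _ _ (φ.map_target ht)]
  simp only [map_sum, smul_eq_C_mul, map_mul, map_prod, constantCoeff_C]
  rfl

/-- The expression of a fibrewise operator in a chart at a point is determined by the values on flat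
sections, since flat sections have arbitrary jets. -/
theorem inChart_eq_polyOp (hcov : cov.ContMDiffCovariantDerivative ∞) (hD : IsFedosov cov A)
    (hφ : φ ∈ charts d M) (hx : x ∈ φ.source)
    {P : MultilinearMap ℝ (fun _ : Fin n => SymSection d M) (SymSection d M)}
    (hP : P ∈ FibrePolyDiff d M n) {S : Finset (Fin n → List (Fin d))}
    {c : (Fin n → List (Fin d)) → ℝ}
    (h : ∀ a : Fin n → Smooth d M, descend hcov A P a x =
      constantCoeff (polyOp S c fun i => inChart φ x ((lift hcov A (a i)).1 x)))
    (s : Fin n → SymSection d M) :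
    inChart φ x ((P s).1 x) = polyOp S c fun i => inChart φ x ((s i).1 x) := by
  obtain ⟨S', hS'⟩ := hP
  obtain ⟨c', -, hP⟩ := hS' φ hφ
  simp only [← polyOp_apply (c := fun α => c' α _)] at hP
  rw [hP s x hx]
  have h1 := linSubst_polyOp_eq (S := S') (S' := S) (c := fun α => c' α x) (c' := c)
    (J := fun m i => if m = i then 1 else 0)
    (e := fun a => inChart φ x ((lift hcov A a).1 x))
    (exists_lift_jet hcov hD hφ hx) (fun a => by
      simp only [linSubst_id, ← h, ← hP _ x hx, constantCoeff_inChart]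
      rfl)
    fun i => inChart φ x ((s i).1 x)
  simpa only [linSubst_id] using h1

theorem descend_injective (hcov : cov.ContMDiffCovariantDerivative ∞) (hD : IsFedosov cov A)
    {P P' : MultilinearMap ℝ (fun _ : Fin n => SymSection d M) (SymSection d M)}
    (hP : P ∈ FibrePolyDiff d M n) (hP' : P' ∈ FibrePolyDiff d M n)
    (h : descend hcov A P = descend hcov A P') : P = P' := by
  obtain ⟨S', hS'⟩ := hP'
  refine MultilinearMap.ext fun s => Subtype.ext (funext fun x => ?_)
  have hφ := chartAt_mem_charts (d := d) x
  have hx := mem_chart_source (EuclideanSpace ℝ (Fin d)) x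
  obtain ⟨c', -, hP'⟩ := hS' _ hφ
  simp only [← polyOp_apply (c := fun α => c' α _)] at hP'
  refine inChart_injective hφ hx ?_
  rw [hP' s x hx]
  refine inChart_eq_polyOp hcov hD hφ hx hP (fun a => ?_) s
  rw [h, ← hP' _ x hx, constantCoeff_inChart]
  rfl

/-- The local operators with symbols prescribed on flat sections fit together. -/
theorem linSubst_jac_polyOp (hcov : cov.ContMDiffCovariantDerivative ∞) (hD : IsFedosov cov A)
    (hφ : φ ∈ charts d M) (hx : x ∈ φ.source) {S S' : Finset (Fin n → List (Fin d))} {c c' : (Fin n → List (Fin d)) → ℝ}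
    (h : ∀ a : Fin n → Smooth d M,
      constantCoeff (polyOp S c fun i => inChart φ x ((lift hcov A (a i)).1 x)) =
      constantCoeff (polyOp S' c' fun i => inChart ψ x ((lift hcov A (a i)).1 x)))
    (f : Fin n → Series d) :
    inChart ψ x (outChart φ x (polyOp S c fun i => inChart φ x (f i))) =
      polyOp S' c' fun i => inChart ψ x (f i) := by
  have h1 := linSubst_polyOp_eq (S := S) (S' := S') (J := jac φ ψ x)
    (e := fun a => inChart φ x ((lift hcov A a).1 x))
    (exists_lift_jet hcov hD hφ hx) (fun a => by
      simp only [← inChart_eq_linSubst_jac hφ hx]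
      exact h a)
    fun i => inChart φ x (f i)
  rw [inChart_eq_linSubst_jac hφ hx, inChart_outChart hφ hx, h1]
  simp only [← inChart_eq_linSubst_jac hφ hx]

/-- The fibrewise operator with given expressions `∑_α c^φ_α ∂_y^α` in the charts, the one in the
preferred chart at each point being used to define it. -/
def glueOp (S : Finset (Fin n → List (Fin d)))
    (c : OpenPartialHomeomorph M (EuclideanSpace ℝ (Fin d)) → (Fin n → List (Fin d)) → M → ℝ) :
    MultilinearMap ℝ (fun _ : Fin n => SymSection d M) (M → Series d) :=
  MultilinearMap.pi fun x =>
    (outChartLinear (chartAt (EuclideanSpace ℝ (Fin d)) x) x).compMultilinearMap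
      ((polyOp S fun α => c (chartAt (EuclideanSpace ℝ (Fin d)) x) α x).compLinearMap fun _ =>
        (inChartLinear (chartAt (EuclideanSpace ℝ (Fin d)) x) x).comp
          ((LinearMap.proj x).comp (SymSection d M).subtype))

/-- Every polydifferential operator comes from a fibrewise one, with the expression in a chart given
by any expression of the operator in terms of the Taylor coefficients of flat sections. -/
theorem exists_fibre_operator (hcov : cov.ContMDiffCovariantDerivative ∞) (hD : IsFedosov cov A)
    {Q : MultilinearMap ℝ (fun _ : Fin n => Smooth d M) (Smooth d M)}
    {S : Finset (Fin n → List (Fin d))}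
    (hQ : ∀ φ ∈ charts d M, SmoothComb φ.target S
      (fun α a t => ∏ i, yJet (fun a => localExpr φ (lift hcov A a)) (α i) (a i) t)
      (fun a t => Q a (φ.symm t))) :
    ∃ P ∈ FibrePolyDiff d M n, descend hcov A P = Q := by
  classical
  choose! c hc hQ using hQ
  have hc' : ∀ φ ∈ charts d M, ∀ x ∈ φ.source, ∀ a : Fin n → Smooth d M,
      constantCoeff (polyOp S (fun α => c φ α (φ x))
        fun i => inChart φ x ((lift hcov A (a i)).1 x)) = Q a x := by
    intro φ hφ x hx a
    have h := hQ φ hφ a _ (φ.map_source hx)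
    simp only [φ.left_inv hx] at h
    rw [h, constantCoeff_polyOp]
    simp only [yJet, localExpr_apply hx]
  have hglue : ∀ φ ∈ charts d M, ∀ x ∈ φ.source, ∀ s : Fin n → SymSection d M,
      inChart φ x (glueOp S (fun φ α x => c φ α (φ x)) s x) =
        polyOp S (fun α => c φ α (φ x)) fun i => inChart φ x ((s i).1 x) := by
    intro φ hφ x hx s
    have hκ := chartAt_mem_charts (d := d) x
    have hxκ := mem_chart_source (EuclideanSpace ℝ (Fin d)) x
    exact linSubst_jac_polyOp hcov hD hκ hxκ
      (fun a => (hc' _ hκ x hxκ a).trans (hc' φ hφ x hx a).symm) fun i => (s i).1 x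
  have hmem : ∀ s : Fin n → SymSection d M,
      glueOp S (fun φ α x => c φ α (φ x)) s ∈ SymSection d M := by
    intro s φ hφ m
    have hsm : SmoothSeriesOn φ.target (fun t =>
        ∑ α ∈ S, C (c φ α t) * ∏ i, yPartial (α i) (localExpr φ (s i) t)) :=
      SmoothSeriesOn.sum fun α _ => (smoothSeriesOn_C (hc φ hφ α)).mul
        (SmoothSeriesOn.prod fun i _ => (smoothSeriesOn_localExpr hφ (s i)).yPartial (α i))
    refine (contMDiffOn_comp_chart hφ (hsm m)).congr fun x hx => ?_
    rw [hglue φ hφ x hx, polyOp_apply]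
    simp only [Function.comp_apply, smul_eq_C_mul, localExpr_apply hx]
  refine ⟨(glueOp S fun φ α x => c φ α (φ x)).codRestrict _ hmem,
    ⟨S, fun φ hφ => ⟨fun α x => c φ α (φ x), fun α => contMDiffOn_comp_chart hφ (hc φ hφ α),
      fun s x hx => ?_⟩⟩, MultilinearMap.ext fun a => ContMDiffMap.ext fun x => ?_⟩
  · rw [← polyOp_apply (c := fun α => c φ α (φ x))]
    exact hglue φ hφ x hx s
  · have hκ := chartAt_mem_charts (d := d) x
    have hxκ := mem_chart_source (EuclideanSpace ℝ (Fin d)) x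
    rw [descend_apply, symbolMap,
      ← constantCoeff_inChart (φ := chartAt (EuclideanSpace ℝ (Fin d)) x) (x := x)]
    exact (congrArg _ (hglue _ hκ x hxκ _)).trans (hc' _ hκ x hxκ a)

theorem descend_surjective (hcov : cov.ContMDiffCovariantDerivative ∞) (hD : IsFedosov cov A)
    {Q : MultilinearMap ℝ (fun _ : Fin n => Smooth d M) (Smooth d M)}
    (hQ : Q ∈ PolyDiff d M n) : ∃ P ∈ FibrePolyDiff d M n, descend hcov A P = Q := by
  obtain ⟨S, hS⟩ := mem_polyDiff_iff.1 hQ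
  exact exists_fibre_operator hcov hD (S := fullIndex S) fun φ hφ =>
    (hS φ hφ).trans fun α hα => SmoothComb.prod fun i =>
      (smoothComb_xPartial_lift hcov hD hφ (α i)).mono (multiIndexLT_subset_lengthBound hα i)

/-- The isomorphism `μ` in one degree. -/
def descendEquiv (hcov : cov.ContMDiffCovariantDerivative ∞) (hD : IsFedosov cov A) (n : ℕ) :
    FibrePolyDiff d M n ≃ₗ[ℝ] PolyDiff d M n :=
  LinearEquiv.ofBijective
    { toFun := fun P => ⟨descend hcov A P.1, descend_mem_polyDiff hcov hD P.2⟩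
      map_add' := fun P P' => Subtype.ext (MultilinearMap.ext fun a =>
        (symbolLinear d M).map_add _ _)
      map_smul' := fun r P => Subtype.ext (MultilinearMap.ext fun a =>
        (symbolLinear d M).map_smul r _) }
    ⟨fun P P' h =>
        Subtype.ext (descend_injective hcov hD P.2 P'.2 (congrArg Subtype.val h)),
      fun Q => by
        obtain ⟨P, hP, h⟩ := descend_surjective hcov hD Q.2
        exact ⟨⟨P, hP⟩, Subtype.ext h⟩⟩

end Operators

/-! ### Polyvectors in a frame -/

section Exterior

variable {d n : ℕ} {V : Type*} [AddCommGroup V] [Module ℝ V] (e : Fin d → V)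

/-- With antisymmetric coefficients, `∂_{j₁} ∧ ⋯ ∧ ∂_{jₙ}` pairs like `n! ∂_{j₁} ⊗ ⋯ ⊗ ∂_{jₙ}`. -/
theorem pairingDual_sum_smul_ιMulti {v : (Fin n → Fin d) → ℝ}
    (hv : ∀ (π : Equiv.Perm (Fin n)) J, v (J ∘ π) = ((Equiv.Perm.sign π : ℤ) : ℝ) * v J)
    (θ : Fin n → Module.Dual ℝ V) :
    exteriorPower.pairingDual ℝ V n (exteriorPower.ιMulti ℝ n θ)
      (((n.factorial : ℝ)⁻¹) • ∑ J, v J • exteriorPower.ιMulti ℝ n (e ∘ J)) =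
      ∑ J, v J * ∏ i, θ i (e (J i)) := by
  -- each permutation in the expansion of the determinant contributes the same, after `J ↦ J ∘ σ`
  have hσ : ∀ σ : Equiv.Perm (Fin n), ∑ J : Fin n → Fin d,
      v J * (((Equiv.Perm.sign σ : ℤ) : ℝ) * ∏ i, θ i (e (J (σ i)))) =
        ∑ J, v J * ∏ i, θ i (e (J i)) := fun σ => by
    rw [← (Equiv.arrowCongr σ.symm (Equiv.refl (Fin d))).sum_comp
      fun J => v J * ∏ i, θ i (e (J i))]
    refine Finset.sum_congr rfl fun J _ => ?_
    have h1 : Equiv.arrowCongr σ.symm (Equiv.refl (Fin d)) J = J ∘ σ := rfl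
    rw [h1, hv]
    simp only [Function.comp_apply]
    ring
  simp only [map_smul, map_sum, exteriorPower.pairingDual_ιMulti_ιMulti, Matrix.det_apply,
    Matrix.of_apply, Function.comp_apply, smul_eq_mul, Units.smul_def, zsmul_eq_mul,
    Finset.mul_sum (s := (Finset.univ : Finset (Equiv.Perm (Fin n))))]
  rw [Finset.sum_comm, Finset.sum_congr rfl fun σ _ => hσ σ, Finset.sum_const, Finset.card_univ,
    Fintype.card_perm, Fintype.card_fin, nsmul_eq_mul, ← mul_assoc,
    inv_mul_cancel₀ (Nat.cast_ne_zero.2 n.factorial_ne_zero), one_mul]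

/-- The expansion of a polyvector in a frame. -/
theorem eq_sum_pairingDual_smul_ιMulti {ε : Fin d → Module.Dual ℝ V}
    (he : ∀ u, ∑ i, ε i u • e i = u) (w : ⋀[ℝ]^n V) :
    w = ((n.factorial : ℝ)⁻¹) • ∑ J : Fin n → Fin d,
      exteriorPower.pairingDual ℝ V n (exteriorPower.ιMulti ℝ n (ε ∘ J)) w •
        exteriorPower.ιMulti ℝ n (e ∘ J) := by
  suffices h : (LinearMap.id : ⋀[ℝ]^n V →ₗ[ℝ] ⋀[ℝ]^n V) =
      ((n.factorial : ℝ)⁻¹) • ∑ J : Fin n → Fin d,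
        (exteriorPower.pairingDual ℝ V n (exteriorPower.ιMulti ℝ n (ε ∘ J))).smulRight
          (exteriorPower.ιMulti ℝ n (e ∘ J)) by
    simpa [_root_.sum_apply] using congrArg (fun L => L w) h
  refine exteriorPower.linearMap_ext (AlternatingMap.ext fun u => ?_)
  have hσ : ∀ σ : Equiv.Perm (Fin n), ∑ J : Fin n → Fin d,
      (((Equiv.Perm.sign σ : ℤ) : ℝ) * ∏ i, ε (J i) (u (σ i))) •
        exteriorPower.ιMulti ℝ n (e ∘ J) = exteriorPower.ιMulti ℝ n u := fun σ => by
    have h1 : exteriorPower.ιMulti ℝ n (u ∘ σ) =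
        ∑ J : Fin n → Fin d, (∏ i, ε (J i) (u (σ i))) • exteriorPower.ιMulti ℝ n (e ∘ J) := by
      have h2 : u ∘ σ = fun i => ∑ j, ε j (u (σ i)) • e j := funext fun i => (he _).symm
      rw [h2, ← AlternatingMap.coe_multilinearMap, MultilinearMap.map_sum]
      exact Finset.sum_congr rfl fun J _ => MultilinearMap.map_smul_univ _ _ _
    simp only [mul_smul, ← Finset.smul_sum]
    rw [← h1, AlternatingMap.map_perm, Units.smul_def, ← Int.cast_smul_eq_zsmul ℝ, smul_smul]
    rw [← Int.cast_mul, ← Units.val_mul, Int.units_mul_self, Units.val_one, Int.cast_one, one_smul]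
  have h3 : ∑ J : Fin n → Fin d,
      exteriorPower.pairingDual ℝ V n (exteriorPower.ιMulti ℝ n (ε ∘ J))
        (exteriorPower.ιMulti ℝ n u) • exteriorPower.ιMulti ℝ n (e ∘ J) =
      (n.factorial : ℝ) • exteriorPower.ιMulti ℝ n u := by
    simp only [exteriorPower.pairingDual_ιMulti_ιMulti, Matrix.det_apply, Matrix.of_apply,
      Function.comp_apply, Units.smul_def, zsmul_eq_mul, Finset.sum_smul]
    rw [Finset.sum_comm, Finset.sum_congr rfl fun σ _ => hσ σ, Finset.sum_const, Finset.card_univ,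
      Fintype.card_perm, Fintype.card_fin, Nat.cast_smul_eq_nsmul]
  have h4 : exteriorPower.ιMulti ℝ n u = ((n.factorial : ℝ)⁻¹) • ∑ J : Fin n → Fin d,
      exteriorPower.pairingDual ℝ V n (exteriorPower.ιMulti ℝ n (ε ∘ J))
        (exteriorPower.ιMulti ℝ n u) • exteriorPower.ιMulti ℝ n (e ∘ J) := by
    rw [h3, smul_smul, inv_mul_cancel₀ (Nat.cast_ne_zero.2 n.factorial_ne_zero), one_smul]
  refine h4.trans ?_
  rw [LinearMap.compAlternatingMap_apply, LinearMap.smul_apply, LinearMap.sum_apply]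
  rfl

theorem pairingDual_perm (π : Equiv.Perm (Fin n)) (θ : Fin n → Module.Dual ℝ V) (w : ⋀[ℝ]^n V) :
    exteriorPower.pairingDual ℝ V n (exteriorPower.ιMulti ℝ n (θ ∘ π)) w =
      ((Equiv.Perm.sign π : ℤ) : ℝ) *
        exteriorPower.pairingDual ℝ V n (exteriorPower.ιMulti ℝ n θ) w := by
  rw [AlternatingMap.map_perm, Units.smul_def, map_zsmul]
  exact zsmul_eq_mul _ _

/-- The pairing with a fixed polyvector, as a multilinear function of covectors. -/
def pairingMultilinear (w : ⋀[ℝ]^n V) : MultilinearMap ℝ (fun _ : Fin n => Module.Dual ℝ V) ℝ :=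
  ((exteriorPower.pairingDual ℝ V n).flip w).compMultilinearMap
    (exteriorPower.ιMulti ℝ n).toMultilinearMap

end Exterior

/-! ### The comparison of polyvector fields -/

section PolyVectors

variable {d n : ℕ} {M : Type*} [TopologicalSpace M] [ChartedSpace (EuclideanSpace ℝ (Fin d)) M]
  {φ ψ : OpenPartialHomeomorph M (EuclideanSpace ℝ (Fin d))} {x : M}

variable (φ x) in
/-- The polyvector `(1/n!) ∑_J v_J ∂_{j₁} ∧ ⋯ ∧ ∂_{jₙ}`. It corresponds to the operator
`∑_J v_J ∂_{j₁} ⊗ ⋯ ⊗ ∂_{jₙ}` if `v` is antisymmetric. -/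
def frameVector (v : (Fin n → Fin d) → ℝ) : ⋀[ℝ]^n (TangentSpace (𝓡 d) x) :=
  ((n.factorial : ℝ)⁻¹) • ∑ J, v J • exteriorPower.ιMulti ℝ n ((fun i => frame φ i x) ∘ J)

theorem pairing_frameVector {v : (Fin n → Fin d) → ℝ}
    (hv : ∀ (π : Equiv.Perm (Fin n)) J, v (J ∘ π) = ((Equiv.Perm.sign π : ℤ) : ℝ) * v J)
    (θ : Fin n → Module.Dual ℝ (TangentSpace (𝓡 d) x)) :
    pairing θ (frameVector φ x v) = ∑ J, v J * ∏ i, θ i (frame φ (J i) x) :=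
  pairingDual_sum_smul_ιMulti _ hv θ

theorem eq_frameVector (hφ : φ ∈ charts d M) (hx : x ∈ φ.source)
    (w : ⋀[ℝ]^n (TangentSpace (𝓡 d) x)) :
    w = frameVector φ x fun J => pairing (fun i => coframe φ (J i) x) w :=
  eq_sum_pairingDual_smul_ιMulti (fun i => frame φ i x) (ε := fun i => coframe φ i x)
    (sum_coframe_smul_frame hφ hx) w

theorem pairing_perm (π : Equiv.Perm (Fin n)) (θ : Fin n → Module.Dual ℝ (TangentSpace (𝓡 d) x))
    (w : ⋀[ℝ]^n (TangentSpace (𝓡 d) x)) :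
    pairing (fun i => θ (π i)) w = ((Equiv.Perm.sign π : ℤ) : ℝ) * pairing θ w :=
  pairingDual_perm π θ w

/-- The expression of the pairing in a frame. -/
theorem pairing_eq_sum (hφ : φ ∈ charts d M) (hx : x ∈ φ.source)
    (θ : Fin n → Module.Dual ℝ (TangentSpace (𝓡 d) x)) (w : ⋀[ℝ]^n (TangentSpace (𝓡 d) x)) :
    pairing θ w =
      ∑ J : Fin n → Fin d, pairing (fun i => coframe φ (J i) x) w * ∏ i, θ i (frame φ (J i) x) := by
  conv_lhs => rw [eq_frameVector hφ hx w]
  exact pairing_frameVector (fun π J => pairing_perm π (fun i => coframe φ (J i) x) w) θ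

theorem mdifferentiableAt_smooth (a : Smooth d M) (x : M) :
    MDifferentiableAt (𝓡 d) 𝓘(ℝ, ℝ) a x :=
  a.contMDiff.mdifferentiableAt (by simp)

theorem eq_of_apply_frame (hφ : φ ∈ charts d M) (hx : x ∈ φ.source)
    {θ η : Module.Dual ℝ (TangentSpace (𝓡 d) x)} (h : ∀ j, θ (frame φ j x) = η (frame φ j x)) :
    θ = η := by
  refine LinearMap.ext fun v => ?_
  rw [← sum_coframe_smul_frame hφ hx v, map_sum, map_sum]
  exact Finset.sum_congr rfl fun j _ => by rw [map_smul, map_smul, h]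

theorem dif_add (a b : Smooth d M) (x : M) : dif (d := d) (a + b : Smooth d M) x = dif a x + dif b x := by
  have h := mvfderiv_add (mdifferentiableAt_smooth a x) (mdifferentiableAt_smooth b x)
  exact congrArg ContinuousLinearMap.toLinearMap h

theorem dif_smul (r : ℝ) (a : Smooth d M) (x : M) : dif (d := d) (r • a : Smooth d M) x = r • dif a x := by
  have h := mvfderiv_smul (a := fun _ : M => r) mdifferentiableAt_const
    (mdifferentiableAt_smooth a x)
  rw [mvfderiv_const, ContinuousLinearMap.zero_smulRight, add_zero] at h
  exact congrArg ContinuousLinearMap.toLinearMap h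

theorem contMDiffOn_sum_mul_prod_fderiv (hφ : φ ∈ charts d M) {g : (Fin n → Fin d) → M → ℝ}
    (hg : ∀ J, ContMDiffOn (𝓡 d) 𝓘(ℝ, ℝ) ∞ (g J) φ.source) (a : Fin n → Smooth d M) :
    ContMDiffOn (𝓡 d) 𝓘(ℝ, ℝ) ∞
      (fun y => ∑ J, g J y * ∏ i, fderiv ℝ (a i ∘ φ.symm) (φ y) (stdVec (J i))) φ.source := by
  have h : ContDiffOn ℝ ∞ (fun t => ∑ J : Fin n → Fin d,
      g J (φ.symm t) * ∏ i, fderiv ℝ (a i ∘ φ.symm) t (stdVec (J i))) φ.target :=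
    ContDiffOn.sum fun J _ => (contDiffOn_comp_symm hφ (hg J)).mul (contDiffOn_prod fun i _ =>
      contDiffOn_fderiv_apply φ.open_target (contDiffOn_smooth_comp_symm hφ (a i)) _)
  refine (contMDiffOn_comp_chart hφ h).congr fun y hy => ?_
  simp only [Function.comp_apply, φ.left_inv hy]

variable [IsManifold (𝓡 d) ∞ M]

theorem contMDiff_pairing_dif (w : PolyVector d M n) (a : Fin n → Smooth d M) :
    ContMDiff (𝓡 d) 𝓘(ℝ, ℝ) ∞ (fun x => pairing (fun i => dif (a i) x) (w.1 x)) := by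
  intro x
  have hφ := chartAt_mem_charts (d := d) x
  refine ((contMDiffOn_sum_mul_prod_fderiv hφ (w.2 _ hφ) a).congr fun y hy => ?_).contMDiffAt
    ((OpenPartialHomeomorph.open_source _).mem_nhds
      (mem_chart_source (EuclideanSpace ℝ (Fin d)) x))
  rw [pairing_eq_sum hφ hy]
  simp only [dif_frame hφ hy (mdifferentiableAt_smooth _ y)]

variable (d) in
/-- The differential at a point as a linear map. -/
def difLinear (x : M) : Smooth d M →ₗ[ℝ] Module.Dual ℝ (TangentSpace (𝓡 d) x) where
  toFun a := dif a x
  map_add' a b := dif_add a b x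
  map_smul' r a := dif_smul r a x

/-- The value at `x` of the operator defined by a polyvector at `x`. -/
def polyVectorOpAt (x : M) (w : ⋀[ℝ]^n (TangentSpace (𝓡 d) x)) :
    MultilinearMap ℝ (fun _ : Fin n => Smooth d M) ℝ :=
  (pairingMultilinear w).compLinearMap fun _ => difLinear d x

/-- The action of a polyvector field on functions. -/
def polyVectorOp (w : PolyVector d M n) :
    MultilinearMap ℝ (fun _ : Fin n => Smooth d M) (Smooth d M) where
  toFun a := ⟨fun x => pairing (fun i => dif (a i) x) (w.1 x), contMDiff_pairing_dif w a⟩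
  map_update_add' a i b b' := ContMDiffMap.ext fun x =>
    (polyVectorOpAt x (w.1 x)).map_update_add a i b b'
  map_update_smul' a i r b := ContMDiffMap.ext fun x =>
    (polyVectorOpAt x (w.1 x)).map_update_smul a i r b

theorem polyVectorOp_apply (w : PolyVector d M n) (a : Fin n → Smooth d M) (x : M) :
    polyVectorOp w a x = pairing (fun i => dif (a i) x) (w.1 x) := rfl

variable [T2Space M]

theorem exists_dif_eq_coframe (hφ : φ ∈ charts d M) (hx : x ∈ φ.source) (k : Fin d) :
    ∃ z : Smooth d M, dif z x = coframe φ k x := by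
  obtain ⟨z, -, hz⟩ := exists_smooth_coord hφ hx k
  refine ⟨z, eq_of_apply_frame hφ hx fun j => ?_⟩
  rw [dif_frame hφ hx (mdifferentiableAt_smooth z x), hz, coframe_frame hφ hx]

/-- A polyvector is determined by its pairings with differentials of functions. -/
theorem eq_of_pairing_dif_eq {w w' : ⋀[ℝ]^n (TangentSpace (𝓡 d) x)}
    (h : ∀ a : Fin n → Smooth d M,
      pairing (fun i => dif (a i) x) w = pairing (fun i => dif (a i) x) w') : w = w' := by
  have hφ := chartAt_mem_charts (d := d) x
  have hx := mem_chart_source (EuclideanSpace ℝ (Fin d)) x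
  rw [eq_frameVector hφ hx w, eq_frameVector hφ hx w']
  congr 1
  funext J
  choose z hz using fun i => exists_dif_eq_coframe hφ hx (J i)
  simpa only [hz] using h z

variable {cov : CovariantDerivative (𝓡 d) (EuclideanSpace ℝ (Fin d))
    (TangentSpace (𝓡 d) : M → Type _)} {A : FibreVectorOneForm d M}

theorem constantCoeff_pderiv_lift (hcov : cov.ContMDiffCovariantDerivative ∞)
    (hD : IsFedosov cov A) (hφ : φ ∈ charts d M) (hx : x ∈ φ.source) (j : Fin d)
    (a : Smooth d M) : constantCoeff (pderiv ℝ j (inChart φ x ((lift hcov A a).1 x))) =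
      dif a x (frame φ j x) := by
  have hsym : symbolMap (lift hcov A a) = a := funext (symbolMap_lift hcov a)
  rw [(isFlat_lift hcov hD a).constantCoeff_pderiv hφ hx, hsym,
    dif_frame hφ hx (mdifferentiableAt_smooth a x)]

theorem exists_polyVector (hcov : cov.ContMDiffCovariantDerivative ∞) (hD : IsFedosov cov A)
    (P : FibrePolyVector d M n) : ∃ w : PolyVector d M n, ∀ (a : Fin n → Smooth d M) (x : M),
      descend hcov A P.1.1 a x = pairing (fun i => dif (a i) x) (w.1 x) := by
  choose! v hv hanti hP using P.2
  have hdesc : ∀ φ ∈ charts d M, ∀ x ∈ φ.source, ∀ a : Fin n → Smooth d M,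
      descend hcov A P.1.1 a x = ∑ J, v φ J x * ∏ i, dif (a i) x (frame φ (J i) x) := by
    intro φ hφ x hx a
    rw [descend_apply, symbolMap, ← constantCoeff_inChart (φ := φ) (x := x), hP φ hφ _ x hx]
    simp only [map_sum, smul_eq_C_mul, map_mul, map_prod, constantCoeff_C,
      constantCoeff_pderiv_lift hcov hD hφ hx]
  have hpair : ∀ (x : M) (a : Fin n → Smooth d M),
      pairing (fun i => dif (a i) x) (frameVector (chartAt (EuclideanSpace ℝ (Fin d)) x) x
        fun J => v (chartAt (EuclideanSpace ℝ (Fin d)) x) J x) = descend hcov A P.1.1 a x := by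
    intro x a
    have hκ := chartAt_mem_charts (d := d) x
    rw [pairing_frameVector (fun π J => hanti _ hκ π J x),
      hdesc _ hκ x (mem_chart_source (EuclideanSpace ℝ (Fin d)) x)]
  refine ⟨⟨fun x => frameVector (chartAt (EuclideanSpace ℝ (Fin d)) x) x
    fun J => v (chartAt (EuclideanSpace ℝ (Fin d)) x) J x, fun φ hφ J =>
      (hv φ hφ J).congr fun x hx => ?_⟩, fun a x => (hpair x a).symm⟩
  choose z hz using fun i => exists_dif_eq_coframe hφ hx (J i)
  have h := hpair x z
  simp only [hdesc φ hφ x hx, hz, coframe_frame hφ hx] at h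
  refine h.trans ?_
  rw [Finset.sum_eq_single J]
  · simp
  · intro K _ hK
    obtain ⟨i, hi⟩ := Function.ne_iff.1 hK
    rw [Finset.prod_eq_zero (Finset.mem_univ i) (if_neg hi.symm), mul_zero]
  · simp

/-- The multi-indices `(j₁), …, (jₙ)` of length one. -/
def singletonIndex (d n : ℕ) : (Fin n → Fin d) ↪ (Fin n → List (Fin d)) where
  toFun J i := [J i]
  inj' J K h := funext fun i => by simpa using congrFun h i

theorem polyOp_singletonIndex (v : (Fin n → Fin d) → ℝ) (f : Fin n → Series d) :
    polyOp (Finset.univ.map (singletonIndex d n)) (Function.extend (singletonIndex d n) v 0) f =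
      ∑ J, v J • ∏ i, pderiv ℝ (J i) (f i) := by
  simp only [polyOp_apply, Finset.sum_map, (singletonIndex d n).injective.extend_apply]
  rfl

theorem exists_fibrePolyVector (hcov : cov.ContMDiffCovariantDerivative ∞)
    (hD : IsFedosov cov A) (w : PolyVector d M n) :
    ∃ P : FibrePolyVector d M n, descend hcov A P.1.1 = polyVectorOp w := by
  have hw : ∀ φ ∈ charts d M, ∀ x ∈ φ.source, ∀ a : Fin n → Smooth d M, polyVectorOp w a x =
      ∑ J : Fin n → Fin d, pairing (fun i => coframe φ (J i) x) (w.1 x) *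
        ∏ i, constantCoeff (pderiv ℝ (J i) (inChart φ x ((lift hcov A (a i)).1 x))) := by
    intro φ hφ x hx a
    rw [polyVectorOp_apply, pairing_eq_sum hφ hx]
    simp only [constantCoeff_pderiv_lift hcov hD hφ hx]
  obtain ⟨P, hP, hPw⟩ := exists_fibre_operator hcov hD (Q := polyVectorOp w)
    (S := Finset.univ.map (singletonIndex d n)) fun φ hφ =>
    (SmoothComb.sum (s := Finset.univ) fun J _ => (SmoothComb.of_mem
      (Finset.mem_map_of_mem (singletonIndex d n) (Finset.mem_univ J))).smul
        (contDiffOn_comp_symm hφ (w.2 φ hφ J))).congr fun a t ht => hw φ hφ _ (φ.map_target ht) a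
  refine ⟨⟨⟨P, hP⟩, fun φ hφ => ⟨fun J x => pairing (fun i => coframe φ (J i) x) (w.1 x),
    w.2 φ hφ, fun π J x => pairing_perm π (fun i => coframe φ (J i) x) (w.1 x),
    fun s x hx => ?_⟩⟩, hPw⟩
  rw [← polyOp_singletonIndex fun J => pairing (fun i => coframe φ (J i) x) (w.1 x)]
  refine inChart_eq_polyOp hcov hD hφ hx hP (fun a => ?_) s
  rw [hPw, hw φ hφ x hx, polyOp_singletonIndex]
  simp only [map_sum, smul_eq_C_mul, map_mul, map_prod, constantCoeff_C]

/-- The isomorphism from fibrewise polyvector fields to polyvector fields in one degree. -/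
theorem exists_polyVectorEquiv (hcov : cov.ContMDiffCovariantDerivative ∞)
    (hD : IsFedosov cov A) (n : ℕ) : ∃ ν : FibrePolyVector d M n ≃ₗ[ℝ] PolyVector d M n,
      ∀ (P : FibrePolyVector d M n) (a : Fin n → Smooth d M) (x : M),
        descend hcov A P.1.1 a x = pairing (fun i => dif (a i) x) ((ν P).1 x) := by
  choose ν hν using exists_polyVector (n := n) hcov hD
  have hadd : ∀ P P', ν (P + P') = ν P + ν P' := fun P P' => Subtype.ext <| funext fun x =>
    eq_of_pairing_dif_eq fun a => by
      rw [← hν]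
      refine Eq.trans ?_ (map_add (exteriorPower.pairingDual ℝ (TangentSpace (𝓡 d) x) n
        (exteriorPower.ιMulti ℝ n fun i => dif (a i) x)) _ _).symm
      exact congrArg₂ (· + ·) (hν P a x) (hν P' a x)
  have hsmul : ∀ (r : ℝ) P, ν (r • P) = r • ν P := fun r P => Subtype.ext <| funext fun x =>
    eq_of_pairing_dif_eq fun a => by
      rw [← hν]
      refine Eq.trans ?_ (map_smul (exteriorPower.pairingDual ℝ (TangentSpace (𝓡 d) x) n
        (exteriorPower.ιMulti ℝ n fun i => dif (a i) x)) r _).symm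
      refine (constantCoeff_smul _ r).trans ?_
      exact congrArg (r * ·) (hν P a x)
  refine ⟨LinearEquiv.ofBijective { toFun := ν, map_add' := hadd, map_smul' := hsmul }
    ⟨fun P P' h => ?_, fun w => ?_⟩, hν⟩
  · refine Subtype.ext (Subtype.ext (descend_injective hcov hD P.1.2 P'.1.2 ?_))
    refine MultilinearMap.ext fun a => ContMDiffMap.ext fun x => ?_
    rw [hν, hν]
    exact congrArg (fun w : PolyVector d M n => pairing (fun i => dif (a i) x) (w.1 x)) h
  · obtain ⟨P, hP⟩ := exists_fibrePolyVector hcov hD w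
    refine ⟨P, Subtype.ext <| funext fun x => eq_of_pairing_dif_eq fun a => ?_⟩
    exact (hν P a x).symm.trans (by rw [hP, polyVectorOp_apply])

end PolyVectors

end Fedosov

end

theorem proposition1 (d : ℕ) (M : Type*) [TopologicalSpace M] [T2Space M]
    [SecondCountableTopology M] [ChartedSpace (EuclideanSpace ℝ (Fin d)) M]
    [IsManifold (𝓡 d) ∞ M]
    (cov : CovariantDerivative (𝓡 d) (EuclideanSpace ℝ (Fin d))
      (TangentSpace (𝓡 d) : M → Type _))
    (hcov : cov.ContMDiffCovariantDerivative ∞)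
    (htorsion : cov.torsion = 0)
    (A : Fedosov.FibreVectorOneForm d M)
    (hD : Fedosov.IsFedosov cov A) :
    ∃ (τ : Fedosov.Smooth d M → Fedosov.SymSection d M)
      (μ : (⨁ n, Fedosov.FibrePolyDiff d M n) ≃ₗ[ℝ] (⨁ n, Fedosov.PolyDiff d M n))
      (ν : (⨁ n, Fedosov.FibrePolyVector d M n) ≃ₗ[ℝ] (⨁ n, Fedosov.PolyVector d M n)),
      -- `τ a` is the unique section `s` of `𝒮M` with `D s = 0` and `s|_{y = 0} = a`
      (∀ (a : Fedosov.Smooth d M) (s : Fedosov.SymSection d M),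
        (Fedosov.IsFlat cov A s ∧ ∀ x, Fedosov.symbolMap s x = a x) ↔ s = τ a) ∧
      -- `μ` preserves degrees, and `μ(P)(a₁, …, aₙ) = P(τ a₁, …, τ aₙ)|_{y = 0}`
      (∀ (n : ℕ) (P : Fedosov.FibrePolyDiff d M n), ∃ Q : Fedosov.PolyDiff d M n,
        μ (DirectSum.lof ℝ ℕ (fun n => Fedosov.FibrePolyDiff d M n) n P) =
            DirectSum.lof ℝ ℕ (fun n => Fedosov.PolyDiff d M n) n Q ∧
          ∀ (a : Fin n → Fedosov.Smooth d M) (x : M),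
            Q.1 a x = Fedosov.symbolMap (P.1 (fun i => τ (a i))) x) ∧
      -- `ν` preserves degrees and is the restriction of `μ` to polyvector fields, where a
      -- polyvector field `w` on `M` is the operator `(a₁, …, aₙ) ↦ ⟨da₁ ∧ ⋯ ∧ daₙ, w⟩`
      (∀ (n : ℕ) (P : Fedosov.FibrePolyVector d M n), ∃ w : Fedosov.PolyVector d M n,
        ν (DirectSum.lof ℝ ℕ (fun n => Fedosov.FibrePolyVector d M n) n P) =
            DirectSum.lof ℝ ℕ (fun n => Fedosov.PolyVector d M n) n w ∧
          ∀ (a : Fin n → Fedosov.Smooth d M) (x : M),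
            (μ (DirectSum.lof ℝ ℕ (fun n => Fedosov.FibrePolyDiff d M n) n P.1) n).1 a x =
              Fedosov.pairing (fun i => Fedosov.dif (a i) x) (w.1 x)) := by
  choose ν hν using Fedosov.exists_polyVectorEquiv hcov hD
  have hμ : ∀ n (P : Fedosov.FibrePolyDiff d M n),
      DFinsupp.mapRange.linearEquiv (Fedosov.descendEquiv hcov hD)
        (DirectSum.lof ℝ ℕ (fun n => Fedosov.FibrePolyDiff d M n) n P) =
      DirectSum.lof ℝ ℕ (fun n => Fedosov.PolyDiff d M n) n (Fedosov.descendEquiv hcov hD n P) :=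
    fun n P => DFinsupp.mapRange_single (hf := fun n => (Fedosov.descendEquiv hcov hD n).map_zero)
  refine ⟨Fedosov.lift hcov A, DFinsupp.mapRange.linearEquiv (Fedosov.descendEquiv hcov hD),
    DFinsupp.mapRange.linearEquiv ν, Fedosov.isFlat_iff_eq_lift hcov hD,
    fun n P => ⟨_, hμ n P, fun a x => rfl⟩,
    fun n P => ⟨_, DFinsupp.mapRange_single (hf := fun n => (ν n).map_zero), fun a x => ?_⟩⟩
  rw [hμ, DirectSum.lof_apply]
  exact hν n P a x
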